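/- Let $N$ be a prime. Put $\ell_N=\mathrm{num}\left(\frac{N^2-1}{24}\right)$ (numerator in lowest terms), $E_2(\tau)=1-24\sum_{n\ge 1}\sigma_1(n)q^n$ and $E_{2,N}(\tau)=\frac{N^2E_2(N\tau)-E_2(\tau)}{(N+1)(N-1)}$, where $q=e^{2\pi i\tau}$, and for $g\in\mathbb{Z}/N\mathbb{Z}$ let \[F^{(N)}_g(\tau)=\begin{cases}-\ell_N E_2(\tau)& g=e,\\ -\ell_N E_{2,N}(\tau)& g\neq e.\end{cases}\] Put $(k,r)=(1,N)$ if $N>3$, $(k,r)=(8,16)$ if $N=2$, $(k,r)=(3,9)$ if $N=3$, and $M=rN$, so that $M-k=24\ell_N$. Construction. (1) Let $\mathfrak{h}=\mathbb{C}^{24\ell_N}$ carry a non-degenerate symmetric bilinear form, let $\gamma$ be a linear automorphism of $\mathfrak h$ of order $N$ that preserves the form and has characteristic polynomial $(x^N-1)^{r}/(x-1)^{k}$, and let $V=S(b_i(-n)\mid n>0,\ 1\le i\le 24\ell_N)$ be the Heisenberg vertex algebra of $\mathfrak{h}$, with its operator $L_1(0)=\sum_{n>0}\sum_i b_i(-n)b^i(n)$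 ($b^i$ the dual basis), central charge $c_1=24\ell_N$, and the induced action of $\gamma$. (2) Let $\mathfrak p=\mathbb{C}p$ with $\langle p,p\rangle=-2$, let $\mathrm{Cliff}(\hat{\mathfrak p}_{\rm tw})$ be the Clifford algebra with generators $p(n)$, $n\in\mathbb{Z}$, and relations $p(m)p(n)+p(n)p(m)=2\delta_{m+n,0}$, and let $A(\mathfrak p)^+_{\rm tw}$ be the twisted Clifford module induced from the one-dimensional module $\mathbb{C}v^+_{\rm tw}$ with $p(n)v^+_{\rm tw}=0$ for $n>0$ and $p(0)v^+_{\rm tw}=v^+_{\rm tw}$; its operator $L(0)$ is $\frac1{16}+\frac12\sum_{n>0}n\,p(-n)p(n)$ and the central charge is $\frac12$. Let $\widetilde A_{\rm tw}$ be the tensor product of $M$ copies of $A(\mathfrak p)^+_{\rm tw}$, with $\widetilde p(0)=p(0)\otimes\cdots\otimes p(0)$, with $L_2(0)$ the sum of the operators $L(0)$ of the factors, and $c_2=M/2$. Let $\sigma$ permute the tensor factors with cycle shape $N^{r}$, where the factors are permuted as super vector spaces (with parity operator $p(0)$ and the Koszul sign rule); if $N$ is odd, one may also take the permutation without signs. (3)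 Let $\mathfrak k=\mathbb{C}^{k}$ carry a non-degenerate symmetric bilinear form and let $U$ be its Heisenberg vertex algebra, with operator $L_3(0)$ and central charge $c_3=k$. Put $W^{(N)}_{\rm tw}=V\otimes\widetilde A_{\rm tw}\otimes U$, $L(0)=L_1(0)+L_2(0)+L_3(0)$, $c=c_1+c_2+c_3$, and let $W^{(N)}_{{\rm tw},n}$ be the eigenspace of $L(0)-\frac c{24}$ for the eigenvalue $n$. Theorem. The operator $\gamma\sigma=\gamma\otimes\sigma\otimes 1$ defines an action of $\mathbb{Z}/N\mathbb{Z}$ on $W^{(N)}_{\rm tw}$, with $1$ acting as $\gamma\sigma$. The space $W^{(N)}_{\rm tw}$ is the direct sum of the finite-dimensional subspaces $W^{(N)}_{{\rm tw},n}$, $n\ge0$, and each $W^{(N)}_{{\rm tw},n}$ is the direct sum of the $\mathbb{Z}/N\mathbb{Z}$-invariant subspaces $W^{(N)}_{{\rm tw},n}(m,\varepsilon)$ on which $L_1(0)-\frac{c_1}{24}=m$ and $\widetilde p(0)=\varepsilon$, with $-\ell_N\le m\le n-\ell_N$ an integer and $\varepsilon=\pm1$. Regard $W^{(N)}_{{\rm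 tw},n}$ as the virtual $\mathbb{Z}/N\mathbb{Z}$-module $\sum_{m,\varepsilon}m\,\varepsilon\,[W^{(N)}_{{\rm tw},n}(m,\varepsilon)]$ in the Grothendieck group of finite-dimensional representations, so that the trace $\mathrm{tr}(g\mid W^{(N)}_{{\rm tw},n})$ on the virtual module is the trace of $g\,\widetilde p(0)\left(L_1(0)-\frac{c_1}{24}\right)$ on the vector space $W^{(N)}_{{\rm tw},n}$. Then $W^{(N)}_{\rm tw}$ is an infinite-dimensional virtual graded $\mathbb{Z}/N\mathbb{Z}$-module (the vector space is infinite-dimensional, and infinitely many of the virtual modules $W^{(N)}_{{\rm tw},n}$ are non-zero), and for all $g\in\mathbb{Z}/N\mathbb{Z}$ and all $\tau$ in the upper half-plane \[F^{(N)}_g(\tau)=\sum_{n=0}^{\infty}\mathrm{tr}\left(g\mid W^{(N)}_{{\rm tw},n}\right)q^n .\] -/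

import Mathlib

open scoped TensorProduct

noncomputable section

namespace PurelyEisenstein

/-! ### Numerical data attached to the prime `N` -/

/-- `ℓ_N`, the numerator of `(N² - 1) / 24` in lowest terms. -/
def ell (N : ℕ) : ℕ := ((((N : ℚ) ^ 2 - 1) / 24).num).toNat

/-- The number of `N`-cycles in the cycle shape: `16`, `9` and `N` for `N = 2`, `N = 3`
and `N > 3`. -/
def numCycles (N : ℕ) : ℕ := if N = 2 then 16 else if N = 3 then 9 else N

/-- The number of Clifford tensor factors: `32`, `27` and `N²` for `N = 2`, `N = 3` and `N > 3`. -/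
def numFermions (N : ℕ) : ℕ := N * numCycles N

/-- The dimension of `𝔨`: `8`, `3` and `1` for `N = 2`, `N = 3` and `N > 3`. -/
def kdim (N : ℕ) : ℕ := if N = 2 then 8 else if N = 3 then 3 else 1

/-! ### The Eisenstein series -/

/-- `E_{2,N}(τ) = (N² E₂(Nτ) - E₂(τ)) / ((N + 1)(N - 1))` for `N` prime, with the usual
`E₂ = 1 - 24 ∑ σ₁(n) qⁿ`. -/
def E2level (N : ℕ) (τ : UpperHalfPlane) : ℂ :=
  1 / (((N : ℂ) + 1) * ((N : ℂ) - 1)) *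
    ((N : ℂ) ^ 2 * EisensteinSeries.E2 (UpperHalfPlane.ofComplex ((N : ℂ) * (τ : ℂ)))
      - EisensteinSeries.E2 τ)

/-- The functions `F_g^{(N)}`, for `g ∈ ℤ/Nℤ` (written multiplicatively). -/
def traceFunction (N : ℕ) (g : Multiplicative (ZMod N)) (τ : UpperHalfPlane) : ℂ :=
  if g = 1 then -(ell N : ℂ) * EisensteinSeries.E2 τ else -(ell N : ℂ) * E2level N τ

/-! ### Virtual representations -/

/-- The Grothendieck group of finite-dimensional complex representations of `G`, with one relation
`[V] = [V₁] + [V₂]` for every `G`-equivariant isomorphism `V ≃ V₁ ⊕ V₂`. -/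
abbrev VirtualRep (G : Type) [Group G] : Type 1 :=
  FreeAbelianGroup (FDRep.{0} ℂ G) ⧸ AddSubgroup.closure
    {x : FreeAbelianGroup (FDRep.{0} ℂ G) | ∃ V V₁ V₂ : FDRep.{0} ℂ G,
      (∃ e : V ≃ₗ[ℂ] (V₁ × V₂), ∀ (g : G) (v : V),
        e (V.ρ g v) = (V₁.ρ g (e v).1, V₂.ρ g (e v).2)) ∧
      x = FreeAbelianGroup.of V - (FreeAbelianGroup.of V₁ + FreeAbelianGroup.of V₂)}

/-- The class of a finite-dimensional representation. -/
def VirtualRep.cls {G : Type} [Group G] (V : FDRep.{0} ℂ G) : VirtualRep G :=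
  QuotientAddGroup.mk (FreeAbelianGroup.of V)

/-- The trace of `g` on a virtual representation. -/
def VirtualRep.trace {G : Type} [Group G] (g : G) : VirtualRep G →+ ℂ :=
  QuotientAddGroup.lift _
    (FreeAbelianGroup.lift fun V : FDRep.{0} ℂ G => LinearMap.trace ℂ V (V.ρ g)) (by
      rw [AddSubgroup.closure_le]
      rintro x ⟨V, V₁, V₂, ⟨e, he⟩, rfl⟩
      have h : e.conj (V.ρ g) = LinearMap.prodMap (V₁.ρ g) (V₂.ρ g) := by
        apply LinearMap.ext
        intro w
        have := he g (e.symm w)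
        simpa [LinearEquiv.conj_apply] using this
      have h2 : LinearMap.trace ℂ V (V.ρ g)
          = LinearMap.trace ℂ V₁ (V₁.ρ g) + LinearMap.trace ℂ V₂ (V₂.ρ g) := by
        rw [← LinearMap.trace_conj' (V.ρ g) e, h, LinearMap.trace_prodMap']
      simp [h2])

/-! ### The Heisenberg vertex algebra -/

/-- The space `S(b_i(-n) | n > 0, i = 1, …, d)` of the Heisenberg vertex algebra of `𝔥 = ℂ^d` with
standard basis `b_i`; the variable `(i, n)` stands for `b_i(-n)`. -/
abbrev Heis (d : ℕ) : Type := MvPolynomial (Fin d × ℕ+) ℂ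

/-- The creation operator `a(-n)`, `n > 0`: multiplication by `∑ a_i b_i(-n)`. -/
def heisCreate {d : ℕ} (n : ℕ+) (a : Fin d → ℂ) : Module.End ℂ (Heis d) :=
  LinearMap.mulLeft ℂ (∑ i, a i • (MvPolynomial.X (i, n) : Heis d))

/-- The annihilation operator `a(n)`, `n > 0`: the derivation with `b_i(-m) ↦ n ⟨a, b_i⟩ δ_{m,n}`. -/
def heisAnnihilate {d : ℕ} (B : LinearMap.BilinForm ℂ (Fin d → ℂ)) (n : ℕ+) (a : Fin d → ℂ) :
    Module.End ℂ (Heis d) :=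
  ∑ i, ((n : ℂ) * B a (Pi.single i 1)) • (MvPolynomial.pderiv (R := ℂ) (i, n)).toLinearMap

/-- The mode `a(n)`, `n ∈ ℤ`, of the field `Y(a(-1)1, z) = ∑ a(n) z^{-n-1}`; `a(0) = 0`. -/
def heisMode {d : ℕ} (B : LinearMap.BilinForm ℂ (Fin d → ℂ)) (a : Fin d → ℂ) (n : ℤ) :
    Module.End ℂ (Heis d) :=
  if h : 0 < n then heisAnnihilate B (n.toNat.toPNat (by omega)) a
  else if h' : n < 0 then heisCreate ((-n).toNat.toPNat (by omega)) a
  else 0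

lemma heisAnnihilate_create {d : ℕ} (B : LinearMap.BilinForm ℂ (Fin d → ℂ)) (m n : ℕ+)
    (a b : Fin d → ℂ) :
    heisAnnihilate B m a * heisCreate n b - heisCreate n b * heisAnnihilate B m a
      = (if m = n then (m : ℂ) * B a b else 0) • (1 : Module.End ℂ (Heis d)) := by
  have hb : B a b = ∑ i, b i * B a (Pi.single i 1) := by
    conv_lhs => rw [← Finset.univ_sum_single b]
    rw [map_sum]
    refine Finset.sum_congr rfl fun i _ => ?_
    have : (Pi.single i (b i) : Fin d → ℂ) = b i • Pi.single i 1 := by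
      rw [← Pi.single_smul, smul_eq_mul, mul_one]
    rw [this, map_smul, smul_eq_mul]
  apply LinearMap.ext
  intro v
  have h1 : ∀ i, MvPolynomial.pderiv (i, m) (∑ j, b j • (MvPolynomial.X (j, n) : Heis d))
      = if m = n then MvPolynomial.C (b i) else 0 := by
    intro i
    rw [map_sum]
    simp_rw [Derivation.map_smul]
    rw [Finset.sum_eq_single i]
    · by_cases hmn : m = n
      · subst hmn
        simp [MvPolynomial.smul_eq_C_mul]
      · rw [MvPolynomial.pderiv_X_of_ne (by simpa using fun h => hmn h.symm)]
        simp [hmn]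
    · intro j _ hj
      rw [MvPolynomial.pderiv_X_of_ne (by simp [hj]), smul_zero]
    · simp
  simp only [heisAnnihilate, heisCreate, LinearMap.sub_apply, Module.End.mul_apply,
    LinearMap.mulLeft_apply, LinearMap.sum_apply, LinearMap.smul_apply,
    Derivation.coeFn_coe, MvPolynomial.pderiv_mul, h1, Module.End.one_apply]
  rw [Finset.mul_sum, ← Finset.sum_sub_distrib]
  by_cases hmn : m = n
  · simp only [if_pos hmn]
    rw [hb, Finset.mul_sum, Finset.sum_smul]
    refine Finset.sum_congr rfl fun i _ => ?_
    simp only [MvPolynomial.smul_eq_C_mul, map_mul]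
    ring
  · simp only [if_neg hmn]
    simp

lemma heisCreate_comm {d : ℕ} (m n : ℕ+) (a b : Fin d → ℂ) :
    (heisCreate m a * heisCreate n b : Module.End ℂ (Heis d))
      = heisCreate n b * heisCreate m a := by
  apply LinearMap.ext
  intro v
  simp only [heisCreate, Module.End.mul_apply, LinearMap.mulLeft_apply]
  ring

lemma pderiv_comm {ι : Type} (i j : ι) (v : MvPolynomial ι ℂ) :
    MvPolynomial.pderiv i (MvPolynomial.pderiv j v)
      = MvPolynomial.pderiv j (MvPolynomial.pderiv i v) := by
  classical
  have h : ⁅MvPolynomial.pderiv (R := ℂ) i, MvPolynomial.pderiv (R := ℂ) j⁆ = 0 := by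
    apply MvPolynomial.derivation_ext
    intro k
    rw [Derivation.commutator_apply]
    simp only [MvPolynomial.pderiv_X, Derivation.zero_apply]
    by_cases hi : i = k <;> by_cases hj : j = k <;> simp [hi, hj]
  have h2 := DFunLike.congr_fun h v
  rw [Derivation.commutator_apply, Derivation.zero_apply] at h2
  exact sub_eq_zero.mp h2

lemma heisAnnihilate_comm {d : ℕ} (B : LinearMap.BilinForm ℂ (Fin d → ℂ)) (m n : ℕ+)
    (a b : Fin d → ℂ) :
    heisAnnihilate B m a * heisAnnihilate B n b = heisAnnihilate B n b * heisAnnihilate B m a := by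
  simp only [heisAnnihilate, Finset.sum_mul_sum]
  rw [Finset.sum_comm]
  refine Finset.sum_congr rfl fun i _ => Finset.sum_congr rfl fun j _ => ?_
  apply LinearMap.ext
  intro v
  simp only [Module.End.mul_apply, LinearMap.smul_apply, Derivation.coeFn_coe,
    Derivation.map_smul]
  rw [pderiv_comm, smul_comm]

/-- The Heisenberg relations `[a(m), b(n)] = m ⟨a, b⟩ δ_{m+n,0}`. -/
theorem heisMode_commutator {d : ℕ} (B : LinearMap.BilinForm ℂ (Fin d → ℂ)) (hB : B.IsSymm)
    (a b : Fin d → ℂ) (m n : ℤ) :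
    heisMode B a m * heisMode B b n - heisMode B b n * heisMode B a m
      = (if m + n = 0 then (m : ℂ) * B a b else 0) • (1 : Module.End ℂ (Heis d)) := by
  have key := fun (k l : ℕ+) (x y : Fin d → ℂ) => heisAnnihilate_create B k l x y
  unfold heisMode
  rcases lt_trichotomy m 0 with hm | hm | hm <;> rcases lt_trichotomy n 0 with hn | hn | hn
  · rw [dif_neg (by omega), dif_pos hm, dif_neg (by omega), dif_pos hn, if_neg (by omega),
      zero_smul, sub_eq_zero, heisCreate_comm]
  · subst hn; simp [hm.ne]
  · rw [dif_neg (by omega), dif_pos hm, dif_pos hn, ← neg_sub, key, hB.eq b a]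
    by_cases h : m + n = 0
    · have hn' : n.toNat.toPNat (by omega) = (-m).toNat.toPNat (by omega) := by
        rw [← PNat.coe_inj]; simp only [Nat.toPNat, PNat.mk_coe]; omega
      rw [if_pos hn', if_pos h]
      have hn2 : n.toNat = (-m).toNat := by omega
      have hc : (((-m).toNat : ℕ) : ℂ) = -(m : ℂ) := by
        have : (((-m).toNat : ℕ) : ℤ) = -m := Int.toNat_of_nonneg (by omega)
        exact_mod_cast congrArg (Int.cast : ℤ → ℂ) this
      apply LinearMap.ext
      intro v
      simp only [LinearMap.neg_apply, LinearMap.smul_apply, Module.End.one_apply, Nat.toPNat,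
        PNat.mk_coe, hn2, hc, neg_mul, neg_smul, neg_neg]
    · rw [if_neg (by rw [← PNat.coe_inj]; simp only [Nat.toPNat, PNat.mk_coe]; omega), if_neg h]
      simp
  · subst hm; simp
  · subst hm hn; simp
  · subst hm; simp
  · rw [dif_pos hm, dif_neg (by omega), dif_pos hn, key]
    by_cases h : m + n = 0
    · rw [if_pos (by rw [← PNat.coe_inj]; simp only [Nat.toPNat, PNat.mk_coe]; omega), if_pos h]
      have hc : ((m.toNat : ℕ) : ℂ) = (m : ℂ) := by
        have : ((m.toNat : ℕ) : ℤ) = m := Int.toNat_of_nonneg (by omega)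
        exact_mod_cast congrArg (Int.cast : ℤ → ℂ) this
      simp [Nat.toPNat, hc]
    · rw [if_neg (by rw [← PNat.coe_inj]; simp only [Nat.toPNat, PNat.mk_coe]; omega), if_neg h]
  · subst hn; simp [hm.ne']
  · rw [dif_pos hm, dif_pos hn, if_neg (by omega), zero_smul, sub_eq_zero, heisAnnihilate_comm]

lemma heisAnnihilate_eq_zero {d : ℕ} (B : LinearMap.BilinForm ℂ (Fin d → ℂ)) (v : Heis d) :
    {n : ℕ+ | ∃ a, heisAnnihilate B n a v ≠ 0}.Finite := by
  refine (v.vars.image Prod.snd).finite_toSet.subset ?_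
  rintro n ⟨a, ha⟩
  by_contra hn
  apply ha
  simp only [heisAnnihilate, LinearMap.sum_apply, LinearMap.smul_apply, Derivation.coeFn_coe]
  refine Finset.sum_eq_zero fun i _ => ?_
  rw [MvPolynomial.pderiv_eq_zero_of_notMem_vars, smul_zero]
  intro h
  exact hn (by simpa using ⟨i, h⟩)

/-- The summand `∑_i b_i(-n) b^i(n)` of `L(0)`, where `b^i` is the basis dual to `b_i`. -/
def heisL0Term {d : ℕ} (B : LinearMap.BilinForm ℂ (Fin d → ℂ)) (hB : B.Nondegenerate) (n : ℕ+) :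
    Module.End ℂ (Heis d) :=
  ∑ i, heisCreate n (Pi.basisFun ℂ (Fin d) i) *
    heisAnnihilate B n (B.dualBasis hB (Pi.basisFun ℂ (Fin d)) i)

lemma heisL0Term_finite {d : ℕ} (B : LinearMap.BilinForm ℂ (Fin d → ℂ)) (hB : B.Nondegenerate)
    (v : Heis d) : (Function.support fun n : ℕ+ => heisL0Term B hB n v).Finite := by
  refine (heisAnnihilate_eq_zero B v).subset fun n hn => ?_
  by_contra h
  apply hn
  simp only [Set.mem_ofPred_eq, not_exists, not_not] at h
  simp [heisL0Term, LinearMap.sum_apply, h]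

/-- The operator `L(0)` of the Heisenberg vertex algebra, that is, the zero mode
`½ ∑_i ∑_{n ∈ ℤ} :b_i(-n) b^i(n): = ∑_{n > 0} ∑_i b_i(-n) b^i(n)` of the conformal vector
`½ ∑_i b_i(-1) b^i(-1) 1`; the central charge is `d`. -/
def heisL0 {d : ℕ} (B : LinearMap.BilinForm ℂ (Fin d → ℂ)) (hB : B.Nondegenerate) :
    Module.End ℂ (Heis d) where
  toFun v := ∑ᶠ n : ℕ+, heisL0Term B hB n v
  map_add' v w := by
    simp only [map_add]
    exact finsum_add_distrib (heisL0Term_finite B hB v) (heisL0Term_finite B hB w)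
  map_smul' c v := by
    simp only [map_smul, RingHom.id_apply]
    exact (smul_finsum c _).symm

/-- The extension to the Heisenberg vertex algebra of an endomorphism `γ` of `𝔥`: the algebra
endomorphism with `b_j(-n) ↦ (γ b_j)(-n)`. -/
def heisMap {d : ℕ} (γ : (Fin d → ℂ) →ₗ[ℂ] (Fin d → ℂ)) : Module.End ℂ (Heis d) :=
  (MvPolynomial.aeval fun jn : Fin d × ℕ+ =>
    ∑ i, γ (Pi.single jn.1 1) i • (MvPolynomial.X (i, jn.2) : Heis d)).toLinearMap

/-! ### The canonically twisted Clifford module -/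

/-- `\hat 𝔭_tw = 𝔭[t, t⁻¹]` for `𝔭 = ℂp`; the basis vector at `r ∈ ℤ` is `p(r) = p ⊗ t^r`. -/
abbrev ModeSpace : Type := ℤ →₀ ℂ

/-- The bilinear form with `⟨p(r), p(s)⟩ = ⟨p, p⟩ δ_{r+s,0}`, where `⟨p, p⟩ = -2`. -/
def modeForm : LinearMap.BilinForm ℂ ModeSpace :=
  Finsupp.lsum ℂ fun r : ℤ =>
    LinearMap.toSpanSingleton ℂ (ModeSpace →ₗ[ℂ] ℂ) ((-2 : ℂ) • Finsupp.lapply (-r))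

/-- The quadratic form `a ↦ -½⟨a, a⟩`. -/
def modeQuadraticForm : QuadraticForm ℂ ModeSpace :=
  (-(1 / 2) : ℂ) • LinearMap.BilinMap.toQuadraticMap modeForm

/-- `Cliff(\hat 𝔭_tw)`, with the relations `a² = -½⟨a, a⟩`, so that `p(0)² = 1`. -/
abbrev ModeAlgebra : Type := CliffordAlgebra modeQuadraticForm

/-- The element `p(n)` of `Cliff(\hat 𝔭_tw)`. -/
def pElem (n : ℤ) : ModeAlgebra := CliffordAlgebra.ι modeQuadraticForm (Finsupp.single n 1)

lemma modeQuadraticForm_polar (m n : ℤ) :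
    QuadraticMap.polar modeQuadraticForm (Finsupp.single m 1) (Finsupp.single n 1)
      = if m + n = 0 then 2 else 0 := by
  have h : ∀ r s : ℤ, modeForm (Finsupp.single r 1) (Finsupp.single s 1)
      = if r + s = 0 then -2 else 0 := by
    intro r s
    have e : s = -r ↔ r + s = 0 := by omega
    by_cases hrs : r + s = 0 <;> simp [modeForm, Finsupp.single_apply, e, hrs]
  have h2 : QuadraticMap.polar modeQuadraticForm (Finsupp.single m 1) (Finsupp.single n 1)
      = -(1 / 2) * (modeForm (Finsupp.single m 1) (Finsupp.single n 1)
        + modeForm (Finsupp.single n 1) (Finsupp.single m 1)) := by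
    simp only [QuadraticMap.polar, modeQuadraticForm, smul_apply,
      LinearMap.BilinMap.toQuadraticMap_apply, map_add, LinearMap.add_apply, smul_eq_mul]
    ring
  rw [h2, h, h, add_comm n m]
  split_ifs <;> norm_num

/-- The Clifford relations `p(m) p(n) + p(n) p(m) = 2 δ_{m+n,0}`. -/
theorem pElem_anticommutator (m n : ℤ) :
    pElem m * pElem n + pElem n * pElem m = if m + n = 0 then 2 else 0 := by
  rw [pElem, pElem, CliffordAlgebra.ι_mul_ι_add_swap, modeQuadraticForm_polar]
  split_ifs
  · exact map_ofNat _ 2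
  · exact map_zero _

/-- The left ideal generated by `p(n)`, `n > 0`, and `p(0) - 1`. -/
def vacuumIdeal : Ideal ModeAlgebra :=
  Ideal.span ({x | ∃ n : ℤ, 0 < n ∧ x = pElem n} ∪ {pElem 0 - 1})

/-- The module `A(𝔭)_tw^+` induced from the one-dimensional module `ℂ v_tw^+` over the subalgebra
generated by the `p(n)`, `n ≥ 0`, on which `p(n) v_tw^+ = 0` for `n > 0` and
`p(0) v_tw^+ = v_tw^+`. -/
def Atw : Type := ModeAlgebra ⧸ vacuumIdeal

instance : AddCommGroup Atw := inferInstanceAs (AddCommGroup (ModeAlgebra ⧸ vacuumIdeal))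

instance : Module ModeAlgebra Atw := inferInstanceAs (Module ModeAlgebra (ModeAlgebra ⧸ vacuumIdeal))

instance : Module ℂ Atw := inferInstanceAs (Module ℂ (ModeAlgebra ⧸ vacuumIdeal))

instance : IsScalarTower ℂ ModeAlgebra Atw :=
  inferInstanceAs (IsScalarTower ℂ ModeAlgebra (ModeAlgebra ⧸ vacuumIdeal))

/-- The class in `A(𝔭)_tw^+` of an element `x` of the Clifford algebra, that is, `x v_tw^+`. -/
def Atw.mk : ModeAlgebra →ₗ[ModeAlgebra] Atw := vacuumIdeal.mkQ

/-- The mode `p(n)`, `n ∈ ℤ`, of the field `Y_tw(p(-1/2)v, z) = ∑ p(n) z^{-n-1/2}`. -/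
def pMode (n : ℤ) : Module.End ℂ Atw := Algebra.lsmul ℂ ℂ Atw (pElem n)

lemma pMode_mk (n : ℤ) (x : ModeAlgebra) :
    pMode n (Atw.mk x) = Atw.mk (pElem n * x) := rfl

lemma Atw.mk_eq_zero {x : ModeAlgebra} : Atw.mk x = 0 ↔ x ∈ vacuumIdeal :=
  Submodule.Quotient.mk_eq_zero vacuumIdeal

lemma pMode_finite (v : Atw) : {n : ℕ | pMode (n : ℤ) v ≠ 0}.Finite := by
  obtain ⟨x, rfl⟩ := vacuumIdeal.mkQ_surjective v
  suffices h : ∃ K : ℕ, ∀ n : ℕ, K < n → pElem (n : ℤ) * x ∈ vacuumIdeal by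
    obtain ⟨K, hK⟩ := h
    refine (Set.finite_Iic K).subset fun n hn => ?_
    by_contra hlt
    apply hn
    change pMode (n : ℤ) (Atw.mk x) = 0
    rw [pMode_mk, Atw.mk_eq_zero]
    exact hK n (by simpa using hlt)
  induction x using CliffordAlgebra.left_induction with
  | algebraMap r =>
    refine ⟨0, fun n hn => ?_⟩
    rw [← Algebra.commutes]
    exact Ideal.mul_mem_left _ _ (Ideal.subset_span (Or.inl ⟨n, by exact_mod_cast hn, rfl⟩))
  | add x y hx hy =>
    obtain ⟨K, hK⟩ := hx
    obtain ⟨L, hL⟩ := hy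
    refine ⟨max K L, fun n hn => ?_⟩
    rw [mul_add]
    exact Ideal.add_mem _ (hK n (lt_of_le_of_lt (le_max_left _ _) hn))
      (hL n (lt_of_le_of_lt (le_max_right _ _) hn))
  | ι_mul x m hx =>
    obtain ⟨K, hK⟩ := hx
    induction m using Finsupp.induction_linear with
    | zero => exact ⟨0, fun n _ => by simp⟩
    | add f g hf hg =>
      obtain ⟨L, hL⟩ := hf
      obtain ⟨L', hL'⟩ := hg
      refine ⟨max L L', fun n hn => ?_⟩
      rw [map_add, add_mul, mul_add]
      exact Ideal.add_mem _ (hL n (lt_of_le_of_lt (le_max_left _ _) hn))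
        (hL' n (lt_of_le_of_lt (le_max_right _ _) hn))
    | single r c =>
      refine ⟨max K r.natAbs, fun n hn => ?_⟩
      have h1 : CliffordAlgebra.ι modeQuadraticForm (Finsupp.single r c) = c • pElem r := by
        rw [pElem, ← map_smul, Finsupp.smul_single, smul_eq_mul, mul_one]
      have h2 : pElem (n : ℤ) * pElem r = -(pElem r * pElem (n : ℤ)) := by
        rw [eq_neg_iff_add_eq_zero, pElem_anticommutator, if_neg]
        have := lt_of_le_of_lt (le_max_right K r.natAbs) hn
        omega
      have h3 : pElem (n : ℤ) * (c • pElem r * x) = (-(c • pElem r)) * (pElem (n : ℤ) * x) := by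
        calc pElem (n : ℤ) * (c • pElem r * x) = c • ((pElem (n : ℤ) * pElem r) * x) := by
              rw [← mul_assoc, mul_smul_comm, smul_mul_assoc]
          _ = (-(c • pElem r)) * (pElem (n : ℤ) * x) := by
              rw [h2, ← mul_assoc, neg_mul, neg_mul, neg_mul, smul_mul_assoc, smul_mul_assoc]
              exact smul_neg c _
      rw [h1, h3]
      exact Ideal.mul_mem_left _ _ (hK n (lt_of_le_of_lt (le_max_left _ _) hn))

/-- The summand `½ n p(-n) p(n)` of `L(0)`. -/
def cliffL0Term (n : ℕ) : Module.End ℂ Atw :=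
  ((n : ℂ) / 2) • (pMode (-(n : ℤ)) * pMode (n : ℤ))

lemma cliffL0Term_finite (v : Atw) :
    (Function.support fun n : ℕ => cliffL0Term n v).Finite := by
  refine (pMode_finite v).subset fun n hn h => hn ?_
  simp [cliffL0Term, h]

/-- The operator `L(0)` of `A(𝔭)_tw^+`, the zero mode
`1/16 + ½ ∑_{n > 0} n p(-n) p(n)` of the twisted field of the Virasoro element
`¼ p(-3/2) p(-1/2) v`, whose central charge is `1/2`. -/
def cliffL0 : Module.End ℂ Atw where
  toFun v := (1 / 16 : ℂ) • v + ∑ᶠ n : ℕ, cliffL0Term n v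
  map_add' v w := by
    simp only [map_add, smul_add]
    rw [finsum_add_distrib (cliffL0Term_finite v) (cliffL0Term_finite w), add_add_add_comm]
  map_smul' c v := by
    simp only [map_smul, RingHom.id_apply, smul_add]
    rw [smul_finsum c, smul_comm]

/-- `\tilde A(𝔭)_tw`, the tensor product of `M` copies of `A(𝔭)_tw^+`. -/
abbrev AtwTensor (M : ℕ) : Type := ⨂[ℂ] _ : Fin M, Atw

/-- `\tilde p(0) = p_1(0) ⊗ ⋯ ⊗ p_M(0)`. -/
def pTilde (M : ℕ) : Module.End ℂ (AtwTensor M) := PiTensorProduct.map fun _ => pMode 0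

/-- The operator `L_2(0)` on the tensor product, `∑_i 1 ⊗ ⋯ ⊗ L(0) ⊗ ⋯ ⊗ 1`. -/
def cliffTensorL0 (M : ℕ) : Module.End ℂ (AtwTensor M) :=
  ∑ i : Fin M, PiTensorProduct.map
    (Function.update (fun _ => (LinearMap.id : Atw →ₗ[ℂ] Atw)) i cliffL0)

/-- The permutation of the tensor factors without signs: the `i`-th factor moves to the
`π i`-th place. -/
def plainPerm {M : ℕ} (π : Equiv.Perm (Fin M)) : Module.End ℂ (AtwTensor M) :=
  (PiTensorProduct.reindex ℂ (fun _ : Fin M => Atw) π).toLinearMap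

/-- The projection of the tensor product onto the span of the pure tensors whose `i`-th entry
is odd for `i ∈ S` and even for `i ∉ S`; on each factor the parity operator is `p(0)`. -/
def parityProj {M : ℕ} (S : Finset (Fin M)) : Module.End ℂ (AtwTensor M) :=
  PiTensorProduct.map fun i =>
    if i ∈ S then (1 / 2 : ℂ) • (1 - pMode 0) else (1 / 2 : ℂ) • (1 + pMode 0)

/-- The Koszul sign of moving the `i`-th factor to the `π i`-th place when exactly the factors
with `i ∈ S` are odd: `-1` for each pair of odd factors whose order is reversed. -/
def koszulSign {M : ℕ} (π : Equiv.Perm (Fin M)) (S : Finset (Fin M)) : ℂ :=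
  (-1) ^ ((S ×ˢ S).filter fun ij => ij.1 < ij.2 ∧ π ij.2 < π ij.1).card

/-- The permutation of the tensor factors as super vector spaces, with the Koszul sign rule. -/
def koszulPerm {M : ℕ} (π : Equiv.Perm (Fin M)) : Module.End ℂ (AtwTensor M) :=
  plainPerm π * ∑ S : Finset (Fin M), koszulSign π S • parityProj S

/-! ### The module `W_tw` -/

/-- `W_tw = V ⊗ \tilde A(𝔭)_tw ⊗ U`, where `V` and `U` are the Heisenberg vertex algebras of
`𝔥 = ℂ^{24 ℓ_N}` and of `𝔨`. -/
abbrev Wtw (N : ℕ) : Type :=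
  Heis (24 * ell N) ⊗[ℂ] (AtwTensor (numFermions N) ⊗[ℂ] Heis (kdim N))

/-- `f ⊗ g ⊗ h` as an operator on `W_tw`. -/
def op (N : ℕ) (f : Module.End ℂ (Heis (24 * ell N)))
    (g : Module.End ℂ (AtwTensor (numFermions N))) (h : Module.End ℂ (Heis (kdim N))) :
    Module.End ℂ (Wtw N) :=
  TensorProduct.map f (TensorProduct.map g h)

section Operators

variable (N : ℕ)
  (B : LinearMap.BilinForm ℂ (Fin (24 * ell N) → ℂ)) (hB : B.Nondegenerate)
  (C : LinearMap.BilinForm ℂ (Fin (kdim N) → ℂ)) (hC : C.Nondegenerate)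

/-- `L_1(0) - c_1 / 24` on `W_tw`, where `c_1 = 24 ℓ_N`. -/
def shiftedL1 : Module.End ℂ (Wtw N) :=
  op N (heisL0 B hB) 1 1 - (((24 * ell N : ℕ) : ℂ) / 24) • 1

/-- `L_2(0) - c_2 / 24` on `W_tw`, where `c_2` is half the number of Clifford factors. -/
def shiftedL2 : Module.End ℂ (Wtw N) :=
  op N 1 (cliffTensorL0 (numFermions N)) 1 - (((numFermions N : ℂ) / 2) / 24) • 1

/-- `L_3(0) - c_3 / 24` on `W_tw`, where `c_3 = dim 𝔨`. -/
def shiftedL3 : Module.End ℂ (Wtw N) :=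
  op N 1 1 (heisL0 C hC) - ((kdim N : ℂ) / 24) • 1

/-- `L(0) - c / 24` with `L(0) = L_1(0) + L_2(0) + L_3(0)` and `c = c_1 + c_2 + c_3`. -/
def shiftedL : Module.End ℂ (Wtw N) :=
  shiftedL1 N B hB + shiftedL2 N + shiftedL3 N C hC

/-- `\tilde p(0)` on `W_tw`. -/
def pTildeW : Module.End ℂ (Wtw N) := op N 1 (pTilde (numFermions N)) 1

/-- `W_{tw,n}`: the part of `W_tw` on which `L(0) - c / 24` is `n`. -/
def gradedPiece (n : ℕ) : Submodule ℂ (Wtw N) :=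
  Module.End.eigenspace (shiftedL N B hB C hC) (n : ℂ)

/-- The part of `W_{tw,n}` on which `L_1(0) - c_1 / 24` is `m` and `\tilde p(0)` is `ε`. -/
def finePiece (n : ℕ) (m : ℤ) (ε : ℤˣ) : Submodule ℂ (Wtw N) :=
  gradedPiece N B hB C hC n ⊓ Module.End.eigenspace (shiftedL1 N B hB) (m : ℂ) ⊓
    Module.End.eigenspace (pTildeW N) ((ε : ℤ) : ℂ)

lemma finePiece_le (n : ℕ) (m : ℤ) (ε : ℤˣ) :
    finePiece N B hB C hC n m ε ≤ gradedPiece N B hB C hC n :=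
  inf_le_left.trans inf_le_left

/-- The class of the representation on `finePiece n m ε`. -/
def fineClass {G : Type} [Group G] (ρ : Representation ℂ G (Wtw N))
    (hfin : ∀ n, FiniteDimensional ℂ (gradedPiece N B hB C hC n))
    (hst : ∀ n m ε g, finePiece N B hB C hC n m ε ≤ (finePiece N B hB C hC n m ε).comap (ρ g))
    (n : ℕ) (m : ℤ) (ε : ℤˣ) : VirtualRep G :=
  haveI := hfin n
  haveI : Module.Finite ℂ (finePiece N B hB C hC n m ε) :=
    Submodule.finiteDimensional_of_le (finePiece_le N B hB C hC n m ε)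
  VirtualRep.cls (FDRep.of (V := finePiece N B hB C hC n m ε)
    (ρ.subrepresentation (finePiece N B hB C hC n m ε) (hst n m ε)))

/-- The values that `L_1(0) - c_1 / 24` can take on `W_{tw,n}`: `-ℓ_N, …, n - ℓ_N`. -/
def weights (n : ℕ) : Finset ℤ := Finset.Icc (-(ell N : ℤ)) ((n : ℤ) - ell N)

/-- `W_{tw,n}` as a virtual representation: each simultaneous eigenspace of the commuting operators
`L_1(0) - c_1 / 24` and `\tilde p(0)` counts with multiplicity the product `m ε` of the two
eigenvalues. -/
def virtualPiece {G : Type} [Group G] (ρ : Representation ℂ G (Wtw N))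
    (hfin : ∀ n, FiniteDimensional ℂ (gradedPiece N B hB C hC n))
    (hst : ∀ n m ε g, finePiece N B hB C hC n m ε ≤ (finePiece N B hB C hC n m ε).comap (ρ g))
    (n : ℕ) : VirtualRep G :=
  ∑ m ∈ weights N n, ∑ ε : ℤˣ, (m * (ε : ℤ)) • fineClass N B hB C hC ρ hfin hst n m ε

end Operators

end PurelyEisenstein

end

open PurelyEisenstein

noncomputable section

namespace PurelyEisenstein

/-! ### Sums over finitely supported exponents -/

section Series

/-! All operators involved are diagonal or monomial in one basis. Since `γ` has finite order, `𝔥`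
has an eigenbasis; monomials in its modes, tensored with Clifford words and with monomials of `U`,
form a basis of `W_tw` (`wBasis`). On it `L(0) - c/24`, `L_1(0) - c_1/24` and `p̃(0)` act by
scalars, while `γσ` permutes the vectors up to scalars. The vacuum shifts `-ℓ_N + M/24 - k/24`
cancel, so the degrees are nonnegative integers.

A trace of `(γσ)^a` is then a sum of diagonal entries, and only basis vectors fixed by the
permutation `σ^a` contribute, namely those whose Clifford entries are constant on its orbits. Let
`e` be the orbit length (`1` if `a = 0`, else `N`) and `R = M/e` the number of orbits. Each orbit
with an odd entry contributes `-1`: for odd `N` this comes from `p̃(0)`, for `N = 2` from the Koszul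
sign (`exists_sign`). With `λ_j` the eigenvalues of `γ^a`, the three tensor factors have the
characters `P = ∏_n ∏_j (1 - λ_j q^n)⁻¹`, `∏_n (1 - q^{en})^R` and `∏_n (1 - q^n)^{-k}`. The
characteristic polynomial gives `∏_j (1 - λ_j y) · (1 - y)^k = (1 - y^e)^R`, so their product is `1`
(`eulerSum_mul`).

Inserting `L_1(0) - c_1/24` replaces `P` by `(q d/dq - ℓ_N) P`, so what survives is the logarithmic
derivative of `P` minus `ℓ_N`, that is, `-ℓ_N + eR Λ(q^e) - k Λ(q)` with `Λ(q) = ∑ σ₁(n) q^n`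
(`hasSum_trace_series`). As `eR = M = kN²` and `k(N² - 1) = 24 ℓ_N`, this is `-ℓ_N E_2` or `-ℓ_N
E_{2,N}` (`traceFunction_eq_lambert`).

The Clifford basis rests on two facts: the vacuum is nonzero because the Clifford algebra acts on an
exterior algebra (`vacuum_ne_zero`), and the words are separated by the commuting number operators
(`linearIndependent_fockVector`). Infinitely many virtual pieces are nonzero because otherwise the
trace of the identity would be a polynomial in `q`, whereas `E_2` is unbounded as `q → 1`
(`infinite_of_hasSum_E2`). -/

lemma hasSum_mul_of_summable_norm {α β : Type*} {f : α → ℂ} {g : β → ℂ}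
    (hf : Summable fun a => ‖f a‖) (hg : Summable fun b => ‖g b‖) :
    HasSum (fun p : α × β => f p.1 * g p.2) ((∑' a, f a) * ∑' b, g b) := by
  have h := summable_mul_of_summable_norm hf hg
  exact HasSum.mul (α := ℂ) hf.of_norm.hasSum hg.of_norm.hasSum h

variable {ι : Type*}

/-- The monomial `x^s`. -/
def monom (x : ι → ℂ) (s : ι →₀ ℕ) : ℂ := s.prod fun v k => x v ^ k

lemma monom_add (x : ι → ℂ) (s t : ι →₀ ℕ) : monom x (s + t) = monom x s * monom x t := by
  classical
  exact Finsupp.prod_add_index (by simp) (by intros; rw [pow_add])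

lemma monom_single (x : ι → ℂ) (v : ι) (k : ℕ) : monom x (Finsupp.single v k) = x v ^ k := by
  simp [monom]

/-- Any finite partial sum is dominated by finitely many geometric series multiplied together, and
`1/(1-x) = 1 + x/(1-x) ≤ exp(x/(1-x))` bounds that product uniformly. -/
lemma summable_prod_pow {x : ι → ℝ} {r : ℝ} (hr : r < 1) (h0 : ∀ v, 0 ≤ x v) (hx : ∀ v, x v ≤ r)
    (hs : Summable x) : Summable fun s : ι →₀ ℕ => s.prod fun v k => x v ^ k := by
  classical
  have hs' : Summable fun v => x v / (1 - x v) := by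
    refine Summable.of_nonneg_of_le (fun v => div_nonneg (h0 v) (by linarith [hx v]))
      (fun v => ?_) (hs.div_const (1 - r))
    exact div_le_div_of_nonneg_left (h0 v) (by linarith) (by linarith [hx v])
  refine summable_of_sum_le (c := Real.exp (∑' v, x v / (1 - x v)))
    (fun s => Finset.prod_nonneg fun v _ => pow_nonneg (h0 v) _) fun A => ?_
  -- `A` is enlarged to a box, the exponents supported on `F` with `v`-th value in `t v`, because
  -- the sum over a box factors.
  set F : Finset ι := A.biUnion Finsupp.support with hF
  set t : ι → Finset ℕ := fun v => A.image fun s => s v with ht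
  have hA : A ⊆ F.finsupp t := by
    intro s hs
    rw [Finset.mem_finsupp_iff]
    exact ⟨Finset.subset_biUnion_of_mem Finsupp.support hs,
      fun v _ => Finset.mem_image_of_mem _ hs⟩
  calc ∑ s ∈ A, s.prod (fun v k => x v ^ k)
      ≤ ∑ s ∈ F.finsupp t, s.prod (fun v k => x v ^ k) :=
        Finset.sum_le_sum_of_subset_of_nonneg hA
          fun s _ _ => Finset.prod_nonneg fun v _ => pow_nonneg (h0 v) _
    _ = ∏ v ∈ F, ∑ k ∈ t v, x v ^ k := by
        rw [Finset.prod_sum, Finset.finsupp, Finset.sum_map]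
        refine Finset.sum_congr rfl fun p _ => ?_
        rw [Finsupp.prod_of_support_subset (s := F) _ (by
          simpa using Finsupp.support_indicator_subset F p) _ (by simp),
          ← Finset.prod_attach]
        refine Finset.prod_congr rfl fun v _ => ?_
        simp
    _ ≤ ∏ v ∈ F, Real.exp (x v / (1 - x v)) := by
        refine Finset.prod_le_prod (fun v _ => Finset.sum_nonneg fun k _ => pow_nonneg (h0 v) _)
          fun v _ => ?_
        have h1 : x v < 1 := (hx v).trans_lt hr
        have h2 := (summable_geometric_of_lt_one (h0 v) h1).sum_le_tsum (t v)
          fun k _ => pow_nonneg (h0 v) k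
        rw [tsum_geometric_of_lt_one (h0 v) h1] at h2
        refine h2.trans (le_trans (le_of_eq ?_) (Real.add_one_le_exp _))
        have : 1 - x v ≠ 0 := by linarith
        field_simp
        ring
    _ = Real.exp (∑ v ∈ F, x v / (1 - x v)) := (Real.exp_sum _ _).symm
    _ ≤ _ := Real.exp_le_exp.mpr (hs'.sum_le_tsum F
        fun v _ => div_nonneg (h0 v) (by linarith [hx v]))

variable {x : ι → ℂ} {r : ℝ}

lemma summable_norm_monom (hr : r < 1) (hx : ∀ v, ‖x v‖ ≤ r) (hs : Summable fun v => ‖x v‖) :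
    Summable fun s : ι →₀ ℕ => ‖monom x s‖ := by
  simpa [monom, Finsupp.prod, norm_prod] using
    summable_prod_pow hr (fun v => norm_nonneg (x v)) hx hs

/-! ### The product of all geometric series and its inverse. -/

lemma sub_indicator_add {u : ι →₀ ℕ} {T : Finset ι} (hT : T ⊆ u.support) :
    (u - Finsupp.indicator T fun _ _ => 1) + Finsupp.indicator T (fun _ _ => 1) = u := by
  classical
  refine tsub_add_cancel_of_le fun v => ?_
  by_cases hv : v ∈ T
  · have := hT hv
    simpa [hv, Nat.one_le_iff_ne_zero] using this
  · simp [hv]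

open Classical in
/-- A pair of an exponent and a set of variables is an exponent together with a set of variables in
its support. -/
def addIndicatorEquiv :
    (ι →₀ ℕ) × Finset ι ≃ Σ u : ι →₀ ℕ, (u.support.powerset : Finset (Finset ι)) where
  toFun p := ⟨p.1 + Finsupp.indicator p.2 fun _ _ => 1, p.2, by
    rw [Finset.mem_powerset]
    intro v hv
    simp [hv]⟩
  invFun p := (p.1 - Finsupp.indicator p.2.1 fun _ _ => 1, p.2.1)
  left_inv p := by simp
  right_inv := by
    rintro ⟨u, T, hT⟩
    have h := sub_indicator_add (Finset.mem_powerset.mp hT)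
    refine Sigma.ext h ?_
    refine (Subtype.heq_iff_coe_eq ?_).mpr rfl
    intro y
    simp only [h]

lemma monom_indicator (x : ι → ℂ) (T : Finset ι) :
    monom x (Finsupp.indicator T fun _ _ => 1) = ∏ v ∈ T, x v := by
  classical
  rw [monom, Finsupp.prod_of_support_subset _ (Finsupp.support_indicator_subset T _) _ (by simp)]
  exact Finset.prod_congr rfl fun v hv => by simp [hv]

/-- Group the pairs `(s, T)` by `u = s + 1_T`. The coefficient of `x^u` is the alternating sum over
the subsets of the support of `u`, which vanishes unless `u = 0`. -/
theorem tsum_monom_mul_tsum_prod_neg (hr : r < 1) (hx : ∀ v, ‖x v‖ ≤ r)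
    (hs : Summable fun v => ‖x v‖) :
    (∑' s, monom x s) * ∑' T : Finset ι, ∏ v ∈ T, (-x v) = 1 := by
  classical
  have h1 := summable_norm_monom hr hx hs
  have h2 : Summable fun T : Finset ι => ‖∏ v ∈ T, (-x v)‖ := by
    simpa [norm_prod] using summable_finsetProd_of_summable_nonneg (fun v => norm_nonneg (x v)) hs
  have h3 := hasSum_mul_of_summable_norm h1 h2
  rw [← addIndicatorEquiv.symm.hasSum_iff] at h3
  refine HasSum.unique (h3.sigma (g := fun u : ι →₀ ℕ => if u = 0 then 1 else 0) fun u => ?_)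
    (hasSum_ite_eq 0 1)
  have h4 : ∀ T : (u.support.powerset : Finset (Finset ι)),
      monom x (u - Finsupp.indicator T.1 fun _ _ => 1) * ∏ v ∈ T.1, (-x v)
        = (-1) ^ (T.1.card) * monom x u := by
    rintro ⟨T, hT⟩
    dsimp only
    conv_rhs => rw [← sub_indicator_add (Finset.mem_powerset.mp hT), monom_add, monom_indicator]
    rw [Finset.prod_neg]
    ring
  change HasSum (fun T : (u.support.powerset : Finset (Finset ι)) =>
    monom x (u - Finsupp.indicator T.1 fun _ _ => 1) * ∏ v ∈ T.1, (-x v)) _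
  simp only [h4]
  have h5 := Finset.hasSum u.support.powerset
    fun T : Finset ι => (-1 : ℂ) ^ T.card * monom x u
  refine (congrArg (HasSum _) ?_).mp h5
  rw [← Finset.sum_mul]
  have := congrArg (Int.cast : ℤ → ℂ) (Finset.sum_powerset_neg_one_pow_card (x := u.support))
  push_cast at this
  rw [this]
  by_cases hu : u = 0
  · simp [hu, monom]
  · simp [hu]

/-! ### Sums over exponents weighted by degree. -/

/-- The weighted degree of an exponent. -/
def wdeg (c : ι → ℕ) (s : ι →₀ ℕ) : ℕ := s.sum fun v k => k * c v

lemma sub_single_add {s : ι →₀ ℕ} {v : ι} {m : ℕ} (h : m < s v) :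
    (s - Finsupp.single v (m + 1)) + Finsupp.single v (m + 1) = s :=
  tsub_add_cancel_of_le (Finsupp.single_le_iff.mpr h)

lemma mem_sigma_range {s : ι →₀ ℕ} {p : Σ _ : ι, ℕ} :
    p ∈ s.support.sigma (fun v => Finset.range (s v)) ↔ p.2 < s p.1 := by
  simp only [Finset.mem_sigma, Finsupp.mem_support_iff, Finset.mem_range, and_iff_right_iff_imp]
  omega

/-- Removing a positive power of one variable from an exponent. -/
def addSingleEquiv : (Σ _ : ι, ℕ) × (ι →₀ ℕ) ≃
    Σ s : ι →₀ ℕ, (s.support.sigma fun v => Finset.range (s v) : Finset (Σ _ : ι, ℕ)) where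
  toFun p := ⟨p.2 + Finsupp.single p.1.1 (p.1.2 + 1), p.1, by
    rw [mem_sigma_range, Finsupp.add_apply, Finsupp.single_eq_same]
    omega⟩
  invFun p := (p.2.1, p.1 - Finsupp.single p.2.1.1 (p.2.1.2 + 1))
  left_inv p := by simp
  right_inv := by
    rintro ⟨s, p, hp⟩
    have h := sub_single_add (mem_sigma_range.mp hp)
    refine Sigma.ext h ?_
    refine (Subtype.heq_iff_coe_eq ?_).mpr rfl
    intro y
    simp only [h]

/-- This is the logarithmic derivative of `∏ (1 - x_v)⁻¹`. The degree of `s` counts, with weight `c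
v`, the powers `x_v^m` with `1 ≤ m ≤ s v` that can be split off from `x^s`; removing such a power
turns the sum into a product. The index `p.2` is `m - 1`. -/
theorem hasSum_wdeg_mul_monom (hr : r < 1) (hx : ∀ v, ‖x v‖ ≤ r) (hs : Summable fun v => ‖x v‖)
    (c : ι → ℕ) (hc : Summable fun p : (Σ _ : ι, ℕ) => ‖(c p.1 : ℂ) * x p.1 ^ (p.2 + 1)‖) :
    HasSum (fun s : ι →₀ ℕ => (wdeg c s : ℂ) * monom x s)
      ((∑' p : (Σ _ : ι, ℕ), (c p.1 : ℂ) * x p.1 ^ (p.2 + 1)) * ∑' s, monom x s) := by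
  have h1 := summable_norm_monom hr hx hs
  have h3 := hasSum_mul_of_summable_norm hc h1
  rw [← addSingleEquiv.symm.hasSum_iff] at h3
  refine h3.sigma fun s => ?_
  have h4 : ∀ p : (s.support.sigma fun v => Finset.range (s v) : Finset (Σ _ : ι, ℕ)),
      (c p.1.1 : ℂ) * x p.1.1 ^ (p.1.2 + 1) * monom x (s - Finsupp.single p.1.1 (p.1.2 + 1))
        = c p.1.1 * monom x s := by
    rintro ⟨p, hp⟩
    dsimp only
    conv_rhs => rw [← sub_single_add (mem_sigma_range.mp hp), monom_add, monom_single]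
    ring
  change HasSum (fun p : (s.support.sigma fun v => Finset.range (s v) : Finset (Σ _ : ι, ℕ)) =>
    (c p.1.1 : ℂ) * x p.1.1 ^ (p.1.2 + 1) * monom x (s - Finsupp.single p.1.1 (p.1.2 + 1))) _
  simp only [h4]
  have h5 := Finset.hasSum (s.support.sigma fun v => Finset.range (s v))
    fun p : (Σ _ : ι, ℕ) => (c p.1 : ℂ) * monom x s
  refine (congrArg (HasSum _) ?_).mp h5
  rw [Finset.sum_sigma, wdeg, Finsupp.sum]
  push_cast
  rw [Finset.sum_mul]
  exact Finset.sum_congr rfl fun v _ => by simp; ring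

/-- Identifies the sum over finite sets in `tsum_monom_mul_tsum_prod_neg` with an Euler product,
where factors can be regrouped. -/
lemma hasProd_one_sub (hs : Summable fun v => ‖x v‖) :
    HasProd (fun v => 1 - x v) (∑' T : Finset ι, ∏ v ∈ T, (-x v)) := by
  have h2 : Summable fun T : Finset ι => ∏ v ∈ T, (-x v) :=
    summable_finsetProd_of_summable_norm (by simpa using hs)
  simpa [sub_eq_add_neg] using hasProd_one_add_of_hasSum_prod h2.hasSum

end Series

/-! ### Eigenbases of the Heisenberg vertex algebra -/

section Heisenberg

variable {d : ℕ}

/-- The weight of the exponent of a monomial, where `b_i(-n)` has weight `n`. -/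
def heisWeight (s : Fin d × ℕ+ →₀ ℕ) : ℕ := wdeg (fun v : Fin d × ℕ+ => (v.2 : ℕ)) s

/-- The derivation with `b_i(-n) ↦ n b_i(-n)`. -/
def heisDegree (d : ℕ) : Derivation ℂ (Heis d) (Heis d) :=
  MvPolynomial.mkDerivation ℂ fun v : Fin d × ℕ+ => ((v.2 : ℕ) : ℂ) • MvPolynomial.X v

lemma heisDegree_monomial (s : Fin d × ℕ+ →₀ ℕ) :
    heisDegree d (MvPolynomial.monomial s 1) = (heisWeight s : ℂ) • MvPolynomial.monomial s 1 := by
  rw [heisDegree, MvPolynomial.mkDerivation_monomial, heisWeight, wdeg, Finsupp.sum, Finsupp.sum,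
    one_smul]
  push_cast
  rw [Finset.sum_smul]
  refine Finset.sum_congr rfl fun v hv => ?_
  have h := MvPolynomial.X_mul_pderiv_monomial (i := v) (m := s) (r := (1 : ℂ))
  rw [MvPolynomial.pderiv_monomial, one_mul, mul_comm] at h
  rw [smul_eq_mul, mul_smul_comm, h, ← Nat.cast_smul_eq_nsmul ℂ, smul_smul, mul_comm]

/-- The form drops out: pairing the dual basis vector `b^i` with the `b_j` leaves only `n
∂/∂b_i(-n)`. -/
lemma heisL0Term_apply (B : LinearMap.BilinForm ℂ (Fin d → ℂ)) (hB : B.Nondegenerate) (n : ℕ+)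
    (v : Heis d) :
    heisL0Term B hB n v
      = ∑ i, ((n : ℕ) : ℂ) • (MvPolynomial.X (i, n) * MvPolynomial.pderiv (i, n) v) := by
  simp only [heisL0Term, LinearMap.sum_apply, Module.End.mul_apply]
  refine Finset.sum_congr rfl fun i _ => ?_
  have h1 : heisAnnihilate B n (B.dualBasis hB (Pi.basisFun ℂ (Fin d)) i) v
      = ((n : ℕ) : ℂ) • MvPolynomial.pderiv (i, n) v := by
    rw [heisAnnihilate, LinearMap.sum_apply, Finset.sum_eq_single i]
    · have := B.apply_dualBasis_left hB (Pi.basisFun ℂ (Fin d)) i i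
      rw [Pi.basisFun_apply, if_pos rfl] at this
      simp [this]
    · intro j _ hj
      have := B.apply_dualBasis_left hB (Pi.basisFun ℂ (Fin d)) i j
      rw [Pi.basisFun_apply, if_neg hj] at this
      simp [this]
    · simp
  rw [h1, map_smul]
  simp [heisCreate, Pi.single_apply]

/-- As a derivation, `L(0)` can be compared with algebra maps on generators alone. -/
theorem heisL0_eq (B : LinearMap.BilinForm ℂ (Fin d → ℂ)) (hB : B.Nondegenerate) :
    heisL0 B hB = (heisDegree d).toLinearMap := by
  classical
  refine (MvPolynomial.basisMonomials (Fin d × ℕ+) ℂ).ext fun s => ?_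
  rw [MvPolynomial.coe_basisMonomials, Derivation.coeFn_coe, heisDegree_monomial]
  change ∑ᶠ n : ℕ+, heisL0Term B hB n (MvPolynomial.monomial s 1) = _
  have h1 : ∀ n : ℕ+, heisL0Term B hB n (MvPolynomial.monomial s 1)
      = ∑ i, ((s (i, n) * (n : ℕ) : ℕ) : ℂ) • MvPolynomial.monomial s (1 : ℂ) := by
    intro n
    rw [heisL0Term_apply]
    refine Finset.sum_congr rfl fun i _ => ?_
    rw [MvPolynomial.X_mul_pderiv_monomial, ← Nat.cast_smul_eq_nsmul ℂ, smul_smul, mul_comm]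
    push_cast
    rfl
  simp only [h1]
  -- Only modes `n` of variables occurring in `s` contribute, so the sum over all `n` becomes a
  -- finite double sum.
  rw [finsum_eq_sum_of_support_subset (s := s.support.image Prod.snd), Finset.sum_comm,
    ← Finset.sum_product', heisWeight, wdeg, Finsupp.sum, Nat.cast_sum, Finset.sum_smul]
  · symm
    refine Finset.sum_subset (fun v hv => ?_) fun v _ hv => ?_
    · simpa using ⟨v.1, by simpa using hv⟩
    · simp [Finsupp.notMem_support_iff.mp hv]
  · intro n hn
    obtain ⟨i, -, hi⟩ := Finset.exists_ne_zero_of_sum_ne_zero hn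
    simp only [Finset.coe_image, Set.mem_image, Finset.mem_coe, Finsupp.mem_support_iff]
    exact ⟨(i, n), fun h => hi (by simp [h]), rfl⟩

lemma heisMap_X (f : (Fin d → ℂ) →ₗ[ℂ] (Fin d → ℂ)) (j : Fin d) (n : ℕ+) :
    heisMap f (MvPolynomial.X (j, n))
      = ∑ i, f (Pi.single j 1) i • (MvPolynomial.X (i, n) : Heis d) := by
  simp [heisMap]

lemma heisMap_mul (f : (Fin d → ℂ) →ₗ[ℂ] (Fin d → ℂ)) (v w : Heis d) :
    heisMap f (v * w) = heisMap f v * heisMap f w := by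
  simp [heisMap]

lemma heisMap_C (f : (Fin d → ℂ) →ₗ[ℂ] (Fin d → ℂ)) (a : ℂ) :
    heisMap f (MvPolynomial.C a) = MvPolynomial.C a := by
  simp [heisMap]

lemma heisMap_linear (f : (Fin d → ℂ) →ₗ[ℂ] (Fin d → ℂ)) (a : Fin d → ℂ) (n : ℕ+) :
    heisMap f (∑ i, a i • (MvPolynomial.X (i, n) : Heis d))
      = ∑ i, f a i • (MvPolynomial.X (i, n) : Heis d) := by
  have h : f a = ∑ j, a j • f (Pi.single j 1) := by
    conv_lhs => rw [pi_eq_sum_univ' a, map_sum]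
    refine Finset.sum_congr rfl fun j _ => ?_
    rw [map_smul]
  simp only [map_sum, map_smul, heisMap_X, h, Finset.sum_apply, Pi.smul_apply, Finset.sum_smul,
    Finset.smul_sum, smul_smul, smul_eq_mul]
  exact Finset.sum_comm

lemma heisMap_comp (f g : (Fin d → ℂ) →ₗ[ℂ] (Fin d → ℂ)) :
    heisMap (f ∘ₗ g) = heisMap f * heisMap g := by
  apply LinearMap.ext
  intro v
  rw [Module.End.mul_apply]
  induction v using MvPolynomial.induction_on with
  | C a => simp only [heisMap_C]
  | add p q hp hq => simp only [map_add, hp, hq]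
  | mul_X p v hp => rw [heisMap_mul, heisMap_mul, heisMap_mul, hp, heisMap_X, heisMap_X,
      heisMap_linear, LinearMap.comp_apply]

lemma heisMap_id : heisMap (LinearMap.id : (Fin d → ℂ) →ₗ[ℂ] (Fin d → ℂ)) = 1 := by
  apply LinearMap.ext
  intro v
  rw [Module.End.one_apply]
  induction v using MvPolynomial.induction_on with
  | C a => simp only [heisMap_C]
  | add p q hp hq => simp only [map_add, hp, hq]
  | mul_X p v hp =>
    rw [heisMap_mul, hp, heisMap_X]
    simp [Pi.single_apply]

/-- The substitution mixes only variables `b_i(-n)` with the same `n`, hence preserves degree on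
generators; the Leibniz rule does the rest. Consequently `L_1(0)` stays diagonal in the monomials of
any basis of `𝔥`. -/
lemma heisDegree_heisMap (f : (Fin d → ℂ) →ₗ[ℂ] (Fin d → ℂ)) (v : Heis d) :
    heisDegree d (heisMap f v) = heisMap f (heisDegree d v) := by
  have hX : ∀ v, heisDegree d (MvPolynomial.X v) = ((v.2 : ℕ) : ℂ) • MvPolynomial.X v :=
    fun v => MvPolynomial.mkDerivation_X _ _ _
  induction v using MvPolynomial.induction_on with
  | C a => simp [heisMap_C, MvPolynomial.derivation_C]
  | add p q hp hq => simp only [map_add, hp, hq]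
  | mul_X p v hp =>
    have h : heisDegree d (heisMap f (MvPolynomial.X v))
        = heisMap f (heisDegree d (MvPolynomial.X v)) := by
      rw [hX, map_smul, ← Prod.mk.eta (p := v), heisMap_X, map_sum, Finset.smul_sum]
      refine Finset.sum_congr rfl fun i _ => ?_
      rw [Derivation.map_smul, hX, smul_comm]
    simp only [heisMap_mul, Derivation.leibniz, smul_eq_mul, map_add, hp, h]

/-- The monomial basis of the Heisenberg vertex algebra attached to a basis of `𝔥`. -/
def heisBasis (e : Module.Basis (Fin d) ℂ (Fin d → ℂ)) :
    Module.Basis (Fin d × ℕ+ →₀ ℕ) ℂ (Heis d) :=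
  (MvPolynomial.basisMonomials (Fin d × ℕ+) ℂ).map
    (LinearEquiv.ofLinearMap (heisMap (e.equivFun.symm : (Fin d → ℂ) →ₗ[ℂ] (Fin d → ℂ)))
      (heisMap (e.equivFun : (Fin d → ℂ) →ₗ[ℂ] (Fin d → ℂ)))
      (by
        rw [← Module.End.mul_eq_comp, ← heisMap_comp]
        simp [heisMap_id]
        rfl)
      (by
        rw [← Module.End.mul_eq_comp, ← heisMap_comp]
        simp [heisMap_id]
        rfl))

lemma heisBasis_apply (e : Module.Basis (Fin d) ℂ (Fin d → ℂ)) (s : Fin d × ℕ+ →₀ ℕ) :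
    heisBasis e s = heisMap (e.equivFun.symm : (Fin d → ℂ) →ₗ[ℂ] (Fin d → ℂ))
      (MvPolynomial.monomial s 1) := by
  simp [heisBasis]

theorem heisL0_heisBasis (B : LinearMap.BilinForm ℂ (Fin d → ℂ)) (hB : B.Nondegenerate)
    (e : Module.Basis (Fin d) ℂ (Fin d → ℂ)) (s : Fin d × ℕ+ →₀ ℕ) :
    heisL0 B hB (heisBasis e s) = (heisWeight s : ℂ) • heisBasis e s := by
  rw [heisL0_eq, heisBasis_apply, Derivation.coeFn_coe, heisDegree_heisMap, heisDegree_monomial,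
    map_smul]

theorem heisMap_heisBasis (e : Module.Basis (Fin d) ℂ (Fin d → ℂ)) (lam : Fin d → ℂ)
    (f : (Fin d → ℂ) →ₗ[ℂ] (Fin d → ℂ)) (hf : ∀ j, f (e j) = lam j • e j)
    (s : Fin d × ℕ+ →₀ ℕ) :
    heisMap f (heisBasis e s) = monom (fun v : Fin d × ℕ+ => lam v.1) s • heisBasis e s := by
  classical
  set P : (Fin d → ℂ) →ₗ[ℂ] (Fin d → ℂ) := e.equivFun.symm.toLinearMap with hP
  have hPs : ∀ j, P (Pi.single j 1) = e j := fun j => by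
    simp [hP, Module.Basis.equivFun_symm_apply, Pi.single_apply]
  rw [heisBasis_apply, ← hP]
  have hX : ∀ v : Fin d × ℕ+, heisMap f (heisMap P (MvPolynomial.X v))
      = lam v.1 • heisMap P (MvPolynomial.X v) := by
    rintro ⟨j, n⟩
    rw [heisMap_X, heisMap_linear, hPs, hf, Finset.smul_sum]
    simp [smul_smul]
  induction s using Finsupp.induction_linear with
  | zero =>
    change heisMap f (heisMap P (MvPolynomial.C 1)) = _ • heisMap P (MvPolynomial.C 1)
    rw [heisMap_C, heisMap_C, monom, Finsupp.prod_zero_index, one_smul]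
  | add s t hs ht =>
    have h : MvPolynomial.monomial (s + t) (1 : ℂ)
        = MvPolynomial.monomial s 1 * MvPolynomial.monomial t 1 := by
      rw [MvPolynomial.monomial_mul, one_mul]
    rw [h, heisMap_mul, heisMap_mul, hs, ht, monom_add, smul_mul_smul_comm]
  | single v k =>
    rw [monom_single, ← MvPolynomial.X_pow_eq_monomial]
    induction k with
    | zero =>
      rw [pow_zero, pow_zero, one_smul, ← MvPolynomial.C_1]
      simp only [heisMap_C]
    | succ k ih => rw [pow_succ, pow_succ, heisMap_mul, heisMap_mul, ih, hX, smul_mul_smul_comm]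

/-- An endomorphism of finite order is diagonalizable. -/
theorem exists_eigenbasis {N : ℕ} (hN : N ≠ 0) (f : Module.End ℂ (Fin d → ℂ)) (hf : f ^ N = 1) :
    ∃ (e : Module.Basis (Fin d) ℂ (Fin d → ℂ)) (lam : Fin d → ℂ),
      (∀ j, f (e j) = lam j • e j) ∧ (∀ j, lam j ^ N = 1) ∧
      f.charpoly = ∏ j, (Polynomial.X - Polynomial.C (lam j)) := by
  have hss : f.IsSemisimple := by
    -- `X^N - 1` annihilates `f` and is separable in characteristic zero.
    refine Module.End.isSemisimple_of_squarefree_aeval_eq_zero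
      (p := (Polynomial.X ^ N - Polynomial.C 1 : Polynomial ℂ)) ?_ (by simp [hf])
    exact (Polynomial.separable_X_pow_sub_C 1 (by exact_mod_cast hN) one_ne_zero).squarefree
  have hint := DirectSum.isInternal_submodule_of_iSupIndep_of_iSup_eq_top
    f.eigenspaces_iSupIndep hss.iSup_eigenspace_eq_top
  let v := hint.collectedBasis fun μ => Module.finBasis ℂ (f.eigenspace μ)
  have hsv : ∀ i, f (v i) = i.1 • v i := fun i =>
    Module.End.mem_eigenspace_iff.mp (hint.collectedBasis_mem _ i)
  -- The collected basis is indexed by pairs (eigenvalue, index in its eigenspace). After reindexing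
  -- by `Fin d` the eigenvalue is the first component.
  let φ := v.indexEquiv (Pi.basisFun ℂ (Fin d))
  have hev : ∀ j, f (v.reindex φ j) = (φ.symm j).1 • v.reindex φ j := fun j => by
    rw [Module.Basis.reindex_apply, hsv]
  refine ⟨v.reindex φ, fun j => (φ.symm j).1, hev, fun j => ?_, ?_⟩
  · have h : ∀ k : ℕ, (f ^ k) (v.reindex φ j) = (φ.symm j).1 ^ k • v.reindex φ j := by
      intro k
      induction k with
      | zero => simp
      | succ k ih => rw [pow_succ', Module.End.mul_apply, ih, map_smul, hev, smul_smul, pow_succ]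
    have h' := h N
    rw [hf, Module.End.one_apply] at h'
    have h2 : ((φ.symm j).1 ^ N - 1) • v.reindex φ j = 0 := by
      rw [sub_smul, one_smul, ← h', sub_self]
    exact sub_eq_zero.mp ((smul_eq_zero.mp h2).resolve_right ((v.reindex φ).ne_zero j))
  · rw [← LinearMap.charpoly_toMatrix f (v.reindex φ), ← Matrix.charpoly_diagonal]
    congr 1
    ext i j
    rw [LinearMap.toMatrix_apply, hev, map_smul, Module.Basis.repr_self, Matrix.diagonal_apply]
    by_cases h : i = j
    · subst h; simp
    · simp [h]

end Heisenberg

/-! ### The Fock model of the twisted Clifford module -/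

section Fock

/-- The exterior algebra on which the Clifford algebra acts. -/
abbrev FockModel : Type := CliffordAlgebra (0 : QuadraticForm ℂ ModeSpace)

/-- The projection to the span of the `p(r)` with `r > 0`. -/
def posPart : ModeSpace →ₗ[ℂ] ModeSpace :=
  Finsupp.lsum ℂ fun r : ℤ => if 0 < r then Finsupp.lsingle r else 0

/-- The projection to the span of the `p(r)` with `r < 0`. -/
def negPart : ModeSpace →ₗ[ℂ] ModeSpace :=
  Finsupp.lsum ℂ fun r : ℤ => if r < 0 then Finsupp.lsingle r else 0

lemma posPart_single (r : ℤ) (c : ℂ) :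
    posPart (Finsupp.single r c) = if 0 < r then Finsupp.single r c else 0 := by
  by_cases h : 0 < r <;> simp [posPart, h]

lemma negPart_single (r : ℤ) (c : ℂ) :
    negPart (Finsupp.single r c) = if r < 0 then Finsupp.single r c else 0 := by
  by_cases h : r < 0 <;> simp [negPart, h]

lemma modeForm_single (r s : ℤ) (c c' : ℂ) :
    modeForm (Finsupp.single r c) (Finsupp.single s c')
      = if r + s = 0 then -2 * (c * c') else 0 := by
  have e : s = -r ↔ r + s = 0 := by omega
  by_cases hrs : r + s = 0
  · simp [modeForm, Finsupp.single_apply, e, hrs]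
    ring
  · simp [modeForm, e, hrs]

/-- The number of contractions in a product of two vectors. -/
def contractionForm : LinearMap.BilinForm ℂ ModeSpace :=
  (LinearMap.mul ℂ ℂ).compl₁₂ (Finsupp.lapply 0) (Finsupp.lapply 0)
    - modeForm.compl₁₂ posPart negPart

lemma contractionForm_apply (a b : ModeSpace) :
    contractionForm a b = a 0 * b 0 - modeForm (posPart a) (negPart b) := rfl

/-- Of the two orders of a pair `p(r), p(-r)` with `r ≠ 0`, only the one with the positive mode
first is contracted, so symmetrizing recovers the full pairing; `p(0)` enters in both orders. -/
lemma contractionForm_add_swap (a b : ModeSpace) :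
    contractionForm a b + contractionForm b a = -modeForm a b := by
  have h : contractionForm + LinearMap.flip contractionForm = -modeForm := by
    refine Finsupp.lhom_ext fun r c => Finsupp.lhom_ext fun s c' => ?_
    rw [LinearMap.add_apply, LinearMap.add_apply, LinearMap.flip_apply, LinearMap.neg_apply,
      LinearMap.neg_apply, contractionForm_apply, contractionForm_apply]
    simp only [posPart_single, negPart_single]
    have hsr : s + r = 0 ↔ r + s = 0 := by rw [add_comm]
    rcases lt_trichotomy r 0 with hr | hr | hr <;> rcases lt_trichotomy s 0 with hs | hs | hs
    · simp [hr, hs, hr.not_gt, hs.not_gt, hr.ne, hs.ne, modeForm_single]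
      omega
    · simp [hr, hs, hr.not_gt, hr.ne, modeForm_single]
    · simp only [if_pos hr, if_pos hs, if_neg hr.not_gt, if_neg hs.not_gt, modeForm_single, hsr]
      split_ifs <;> simp [hr.ne, mul_comm]
    · simp [hr, hs, hs.not_gt, hs.ne, modeForm_single]
    · simp [hr, hs, modeForm_single]
      ring
    · simp [hr, hs, hs.not_gt, hs.ne', modeForm_single]
    · simp only [if_pos hr, if_pos hs, if_neg hr.not_gt, if_neg hs.not_gt, modeForm_single]
      split_ifs <;> simp [hr.ne']
    · simp [hr, hs, hr.not_gt, hr.ne', modeForm_single]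
    · simp [hr, hs, hr.not_gt, hs.not_gt, hr.ne', hs.ne', modeForm_single]
      omega
  exact LinearMap.congr_fun₂ h a b

lemma modeQuadraticForm_eq (a : ModeSpace) : modeQuadraticForm a = contractionForm a a := by
  have h := contractionForm_add_swap a a
  have h2 : modeQuadraticForm a = -(1 / 2) * modeForm a a := rfl
  rw [h2]
  linear_combination -(1 / 2 : ℂ) * h

/-- Contraction lowers the exterior degree by one. Hence the involution, which represents `p(0)`,
anticommutes with the positive modes. -/
lemma involute_contractLeft (D : Module.Dual ℂ ModeSpace) (x : FockModel) :
    CliffordAlgebra.involute (CliffordAlgebra.contractLeft D x)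
      = -CliffordAlgebra.contractLeft D (CliffordAlgebra.involute x) := by
  induction x using CliffordAlgebra.left_induction with
  | algebraMap r => simp
  | add x y hx hy => simp only [map_add, hx, hy, neg_add]
  | ι_mul x a hx =>
    simp only [CliffordAlgebra.contractLeft_ι_mul, map_sub, map_mul, map_smul, hx,
      CliffordAlgebra.involute_ι, neg_mul, map_neg, mul_neg]
    abel

/-- The action of a vector of `\hat 𝔭_tw` on the Fock model. -/
def fockAct : ModeSpace →ₗ[ℂ] Module.End ℂ FockModel :=
  (LinearMap.mul ℂ FockModel) ∘ₗ CliffordAlgebra.ι 0 ∘ₗ negPart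
    - CliffordAlgebra.contractLeft ∘ₗ modeForm ∘ₗ posPart
    + (LinearMap.toSpanSingleton ℂ _ CliffordAlgebra.involute.toLinearMap) ∘ₗ Finsupp.lapply 0

lemma fockAct_apply (a : ModeSpace) (x : FockModel) :
    fockAct a x = CliffordAlgebra.ι 0 (negPart a) * x
      - CliffordAlgebra.contractLeft (modeForm (posPart a)) x
      + a 0 • CliffordAlgebra.involute x := rfl

/-- Exterior multiplications and contractions square to zero and the involution squares to one. The
mixed terms cancel, except for the scalar from contracting the positive part with the negative part.
-/
lemma fockAct_mul_self (a : ModeSpace) :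
    fockAct a * fockAct a = algebraMap ℂ _ (modeQuadraticForm a) := by
  apply LinearMap.ext
  intro x
  have h1 : ∀ y : FockModel, CliffordAlgebra.ι 0 (negPart a) * (CliffordAlgebra.ι 0 (negPart a) * y)
      = 0 := fun y => by
    rw [← mul_assoc, CliffordAlgebra.ι_sq_scalar]
    simp
  rw [Module.algebraMap_end_apply, modeQuadraticForm_eq, contractionForm_apply, sub_smul,
    Module.End.mul_apply]
  simp only [fockAct_apply, map_add, map_sub, map_smul, CliffordAlgebra.contractLeft_ι_mul, map_mul,
    CliffordAlgebra.involute_ι, involute_contractLeft, CliffordAlgebra.contractLeft_contractLeft,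
    CliffordAlgebra.involute_involute, h1, smul_add, smul_sub, smul_neg, neg_mul, smul_smul]
  abel

/-- The action of the Clifford algebra on the Fock model. -/
def fockHom : ModeAlgebra →ₐ[ℂ] Module.End ℂ FockModel :=
  CliffordAlgebra.lift modeQuadraticForm ⟨fockAct, fockAct_mul_self⟩

lemma fockHom_pElem (n : ℤ) : fockHom (pElem n) = fockAct (Finsupp.single n 1) := by
  rw [fockHom, pElem, CliffordAlgebra.lift_ι_apply]

/-- In the Fock model every generator of the left ideal kills the vector `1`, whereas the identity
does not. -/
theorem vacuum_ne_zero : Atw.mk 1 ≠ 0 := by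
  intro h
  rw [Atw.mk_eq_zero] at h
  have key : ∀ x ∈ vacuumIdeal, fockHom x 1 = 0 := by
    intro x hx
    refine Submodule.span_induction ?_ (by simp) (fun x y _ _ hx hy => by
      rw [map_add, LinearMap.add_apply, hx, hy, add_zero]) (fun a x _ hx => by
      rw [smul_eq_mul, map_mul, Module.End.mul_apply, hx, map_zero]) hx
    rintro x (⟨n, hn, rfl⟩ | rfl)
    · rw [fockHom_pElem, fockAct_apply, posPart_single, negPart_single, if_pos hn,
        if_neg hn.not_gt]
      simp [hn.ne']
    · rw [map_sub, LinearMap.sub_apply, fockHom_pElem, fockAct_apply, posPart_single,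
        negPart_single]
      simp
  have h1 := key 1 h
  rw [map_one fockHom] at h1
  exact one_ne_zero h1

end Fock

/-! ### A basis of the twisted Clifford module -/

section CliffordBasis

lemma pMode_anticommutator (m n : ℤ) (v : Atw) :
    pMode m (pMode n v) + pMode n (pMode m v) = if m + n = 0 then (2 : ℂ) • v else 0 := by
  obtain ⟨x, rfl⟩ := vacuumIdeal.mkQ_surjective v
  change Atw.mk (pElem m * (pElem n * x)) + Atw.mk (pElem n * (pElem m * x)) = _
  rw [← map_add, ← mul_assoc, ← mul_assoc, ← add_mul, pElem_anticommutator]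
  split_ifs
  · rw [two_mul, map_add]
    exact (two_smul ℂ (Atw.mk x)).symm
  · rw [zero_mul, map_zero]

lemma pMode_comm_of_ne {m n : ℤ} (h : m + n ≠ 0) (v : Atw) :
    pMode m (pMode n v) = -pMode n (pMode m v) := by
  rw [eq_neg_iff_add_eq_zero, pMode_anticommutator, if_neg h]

lemma pMode_comm_neg (n : ℤ) (v : Atw) :
    pMode n (pMode (-n) v) = (2 : ℂ) • v - pMode (-n) (pMode n v) := by
  rw [eq_sub_iff_add_eq, pMode_anticommutator, if_pos (add_neg_cancel n)]

/-- The vector `p(-n_1) ⋯ p(-n_k) v_tw^+`. -/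
def fockWord : List ℕ+ → Atw
  | [] => Atw.mk 1
  | n :: l => pMode (-((n : ℕ) : ℤ)) (fockWord l)

lemma pMode_zero_fockWord (l : List ℕ+) :
    pMode 0 (fockWord l) = (-1 : ℂ) ^ l.length • fockWord l := by
  induction l with
  | nil =>
    rw [fockWord, pMode_mk, mul_one, List.length_nil, pow_zero, one_smul, ← sub_eq_zero, ← map_sub,
      Atw.mk_eq_zero]
    exact Ideal.subset_span (Or.inr rfl)
  | cons n l ih =>
    rw [fockWord, pMode_comm_of_ne (by have := n.pos; omega), ih, map_smul, List.length_cons,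
      pow_succ, mul_neg_one, neg_smul]

lemma pMode_pos_fockWord {n : ℕ+} {l : List ℕ+} (hn : n ∉ l) :
    pMode ((n : ℕ) : ℤ) (fockWord l) = 0 := by
  induction l with
  | nil =>
    rw [fockWord, pMode_mk, mul_one, Atw.mk_eq_zero]
    exact Ideal.subset_span (Or.inl ⟨_, by exact_mod_cast n.pos, rfl⟩)
  | cons m l ih =>
    simp only [List.mem_cons, not_or] at hn
    rw [fockWord, pMode_comm_of_ne, ih hn.2, map_zero, neg_zero]
    intro h
    apply hn.1
    apply PNat.coe_injective
    omega

lemma pMode_fockWord_cons {n : ℕ+} {l : List ℕ+} (hn : n ∉ l) :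
    pMode ((n : ℕ) : ℤ) (fockWord (n :: l)) = (2 : ℂ) • fockWord l := by
  rw [fockWord, pMode_comm_neg, pMode_pos_fockWord hn, map_zero, sub_zero]

/-- The even operator `p(-n) p(n)` commutes with `p(-m)` for `m ≠ n`, so it passes along the word.
At the letter `n` the anticommutator supplies the factor `2`; if there is none, it reaches the
vacuum and gives `0`. -/
lemma number_fockWord (n : ℕ+) {l : List ℕ+} (hl : l.Nodup) :
    pMode (-((n : ℕ) : ℤ)) (pMode ((n : ℕ) : ℤ) (fockWord l))
      = (if n ∈ l then (2 : ℂ) else 0) • fockWord l := by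
  induction l with
  | nil => simp [pMode_pos_fockWord]
  | cons m l ih =>
    obtain ⟨hm, hl⟩ := List.nodup_cons.mp hl
    by_cases h : n = m
    · subst h
      rw [pMode_fockWord_cons hm, map_smul, if_pos List.mem_cons_self, fockWord]
    · have h1 : ((n : ℕ) : ℤ) ≠ ((m : ℕ) : ℤ) := fun h' => h (PNat.coe_injective (by omega))
      have h2 := n.pos
      have h3 := m.pos
      rw [fockWord, pMode_comm_of_ne (m := ((n : ℕ) : ℤ)) (n := -((m : ℕ) : ℤ)) (by omega), map_neg,
        pMode_comm_of_ne (m := -((n : ℕ) : ℤ)) (n := -((m : ℕ) : ℤ)) (by omega), neg_neg, ih hl,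
        map_smul]
      simp [h]

/-- Applying `p(n)` strips the leading letter up to the factor `2`, which reduces to the vacuum. -/
lemma fockWord_ne_zero {l : List ℕ+} (hl : l.Nodup) : fockWord l ≠ 0 := by
  induction l with
  | nil => exact vacuum_ne_zero
  | cons n l ih =>
    obtain ⟨hn, hl⟩ := List.nodup_cons.mp hl
    intro h
    have := pMode_fockWord_cons hn
    rw [h, map_zero] at this
    exact ih hl ((smul_eq_zero.mp this.symm).resolve_left two_ne_zero)

/-- The span contains the vacuum, which generates the module, and is stable under all modes:
negative ones lengthen a word, positive ones are moved to the right by the anticommutator. -/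
lemma span_fockWord : Submodule.span ℂ (Set.range fockWord) = ⊤ := by
  set S := Submodule.span ℂ (Set.range fockWord) with hS
  have hneg : ∀ n : ℕ+, ∀ v ∈ S, pMode (-((n : ℕ) : ℤ)) v ∈ S := by
    intro n v hv
    refine Submodule.span_induction ?_ (by simp) (fun x y _ _ hx hy => by
      rw [map_add]; exact S.add_mem hx hy) (fun a x _ hx => by
      rw [map_smul]; exact S.smul_mem _ hx) hv
    rintro _ ⟨l, rfl⟩
    exact Submodule.subset_span ⟨n :: l, rfl⟩
  have hpos : ∀ n : ℕ+, ∀ v ∈ S, pMode ((n : ℕ) : ℤ) v ∈ S := by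
    intro n v hv
    refine Submodule.span_induction ?_ (by simp) (fun x y _ _ hx hy => by
      rw [map_add]; exact S.add_mem hx hy) (fun a x _ hx => by
      rw [map_smul]; exact S.smul_mem _ hx) hv
    rintro _ ⟨l, rfl⟩
    induction l with
    | nil => rw [pMode_pos_fockWord (by simp)]; exact S.zero_mem
    | cons m l ih =>
      rw [fockWord]
      have h := pMode_anticommutator ((n : ℕ) : ℤ) (-((m : ℕ) : ℤ)) (fockWord l)
      rw [← eq_sub_iff_add_eq] at h
      rw [h]
      refine S.sub_mem ?_ (hneg m _ ih)
      split_ifs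
      · exact S.smul_mem _ (Submodule.subset_span ⟨l, rfl⟩)
      · exact S.zero_mem
  have hzero : ∀ v ∈ S, pMode 0 v ∈ S := by
    intro v hv
    refine Submodule.span_induction ?_ (by simp) (fun x y _ _ hx hy => by
      rw [map_add]; exact S.add_mem hx hy) (fun a x _ hx => by
      rw [map_smul]; exact S.smul_mem _ hx) hv
    rintro _ ⟨l, rfl⟩
    rw [pMode_zero_fockWord]
    exact S.smul_mem _ (Submodule.subset_span ⟨l, rfl⟩)
  have hall : ∀ r : ℤ, ∀ v ∈ S, pMode r v ∈ S := by
    intro r v hv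
    rcases lt_trichotomy r 0 with hr | rfl | hr
    · have := hneg ⟨(-r).toNat, by omega⟩ v hv
      rwa [PNat.mk_coe, Int.toNat_of_nonneg (by omega), neg_neg] at this
    · exact hzero v hv
    · have := hpos ⟨r.toNat, by omega⟩ v hv
      rwa [PNat.mk_coe, Int.toNat_of_nonneg (by omega)] at this
  rw [eq_top_iff]
  rintro v -
  obtain ⟨x, rfl⟩ := vacuumIdeal.mkQ_surjective v
  change Atw.mk x ∈ S
  induction x using CliffordAlgebra.left_induction with
  | algebraMap c =>
    have h : Atw.mk (algebraMap ℂ ModeAlgebra c) = c • fockWord [] := by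
      rw [Algebra.algebraMap_eq_smul_one]
      rfl
    rw [h]
    exact S.smul_mem _ (Submodule.subset_span ⟨[], rfl⟩)
  | add x y hx hy => rw [map_add]; exact S.add_mem hx hy
  | ι_mul x m hx =>
    induction m using Finsupp.induction_linear with
    | zero => simp
    | add f g hf hg => rw [map_add, add_mul, map_add]; exact S.add_mem hf hg
    | single r c =>
      have h : Atw.mk (CliffordAlgebra.ι modeQuadraticForm (Finsupp.single r c) * x)
          = c • pMode r (Atw.mk x) := by
        have h1 : CliffordAlgebra.ι modeQuadraticForm (Finsupp.single r c) = c • pElem r := by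
          rw [pElem, ← map_smul, Finsupp.smul_single, smul_eq_mul, mul_one]
        rw [h1, smul_mul_assoc]
        rfl
      rw [h]
      exact S.smul_mem _ (hall r _ hx)

/-- The sign need not be tracked, since only spans and vanishing of words are deduced from this. -/
lemma fockWord_perm {l l' : List ℕ+} (h : l.Perm l') :
    fockWord l = fockWord l' ∨ fockWord l = -fockWord l' := by
  induction h with
  | nil => exact Or.inl rfl
  | cons n _ ih =>
    rcases ih with h | h
    · left; rw [fockWord, fockWord, h]
    · right; rw [fockWord, fockWord, h, map_neg]
  | swap m n l =>
    right
    rw [fockWord, fockWord, fockWord, fockWord, pMode_comm_of_ne]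
    have := m.pos
    have := n.pos
    omega
  | trans _ _ h1 h2 =>
    rcases h1 with h1 | h1 <;> rcases h2 with h2 | h2 <;> simp [h1, h2]

/-- Two equal letters can be moved to the front, and `p(-n)² = 0` for `n > 0`. -/
lemma fockWord_eq_zero {l : List ℕ+} (hl : ¬l.Nodup) : fockWord l = 0 := by
  rw [List.nodup_iff_forall_not_duplicate] at hl
  push Not at hl
  obtain ⟨n, hn⟩ := hl
  rw [List.duplicate_iff_sublist] at hn
  obtain ⟨l', hl'⟩ := hn.exists_perm_append
  have h0 : fockWord ([n, n] ++ l') = 0 := by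
    have := pMode_anticommutator (-((n : ℕ) : ℤ)) (-((n : ℕ) : ℤ)) (fockWord l')
    rw [if_neg (by have := n.pos; omega), ← two_smul ℂ] at this
    exact (smul_eq_zero.mp this).resolve_left two_ne_zero
  rcases fockWord_perm hl' with h | h <;> rw [h, h0]
  exact neg_zero

/-- The basis vector of the twisted Clifford module attached to a set of modes. -/
def fockVector (S : Finset ℕ+) : Atw := fockWord S.toList

lemma span_fockVector : Submodule.span ℂ (Set.range fockVector) = ⊤ := by
  classical
  rw [eq_top_iff, ← span_fockWord, Submodule.span_le]
  rintro _ ⟨l, rfl⟩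
  by_cases hl : l.Nodup
  · have hp : l.Perm l.toFinset.toList := by
      rw [List.perm_ext_iff_of_nodup hl (Finset.nodup_toList _)]
      simp
    have hm : fockWord l.toFinset.toList ∈ Submodule.span ℂ (Set.range fockVector) :=
      Submodule.subset_span ⟨l.toFinset, rfl⟩
    rcases fockWord_perm hp with h | h
    · rw [h]; exact hm
    · rw [h]; exact Submodule.neg_mem _ hm
  · rw [fockWord_eq_zero hl]
    exact Submodule.zero_mem _

/-- Twice the number operator of the `n`-th mode. -/
def numberOp (n : ℕ+) : Module.End ℂ Atw := pMode (-((n : ℕ) : ℤ)) * pMode ((n : ℕ) : ℤ)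

lemma numberOp_commute (m n : ℕ+) : Commute (numberOp m) (numberOp n) := by
  by_cases h : m = n
  · rw [h]
  · have h1 : ((m : ℕ) : ℤ) ≠ ((n : ℕ) : ℤ) := fun h' => h (PNat.coe_injective (by omega))
    have h2 := n.pos
    have h3 := m.pos
    have key : ∀ r : ℤ, r + n ≠ 0 → r + -n ≠ 0 → Commute (pMode r) (numberOp n) := by
      intro r hr hr'
      apply LinearMap.ext
      intro v
      simp only [numberOp, Module.End.mul_apply]
      rw [pMode_comm_of_ne hr', pMode_comm_of_ne hr, map_neg, neg_neg]
    exact (key _ (by omega) (by omega)).mul_left (key _ (by omega) (by omega))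

/-- The number operators commute, and their joint eigenvalues on a vector determine its set of
modes. Nonzero vectors in distinct joint eigenspaces are independent. -/
lemma linearIndependent_fockVector : LinearIndependent ℂ fockVector := by
  classical
  have hind := Module.End.independent_iInf_maxGenEigenspace_of_forall_mapsTo
    (f := numberOp) fun i j φ => Module.End.mapsTo_maxGenEigenspace_of_comm (numberOp_commute j i) φ
  let χ : Finset ℕ+ → ℕ+ → ℂ := fun S n => if n ∈ S then 2 else 0
  have hχ : Function.Injective χ := by
    intro S T hST
    ext n
    have := congrFun hST n
    by_cases h1 : n ∈ S <;> by_cases h2 : n ∈ T <;> simp [χ, h1, h2] at this ⊢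
  refine (hind.comp hχ).linearIndependent _ (fun S => ?_)
    fun S => fockWord_ne_zero (Finset.nodup_toList S)
  rw [Function.comp_apply, Submodule.mem_iInf]
  intro n
  refine Module.End.eigenspace_le_maxGenEigenspace (Module.End.mem_eigenspace_iff.mpr ?_)
  rw [fockVector, numberOp, Module.End.mul_apply, number_fockWord n (Finset.nodup_toList S)]
  simp [χ]

/-- The basis of the twisted Clifford module. -/
def fockBasis : Module.Basis (Finset ℕ+) ℂ Atw :=
  Module.Basis.mk linearIndependent_fockVector span_fockVector.ge

lemma fockBasis_apply (S : Finset ℕ+) : fockBasis S = fockVector S := by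
  rw [fockBasis, Module.Basis.mk_apply]

theorem pMode_zero_fockBasis (S : Finset ℕ+) :
    pMode 0 (fockBasis S) = (-1 : ℂ) ^ S.card • fockBasis S := by
  rw [fockBasis_apply, fockVector, pMode_zero_fockWord, Finset.length_toList]

theorem cliffL0_fockBasis (S : Finset ℕ+) :
    cliffL0 (fockBasis S) = (1 / 16 + ((∑ n ∈ S, (n : ℕ) : ℕ) : ℂ)) • fockBasis S := by
  classical
  change (1 / 16 : ℂ) • fockBasis S + ∑ᶠ n : ℕ, cliffL0Term n (fockBasis S) = _
  rw [add_smul]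
  congr 1
  have h : ∀ n : ℕ, cliffL0Term n (fockBasis S)
      = ((n : ℂ) * if n ∈ S.map ⟨PNat.val, PNat.coe_injective⟩ then 1 else 0) • fockBasis S := by
    intro n
    -- The sum in `cliffL0` includes the index `0`, whose term vanishes because of the coefficient
    -- `n / 2`.
    rcases Nat.eq_zero_or_pos n with rfl | hn
    · simp [cliffL0Term]
    · obtain ⟨m, rfl⟩ : ∃ m : ℕ+, n = m := ⟨⟨n, hn⟩, rfl⟩
      have h2 : (m : ℕ) ∈ S.map ⟨PNat.val, PNat.coe_injective⟩ ↔ m ∈ S :=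
        Finset.mem_map' ⟨PNat.val, PNat.coe_injective⟩
      rw [cliffL0Term, LinearMap.smul_apply, Module.End.mul_apply, fockBasis_apply, fockVector,
        number_fockWord m (Finset.nodup_toList S), smul_smul]
      congr 1
      by_cases hS : m ∈ S
      · rw [if_pos (Finset.mem_toList.mpr hS), if_pos (h2.mpr hS)]
        ring
      · rw [if_neg (fun h => hS (Finset.mem_toList.mp h)), if_neg (fun h => hS (h2.mp h))]
        ring
  simp only [h]
  rw [finsum_eq_sum_of_support_subset (s := S.map ⟨PNat.val, PNat.coe_injective⟩),
    ← Finset.sum_smul]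
  · congr 1
    rw [Finset.sum_congr rfl fun n hn => by rw [if_pos hn, mul_one]]
    simp
  · intro n hn
    by_contra h'
    apply hn
    simp only [Finset.mem_coe] at h'
    simp only [if_neg h', mul_zero, zero_smul]

end CliffordBasis

/-! ### The tensor product of Clifford modules -/

section CliffordTensor

variable {M : ℕ}

/-- The basis of pure tensors of basis vectors. -/
def tensorBasis (M : ℕ) : Module.Basis (Fin M → Finset ℕ+) ℂ (AtwTensor M) :=
  Basis.piTensorProduct fun _ => fockBasis

lemma tensorBasis_apply (f : Fin M → Finset ℕ+) :
    tensorBasis M f = PiTensorProduct.tprod ℂ fun i => fockBasis (f i) := by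
  rw [tensorBasis, Basis.piTensorProduct_apply]

/-- The weight of a family of sets of modes. -/
def fockWeight (f : Fin M → Finset ℕ+) : ℕ := ∑ i, ∑ n ∈ f i, (n : ℕ)

/-- The factors that are odd. -/
def oddSet (f : Fin M → Finset ℕ+) : Finset (Fin M) := Finset.univ.filter fun i => Odd (f i).card

lemma neg_one_pow_card_oddSet (f : Fin M → Finset ℕ+) :
    (-1 : ℂ) ^ (oddSet f).card = ∏ i, (-1) ^ (f i).card := by
  rw [← Finset.prod_const, oddSet, Finset.prod_filter]
  refine Finset.prod_congr rfl fun i _ => ?_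
  split_ifs with h
  · exact h.neg_one_pow.symm
  · exact (Nat.not_odd_iff_even.mp h).neg_one_pow.symm

theorem pTilde_tensorBasis (f : Fin M → Finset ℕ+) :
    pTilde M (tensorBasis M f) = (-1 : ℂ) ^ (oddSet f).card • tensorBasis M f := by
  rw [tensorBasis_apply, pTilde, PiTensorProduct.map_tprod, neg_one_pow_card_oddSet]
  simp only [pMode_zero_fockBasis]
  exact MultilinearMap.map_smul_univ _ _ _

theorem cliffTensorL0_tensorBasis (f : Fin M → Finset ℕ+) :
    cliffTensorL0 M (tensorBasis M f)
      = ((M : ℂ) / 16 + (fockWeight f : ℂ)) • tensorBasis M f := by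
  have h : ∀ i : Fin M, PiTensorProduct.map
      (Function.update (fun _ => (LinearMap.id : Atw →ₗ[ℂ] Atw)) i cliffL0) (tensorBasis M f)
      = (1 / 16 + ((∑ n ∈ f i, (n : ℕ) : ℕ) : ℂ)) • tensorBasis M f := by
    intro i
    rw [tensorBasis_apply, PiTensorProduct.map_tprod]
    have h2 : (fun j => (Function.update (fun _ => (LinearMap.id : Atw →ₗ[ℂ] Atw)) i cliffL0 j)
        (fockBasis (f j))) = Function.update (fun j => fockBasis (f j)) i
          ((1 / 16 + ((∑ n ∈ f i, (n : ℕ) : ℕ) : ℂ)) • fockBasis (f i)) := by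
      ext1 j
      by_cases hj : j = i
      · subst hj
        rw [Function.update_self, Function.update_self, cliffL0_fockBasis]
      · rw [Function.update_of_ne hj, Function.update_of_ne hj, LinearMap.id_apply]
    rw [h2, MultilinearMap.map_update_smul, Function.update_eq_self]
  rw [cliffTensorL0, LinearMap.sum_apply, Finset.sum_congr rfl fun i _ => h i, ← Finset.sum_smul,
    Finset.sum_add_distrib, fockWeight]
  congr 1
  push_cast
  simp
  ring

theorem plainPerm_tensorBasis (π : Equiv.Perm (Fin M)) (f : Fin M → Finset ℕ+) :
    plainPerm π (tensorBasis M f) = tensorBasis M (f ∘ π.symm) := by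
  rw [tensorBasis_apply, tensorBasis_apply]
  exact PiTensorProduct.reindex_tprod π _

lemma parityProj_tensorBasis (S : Finset (Fin M)) (f : Fin M → Finset ℕ+) :
    parityProj S (tensorBasis M f) = if S = oddSet f then tensorBasis M f else 0 := by
  have h : ∀ i, (if i ∈ S then (1 / 2 : ℂ) • (1 - pMode 0) else (1 / 2 : ℂ) • (1 + pMode 0))
      (fockBasis (f i)) = (if i ∈ S ↔ i ∈ oddSet f then (1 : ℂ) else 0) • fockBasis (f i) := by
    intro i
    have hm : i ∈ oddSet f ↔ Odd (f i).card := by simp [oddSet]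
    by_cases h1 : i ∈ S
    · rw [if_pos h1, LinearMap.smul_apply, LinearMap.sub_apply, pMode_zero_fockBasis,
        Module.End.one_apply]
      by_cases h2 : i ∈ oddSet f
      · rw [(hm.mp h2).neg_one_pow, if_pos (by tauto)]
        module
      · rw [(Nat.not_odd_iff_even.mp (mt hm.mpr h2)).neg_one_pow, if_neg (by tauto)]
        module
    · rw [if_neg h1, LinearMap.smul_apply, LinearMap.add_apply, pMode_zero_fockBasis,
        Module.End.one_apply]
      by_cases h2 : i ∈ oddSet f
      · rw [(hm.mp h2).neg_one_pow, if_neg (by tauto)]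
        module
      · rw [(Nat.not_odd_iff_even.mp (mt hm.mpr h2)).neg_one_pow, if_pos (by tauto)]
        module
  rw [tensorBasis_apply, parityProj, PiTensorProduct.map_tprod]
  simp only [h]
  rw [MultilinearMap.map_smul_univ]
  split_ifs with hS
  · rw [Finset.prod_eq_one fun i _ => by rw [hS, if_pos Iff.rfl], one_smul]
  · obtain ⟨i, hi⟩ : ∃ i, ¬(i ∈ S ↔ i ∈ oddSet f) := by
      by_contra h'
      push Not at h'
      exact hS (Finset.ext h')
    rw [Finset.prod_eq_zero (Finset.mem_univ i) (if_neg hi), zero_smul]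

theorem koszulPerm_tensorBasis (π : Equiv.Perm (Fin M)) (f : Fin M → Finset ℕ+) :
    koszulPerm π (tensorBasis M f)
      = koszulSign π (oddSet f) • tensorBasis M (f ∘ π.symm) := by
  rw [koszulPerm, Module.End.mul_apply, LinearMap.sum_apply, Finset.sum_eq_single (oddSet f)]
  · rw [LinearMap.smul_apply, parityProj_tensorBasis, if_pos rfl, map_smul, plainPerm_tensorBasis]
  · intro S _ hS
    rw [LinearMap.smul_apply, parityProj_tensorBasis, if_neg hS, smul_zero]
  · simp

lemma oddSet_comp_symm (π : Equiv.Perm (Fin M)) (f : Fin M → Finset ℕ+) :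
    oddSet (f ∘ π.symm) = (oddSet f).map π.toEmbedding := by
  ext i
  simp [oddSet, Finset.mem_map_equiv]

/-! ### The Koszul sign -/

/-- The ordered pairs of distinct elements of `S`. -/
def orderedPairs (S : Finset (Fin M)) : Finset (Fin M × Fin M) :=
  (S ×ˢ S).filter fun p => p.1 < p.2

lemma koszulSign_eq_prod (π : Equiv.Perm (Fin M)) (S : Finset (Fin M)) :
    koszulSign π S = ∏ p ∈ orderedPairs S, if π p.2 < π p.1 then -1 else 1 := by
  rw [koszulSign, ← Finset.prod_const, orderedPairs, Finset.prod_ite, Finset.prod_const_one,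
    mul_one, Finset.filter_filter]

/-- The ordered pair with the images of the entries of `p`. -/
def sortImage (π : Equiv.Perm (Fin M)) (p : Fin M × Fin M) : Fin M × Fin M :=
  if π p.1 < π p.2 then (π p.1, π p.2) else (π p.2, π p.1)

lemma sortImage_mem (π : Equiv.Perm (Fin M)) {S T : Finset (Fin M)} (hT : ∀ i ∈ S, π i ∈ T)
    {p : Fin M × Fin M} (hp : p ∈ orderedPairs S) : sortImage π p ∈ orderedPairs T := by
  simp only [orderedPairs, Finset.mem_filter, Finset.mem_product] at hp ⊢
  have h : π p.1 ≠ π p.2 := fun h => hp.2.ne (π.injective h)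
  unfold sortImage
  split_ifs with h1
  · exact ⟨⟨hT _ hp.1.1, hT _ hp.1.2⟩, h1⟩
  · exact ⟨⟨hT _ hp.1.2, hT _ hp.1.1⟩, lt_of_le_of_ne (not_lt.mp h1) h.symm⟩

lemma sortImage_symm (π : Equiv.Perm (Fin M)) {p : Fin M × Fin M} (hp : p.1 < p.2) :
    sortImage π.symm (sortImage π p) = p := by
  unfold sortImage
  by_cases h : π p.1 < π p.2
  · simp [h, hp]
  · simp [h, hp.not_gt]

/-- A pair of odd factors is reversed by `π * π'` exactly when one, but not both, of the following
holds: `π'` reverses it, or `π` reverses its image. `sortImage` matches the pairs of `S` with those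
of its image. -/
theorem koszulSign_mul (π π' : Equiv.Perm (Fin M)) (S : Finset (Fin M)) :
    koszulSign (π * π') S = koszulSign π (S.map π'.toEmbedding) * koszulSign π' S := by
  have h : koszulSign π (S.map π'.toEmbedding)
      = ∏ p ∈ orderedPairs S,
        if π (sortImage π' p).2 < π (sortImage π' p).1 then (-1 : ℂ) else 1 := by
    rw [koszulSign_eq_prod]
    symm
    refine Finset.prod_nbij' (sortImage π') (sortImage π'.symm)
      (fun p hp => sortImage_mem π' (fun i hi => ?_) hp)
      (fun p hp => sortImage_mem π'.symm (fun i hi => ?_) hp) (fun p hp => ?_) (fun p hp => ?_)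
      fun p _ => rfl
    · exact Finset.mem_map_of_mem π'.toEmbedding hi
    · rwa [Finset.mem_map_equiv] at hi
    · exact sortImage_symm π' (Finset.mem_filter.mp hp).2
    · exact sortImage_symm π'.symm (Finset.mem_filter.mp hp).2
  rw [h, koszulSign_eq_prod, koszulSign_eq_prod, ← Finset.prod_mul_distrib]
  refine Finset.prod_congr rfl fun p hp => ?_
  have hp' := (Finset.mem_filter.mp hp).2
  have h1 : π' p.1 ≠ π' p.2 := fun h => hp'.ne (π'.injective h)
  have h2 : π (π' p.1) ≠ π (π' p.2) := fun h => h1 (π.injective h)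
  simp only [Equiv.Perm.mul_apply, sortImage]
  rcases lt_or_gt_of_ne h1 with h1 | h1 <;> rcases lt_or_gt_of_ne h2 with h2 | h2 <;>
    simp [h1, h2, h1.not_gt, h2.not_gt]

lemma koszulSign_one (S : Finset (Fin M)) : koszulSign 1 S = 1 := by
  rw [koszulSign_eq_prod]
  refine Finset.prod_eq_one fun p hp => if_neg ?_
  simpa using (Finset.mem_filter.mp hp).2.le

lemma koszulSign_sq (π : Equiv.Perm (Fin M)) (S : Finset (Fin M)) : koszulSign π S ^ 2 = 1 := by
  rw [koszulSign, ← pow_mul, mul_comm, pow_mul]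
  simp

/-- The cocycle identity `koszulSign_mul` makes the signed permutations multiplicative. -/
theorem koszulPerm_pow (π : Equiv.Perm (Fin M)) (a : ℕ) :
    koszulPerm π ^ a = koszulPerm (π ^ a) := by
  have hmul : ∀ π π' : Equiv.Perm (Fin M), koszulPerm (π * π') = koszulPerm π * koszulPerm π' := by
    intro π π'
    refine (tensorBasis M).ext fun f => ?_
    rw [Module.End.mul_apply, koszulPerm_tensorBasis, koszulPerm_tensorBasis, map_smul,
      koszulPerm_tensorBasis, smul_smul, oddSet_comp_symm, koszulSign_mul, mul_comm]
    rfl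
  induction a with
  | zero =>
    refine (tensorBasis M).ext fun f => ?_
    rw [pow_zero, pow_zero, koszulPerm_tensorBasis, koszulSign_one, one_smul]
    rfl
  | succ a ih => rw [pow_succ, ih, pow_succ, hmul]

theorem plainPerm_pow (π : Equiv.Perm (Fin M)) (a : ℕ) : plainPerm π ^ a = plainPerm (π ^ a) := by
  refine (tensorBasis M).ext fun f => ?_
  rw [plainPerm_tensorBasis]
  induction a generalizing f with
  | zero => rfl
  | succ a ih =>
    rw [pow_succ, Module.End.mul_apply, plainPerm_tensorBasis, ih, pow_succ]
    rfl

lemma koszulSign_pow (π : Equiv.Perm (Fin M)) {S : Finset (Fin M)} (hS : S.map π.toEmbedding = S)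
    (k : ℕ) : koszulSign (π ^ k) S = koszulSign π S ^ k := by
  induction k with
  | zero => rw [pow_zero, pow_zero, koszulSign_one]
  | succ k ih => rw [pow_succ, koszulSign_mul, hS, ih, pow_succ]

/-- A permutation of odd order has no signs on the sets that it preserves. -/
theorem koszulSign_of_odd {π : Equiv.Perm (Fin M)} {S : Finset (Fin M)}
    (hS : S.map π.toEmbedding = S) {N : ℕ} (hN : Odd N) (hπ : π ^ N = 1) : koszulSign π S = 1 := by
  obtain ⟨k, rfl⟩ := hN
  -- The sign squares to `1` and its `N`-th power is `1` with `N` odd, so it is `1`.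
  have h := koszulSign_pow π hS (2 * k + 1)
  rw [hπ, koszulSign_one, pow_succ, pow_mul, koszulSign_sq, one_pow, one_mul] at h
  exact h.symm

/-- The sign of a fixed point free involution is `-1` for each of its orbits. -/
theorem koszulSign_of_involution {π : Equiv.Perm (Fin M)} {S : Finset (Fin M)}
    (hS : S.map π.toEmbedding = S) (hπ : ∀ i, π (π i) = i) (hfix : ∀ i, π i ≠ i) {t : ℕ}
    (ht : S.card = 2 * t) : koszulSign π S = (-1) ^ t := by
  have hmem : ∀ i, π i ∈ S ↔ i ∈ S := by
    intro i
    conv_lhs => rw [← hS]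
    exact Finset.mem_map' π.toEmbedding
  set I := (S ×ˢ S).filter fun ij => ij.1 < ij.2 ∧ π ij.2 < π ij.1 with hI
  -- The map `(i, j) ↦ (π j, π i)` is an involution of the inversions inside `S`. Its fixed points
  -- are the pairs `(i, π i)`, so only these matter for the parity.
  have hcard : (-1 : ℂ) ^ I.card = (-1) ^ (I.filter fun p => p.2 = π p.1).card := by
    rw [← Finset.prod_const, ← Finset.prod_filter_mul_prod_filter_not I fun p => p.2 = π p.1,
      Finset.prod_const]
    refine (congrArg _ ?_).trans (mul_one _)
    refine Finset.prod_involution (fun p _ => (π p.2, π p.1)) (fun _ _ => by norm_num)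
      (fun p hp _ h => ?_) (fun p hp => ?_) fun p hp => by simp [hπ]
    · have h2 := (Finset.mem_filter.mp hp).2
      exact h2 (congrArg Prod.snd h).symm
    · simp only [hI, Finset.mem_filter, Finset.mem_product, hmem, hπ] at hp ⊢
      exact ⟨⟨⟨hp.1.1.2, hp.1.1.1⟩, hp.1.2.2, hp.1.2.1⟩, fun h => hp.2 h.symm⟩
  rw [koszulSign, ← hI, hcard]
  congr 1
  have h1 : (I.filter fun p => p.2 = π p.1).card = (S.filter fun i => i < π i).card := by
    refine Finset.card_nbij' Prod.fst (fun i => (i, π i)) (fun p hp => ?_) (fun i hi => ?_)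
      (fun p hp => ?_) fun i _ => rfl
    · simp only [hI, Finset.coe_filter, Finset.mem_filter, Finset.mem_product,
        Set.mem_ofPred_eq] at hp ⊢
      exact ⟨hp.1.1.1, hp.2 ▸ hp.1.2.1⟩
    · simp only [hI, Finset.coe_filter, Finset.mem_filter, Finset.mem_product, Set.mem_ofPred_eq,
        hmem, hπ] at hi ⊢
      exact ⟨⟨⟨hi.1, hi.1⟩, hi.2, hi.2⟩, trivial⟩
    · simp only [Finset.coe_filter, Set.mem_ofPred_eq] at hp
      exact Prod.ext rfl hp.2.symm
  -- `π` exchanges the points it raises with those it lowers, so each kind makes up half of the `2t`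
  -- points.
  have h2 : (S.filter fun i => ¬i < π i).card = (S.filter fun i => i < π i).card := by
    refine Finset.card_nbij' π π (fun i hi => ?_) (fun i hi => ?_) (fun i _ => hπ i) fun i _ => hπ i
    · simp only [Finset.coe_filter, Set.mem_ofPred_eq, hmem, hπ, not_lt] at hi ⊢
      exact ⟨hi.1, lt_of_le_of_ne hi.2 (hfix i)⟩
    · simp only [Finset.coe_filter, Set.mem_ofPred_eq, hmem, hπ, not_lt] at hi ⊢
      exact ⟨hi.1, hi.2.le⟩
  have h3 := Finset.card_filter_add_card_filter_not (s := S) fun i => i < π i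
  omega

end CliffordTensor

/-! ### Euler products and the trace series -/

section TraceSeries

/-- The variables `λ_j q^{en}`. -/
def qVar {ι : Type*} (lam : ι → ℂ) (q : ℂ) (e : ℕ) (v : ι × ℕ+) : ℂ := lam v.1 * q ^ (e * v.2)

/-- The Lambert series `∑ n q^{mn} = ∑ σ₁(n) qⁿ`. -/
def lambert (q : ℂ) : ℂ := ∑' c : ℕ+ × ℕ+, (c.2 : ℂ) * q ^ (c.1 * c.2 : ℕ)

variable {ι : Type*} {lam : ι → ℂ} {q : ℂ} {e : ℕ}

lemma norm_qVar_le (he : 0 < e) (hlam : ∀ j, ‖lam j‖ ≤ 1) (hq : ‖q‖ < 1) (v : ι × ℕ+) :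
    ‖qVar lam q e v‖ ≤ ‖q‖ ^ (v.2 : ℕ) := by
  rw [qVar, norm_mul, norm_pow]
  calc ‖lam v.1‖ * ‖q‖ ^ (e * v.2) ≤ 1 * ‖q‖ ^ (e * v.2) := by
        gcongr
        exact hlam _
    _ ≤ ‖q‖ ^ (v.2 : ℕ) := by
        rw [one_mul]
        exact pow_le_pow_of_le_one (norm_nonneg q) hq.le (Nat.le_mul_of_pos_left _ he)

lemma norm_qVar_le' (he : 0 < e) (hlam : ∀ j, ‖lam j‖ ≤ 1) (hq : ‖q‖ < 1) (v : ι × ℕ+) :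
    ‖qVar lam q e v‖ ≤ ‖q‖ :=
  (norm_qVar_le he hlam hq v).trans (pow_le_of_le_one (norm_nonneg q) hq.le v.2.ne_zero)

lemma summable_norm_qVar [Finite ι] (he : 0 < e) (hlam : ∀ j, ‖lam j‖ ≤ 1) (hq : ‖q‖ < 1) :
    Summable fun v : ι × ℕ+ => ‖qVar lam q e v‖ := by
  have h1 : Summable fun _ : ι => (1 : ℝ) := Summable.of_finite
  have h2 : Summable fun n : ℕ+ => ‖q‖ ^ (n : ℕ) :=
    (summable_geometric_of_lt_one (norm_nonneg q) hq).comp_injective PNat.coe_injective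
  have h3 := h1.mul_of_nonneg h2 (fun _ => zero_le_one) fun _ => pow_nonneg (norm_nonneg q) _
  refine Summable.of_nonneg_of_le (fun v => norm_nonneg _) (fun v => ?_) h3
  rw [one_mul]
  exact norm_qVar_le he hlam hq v

lemma monom_qVar {d : ℕ} (lam : Fin d → ℂ) (q : ℂ) (s : Fin d × ℕ+ →₀ ℕ) :
    monom (qVar lam q 1) s = monom (fun v => lam v.1) s * q ^ heisWeight s := by
  rw [monom, monom, heisWeight, wdeg, Finsupp.prod, Finsupp.prod, Finsupp.sum,
    ← Finset.prod_pow_eq_pow_sum, ← Finset.prod_mul_distrib]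
  refine Finset.prod_congr rfl fun v _ => ?_
  rw [qVar, mul_pow, one_mul, ← pow_mul, mul_comm (v.2 : ℕ)]

/-- The sum over finite sets of the products of the `-λ_j q^{en}`. -/
def eulerSum (lam : ι → ℂ) (q : ℂ) (e : ℕ) : ℂ :=
  ∑' T : Finset (ι × ℕ+), ∏ v ∈ T, -qVar lam q e v

lemma hasProd_eulerSum [Fintype ι] (he : 0 < e) (hlam : ∀ j, ‖lam j‖ ≤ 1) (hq : ‖q‖ < 1) :
    HasProd (fun n : ℕ+ => ∏ j, (1 - lam j * (q ^ (n : ℕ)) ^ e)) (eulerSum lam q e) := by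
  have h := hasProd_one_sub (summable_norm_qVar he hlam hq)
  rw [← (Equiv.prodComm ℕ+ ι).hasProd_iff] at h
  refine h.prod_fiberwise fun n => ?_
  convert hasProd_fintype (fun j => 1 - lam j * (q ^ (n : ℕ)) ^ e) using 1
  ext j
  simp [qVar, ← pow_mul, mul_comm]

/-- The hypothesis at `y = q^n`, multiplied over all `n`: the Clifford product is the inverse of the
product of the two Heisenberg characters. -/
lemma eulerSum_mul {d k R : ℕ} {lam : Fin d → ℂ} (he : 0 < e) (hlam : ∀ j, ‖lam j‖ ≤ 1)
    (hprod : ∀ y : ℂ, (∏ j, (1 - lam j * y)) * (1 - y) ^ k = (1 - y ^ e) ^ R) (hq : ‖q‖ < 1) :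
    eulerSum lam q 1 * eulerSum (fun _ : Fin k => 1) q 1 = eulerSum (fun _ : Fin R => 1) q e := by
  have h1 := hasProd_eulerSum one_pos hlam hq
  have h2 := hasProd_eulerSum (lam := fun _ : Fin k => (1 : ℂ)) one_pos (by simp) hq
  have h3 := hasProd_eulerSum (lam := fun _ : Fin R => (1 : ℂ)) he (by simp) hq
  refine (h1.mul h2).unique ?_
  convert h3 using 2 with n
  simpa using hprod (q ^ (n : ℕ))

lemma summable_lambert (hq : ‖q‖ < 1) :
    Summable fun c : ℕ+ × ℕ+ => (c.2 : ℂ) * q ^ (c.1 * c.2 : ℕ) := by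
  simpa using summable_prod_mul_pow 1 hq

lemma tsum_ite_dvd (he : 0 < e) :
    ∑' c : ℕ+ × ℕ+, (if e ∣ (c.1 : ℕ) then (c.2 : ℂ) * q ^ (c.1 * c.2 : ℕ) else 0)
      = lambert (q ^ e) := by
  obtain ⟨f, rfl⟩ : ∃ f : ℕ+, e = f := ⟨⟨e, he⟩, rfl⟩
  let φ : ℕ+ × ℕ+ → ℕ+ × ℕ+ := fun c => (f * c.1, c.2)
  have hφ : Function.Injective φ := by
    intro a b hab
    have h1 := congrArg Prod.fst hab
    have h2 := congrArg Prod.snd hab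
    exact Prod.ext (mul_left_cancel h1) h2
  rw [← hφ.tsum_eq, lambert]
  · refine tsum_congr fun c => ?_
    simp only [φ, PNat.mul_coe, dvd_mul_right, if_true, ← pow_mul, mul_assoc]
  · intro c hc
    have hd : (f : ℕ) ∣ (c.1 : ℕ) := by
      by_contra h
      exact hc (if_neg h)
    obtain ⟨m, hm⟩ := hd
    have hm0 : 0 < m := Nat.pos_of_ne_zero fun h => by simp [h] at hm
    refine ⟨(⟨m, hm0⟩, c.2), Prod.ext (PNat.eq ?_) rfl⟩
    rw [hm]
    exact PNat.mul_coe f ⟨m, hm0⟩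

lemma summable_weighted [Finite ι] (hlam : ∀ j, ‖lam j‖ ≤ 1) (hq : ‖q‖ < 1) :
    Summable fun p : ι × (ℕ+ × ℕ+) =>
      ‖(p.2.2 : ℂ) * (lam p.1 ^ (p.2.1 : ℕ) * q ^ (p.2.1 * p.2.2 : ℕ))‖ := by
  have h1 : Summable fun _ : ι => (1 : ℝ) := Summable.of_finite
  have h2 := (summable_lambert hq).norm
  have h3 := h1.mul_of_nonneg h2 (fun _ => zero_le_one) fun _ => norm_nonneg _
  refine Summable.of_nonneg_of_le (fun v => norm_nonneg _) (fun p => ?_) h3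
  rw [one_mul, norm_mul, norm_mul, norm_mul, norm_pow]
  refine mul_le_mul_of_nonneg_left ?_ (norm_nonneg _)
  exact mul_le_of_le_one_left (norm_nonneg _) (pow_le_one₀ (norm_nonneg _) (hlam _))

/-- The pairs `((j, n), m)` with `n > 0`, `m ≥ 0` as triples `(j, m + 1, n)`. -/
def weightIndexEquiv (ι : Type*) : (Σ _ : ι × ℕ+, ℕ) ≃ ι × (ℕ+ × ℕ+) where
  toFun p := (p.1.1, p.2.succPNat, p.1.2)
  invFun p := ⟨(p.1, p.2.2), p.2.1.natPred⟩
  left_inv p := by simp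
  right_inv p := by simp

lemma weighted_comp_weightIndexEquiv (p : Σ _ : ι × ℕ+, ℕ) :
    ((p.1.2 : ℕ) : ℂ) * qVar lam q 1 p.1 ^ (p.2 + 1)
      = ((weightIndexEquiv ι p).2.2 : ℂ) * (lam (weightIndexEquiv ι p).1 ^
        ((weightIndexEquiv ι p).2.1 : ℕ) *
          q ^ ((weightIndexEquiv ι p).2.1 * (weightIndexEquiv ι p).2.2 : ℕ)) := by
  simp only [weightIndexEquiv, Equiv.coe_fn_mk, qVar, mul_pow, one_mul, ← pow_mul,
    Nat.succPNat_coe, Nat.succ_eq_add_one, mul_comm (p.1.2 : ℕ)]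

lemma summable_wdeg [Finite ι] (hlam : ∀ j, ‖lam j‖ ≤ 1) (hq : ‖q‖ < 1) :
    Summable fun p : (Σ _ : ι × ℕ+, ℕ) => ‖((p.1.2 : ℕ) : ℂ) * qVar lam q 1 p.1 ^ (p.2 + 1)‖ := by
  simp only [weighted_comp_weightIndexEquiv]
  exact (weightIndexEquiv ι).summable_iff.mpr (summable_weighted hlam hq)

/-- Summing over `j` first turns the coefficients into power sums of the eigenvalues. Their part
supported on multiples of `e` gives the Lambert series at `q^e`, the constant part the one at `q`.
-/
lemma tsum_wdeg {d k R : ℕ} {lam : Fin d → ℂ} (he : 0 < e) (hlam : ∀ j, ‖lam j‖ ≤ 1)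
    (hpow : ∀ m : ℕ, 0 < m → ∑ j, lam j ^ m = (if e ∣ m then (e * R : ℂ) else 0) - k)
    (hq : ‖q‖ < 1) :
    ∑' p : (Σ _ : Fin d × ℕ+, ℕ), ((p.1.2 : ℕ) : ℂ) * qVar lam q 1 p.1 ^ (p.2 + 1)
      = e * R * lambert (q ^ e) - k * lambert q := by
  have hs := (summable_weighted hlam hq).of_norm
  have hs' := (Equiv.prodComm (ℕ+ × ℕ+) (Fin d)).summable_iff.mpr hs
  simp only [Function.comp_def] at hs'
  have h1 := summable_lambert hq
  have h2 : Summable fun c : ℕ+ × ℕ+ =>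
      if e ∣ (c.1 : ℕ) then (c.2 : ℂ) * q ^ (c.1 * c.2 : ℕ) else 0 := by
    refine Summable.of_norm_bounded h1.norm fun c => ?_
    split_ifs
    · rfl
    · rw [norm_zero]
      exact norm_nonneg _
  simp only [weighted_comp_weightIndexEquiv]
  rw [(weightIndexEquiv (Fin d)).tsum_eq fun p : Fin d × (ℕ+ × ℕ+) =>
      (p.2.2 : ℂ) * (lam p.1 ^ (p.2.1 : ℕ) * q ^ (p.2.1 * p.2.2 : ℕ)),
    ← (Equiv.prodComm (ℕ+ × ℕ+) (Fin d)).tsum_eq]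
  rw [Summable.tsum_prod hs', ← tsum_ite_dvd he, lambert, ← tsum_mul_left, ← tsum_mul_left,
    ← (h2.mul_left _).tsum_sub (h1.mul_left _)]
  refine tsum_congr fun c => ?_
  rw [tsum_fintype]
  simp only [Equiv.prodComm_apply, Prod.swap_prod_mk]
  rw [← Finset.mul_sum, ← Finset.sum_mul, hpow _ c.1.pos]
  split_ifs <;> ring

/-- The trace series, as a sum over the basis of `W_tw` fixed by the permutation. -/
theorem hasSum_trace_series {d k R : ℕ} {lam : Fin d → ℂ} (he : 0 < e) (hlam : ∀ j, ‖lam j‖ ≤ 1)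
    (hprod : ∀ y : ℂ, (∏ j, (1 - lam j * y)) * (1 - y) ^ k = (1 - y ^ e) ^ R)
    (hpow : ∀ m : ℕ, 0 < m → ∑ j, lam j ^ m = (if e ∣ m then (e * R : ℂ) else 0) - k)
    (hq : ‖q‖ < 1) (l : ℂ) :
    HasSum (fun i : (Fin d × ℕ+ →₀ ℕ) × Finset (Fin R × ℕ+) × (Fin k × ℕ+ →₀ ℕ) =>
        ((heisWeight i.1 : ℂ) - l) * monom (qVar lam q 1) i.1 *
          ((∏ v ∈ i.2.1, -qVar (fun _ => 1) q e v) * monom (qVar (fun _ => 1) q 1) i.2.2))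
      (-l + e * R * lambert (q ^ e) - k * lambert q) := by
  have hx := norm_qVar_le' one_pos hlam hq
  have hs := summable_norm_qVar one_pos hlam hq
  have hx1 := norm_qVar_le' (ι := Fin k) (lam := fun _ => (1 : ℂ)) one_pos (by simp) hq
  have hs1 := summable_norm_qVar (ι := Fin k) (lam := fun _ => (1 : ℂ)) one_pos (by simp) hq
  have hs2 := summable_norm_qVar (ι := Fin R) (lam := fun _ => (1 : ℂ)) he (by simp) hq
  have hw := hasSum_wdeg_mul_monom hq hx hs (fun v => (v.2 : ℕ)) (summable_wdeg hlam hq)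
  have hV := hw.sub ((summable_norm_monom hq hx hs).of_norm.hasSum.mul_left l)
  simp only [← sub_mul] at hV
  change HasSum (fun s => ((heisWeight s : ℂ) - l) * monom (qVar lam q 1) s) _ at hV
  have hA : Summable fun T : Finset (Fin R × ℕ+) => ‖∏ v ∈ T, -qVar (fun _ => 1) q e v‖ := by
    simpa [norm_prod] using summable_finsetProd_of_summable_nonneg (fun v => norm_nonneg _) hs2
  have hU := summable_norm_monom hq hx1 hs1
  have hAU := hasSum_mul_of_summable_norm hA hU
  have hall := hasSum_mul_of_summable_norm hV.summable.norm hAU.summable.norm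
  refine (congrArg (HasSum _) ?_).mp hall
  rw [hV.tsum_eq, hAU.tsum_eq, tsum_wdeg he hlam hpow hq]
  have e1 := tsum_monom_mul_tsum_prod_neg hq hx hs
  have e2 := tsum_monom_mul_tsum_prod_neg hq hx1 hs1
  have e3 := eulerSum_mul he hlam hprod hq
  change _ * eulerSum lam q 1 = 1 at e1
  change _ * eulerSum (fun _ : Fin k => 1) q 1 = 1 at e2
  change _ * (eulerSum (fun _ : Fin R => 1) q e * _) = _
  -- Once the Clifford factor is split by `eulerSum_mul`, its two parts cancel the characters of `V`
  -- and `U`, leaving the logarithmic derivative minus `l`.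
  rw [← e3]
  linear_combination (-l + e * R * lambert (q ^ e) - k * lambert q) *
    ((∑' s, monom (qVar (fun _ : Fin k => (1 : ℂ)) q 1) s) *
      eulerSum (fun _ : Fin k => 1) q 1 * e1 + e2)

end TraceSeries

/-! ### Eigenspaces and traces in an eigenbasis -/

section Eigenbasis

variable {V I : Type*} [AddCommGroup V] [Module ℂ V] (b : Module.Basis I ℂ V)

lemma repr_of_diagonal {T : Module.End ℂ V} {t : I → ℂ} (hT : ∀ i, T (b i) = t i • b i) (v : V)
    (i : I) : b.repr (T v) i = t i * b.repr v i := by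
  classical
  have h : (b.coord i) ∘ₗ T = t i • b.coord i := by
    refine b.ext fun j => ?_
    rw [LinearMap.comp_apply, hT, map_smul, LinearMap.smul_apply, Module.Basis.coord_apply,
      Module.Basis.repr_self, Finsupp.single_apply]
    split_ifs with h
    · rw [h]
    · simp
  exact LinearMap.congr_fun h v

theorem mem_eigenspace_iff_repr {T : Module.End ℂ V} {t : I → ℂ} (hT : ∀ i, T (b i) = t i • b i)
    (μ : ℂ) (v : V) :
    v ∈ Module.End.eigenspace T μ ↔ ∀ i, b.repr v i ≠ 0 → t i = μ := by
  rw [Module.End.mem_eigenspace_iff, ← b.repr.injective.eq_iff, DFunLike.ext_iff]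
  refine forall_congr' fun i => ?_
  rw [repr_of_diagonal b hT, map_smul, Finsupp.smul_apply, smul_eq_mul]
  constructor
  · exact fun h hv => mul_right_cancel₀ hv h
  · intro h
    by_cases hv : b.repr v i = 0
    · rw [hv, mul_zero, mul_zero]
    · rw [h hv]

variable {b} {U : Submodule ℂ V} {p : Finset I}

lemma basis_mem_of_mem (hU : ∀ v, v ∈ U ↔ ∀ i, b.repr v i ≠ 0 → i ∈ p)
    {i : I} (hi : i ∈ p) : b i ∈ U := by
  classical
  rw [hU]
  intro j hj
  rw [Module.Basis.repr_self, Finsupp.single_apply] at hj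
  have : i = j := by
    by_contra h
    exact hj (if_neg h)
  exact this ▸ hi

/-- The basis of a coordinate subspace. -/
def coordinateBasis (hU : ∀ v, v ∈ U ↔ ∀ i, b.repr v i ≠ 0 → i ∈ p) :
    Module.Basis p ℂ U :=
  Module.Basis.mk (v := fun i : p => (⟨b i, basis_mem_of_mem hU i.2⟩ : U))
    (LinearIndependent.of_comp U.subtype (b.linearIndependent.comp _ Subtype.val_injective))
    (by
      rintro ⟨u, hu⟩ -
      have h : (⟨u, hu⟩ : U)
          = ∑ i : p, b.repr u i • (⟨b i, basis_mem_of_mem hU i.2⟩ : U) := by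
        apply Subtype.ext
        have hsupp : (b.repr u).support ⊆ p := fun i hi =>
          (hU u).mp hu i (Finsupp.mem_support_iff.mp hi)
        refine (b.linearCombination_repr u).symm.trans ?_
        rw [Finsupp.linearCombination_apply, Finsupp.sum_of_support_subset _ hsupp _ (by simp),
          ← Finset.sum_coe_sort]
        simp
      rw [h]
      exact Submodule.sum_mem _ fun i _ => Submodule.smul_mem _ _ (Submodule.subset_span ⟨i, rfl⟩))

lemma coordinateBasis_apply (hU : ∀ v, v ∈ U ↔ ∀ i, b.repr v i ≠ 0 → i ∈ p)
    (i : p) : (coordinateBasis hU i : V) = b i := by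
  rw [coordinateBasis, Module.Basis.mk_apply]

lemma coordinateBasis_repr (hU : ∀ v, v ∈ U ↔ ∀ i, b.repr v i ≠ 0 → i ∈ p)
    (u : U) (i : p) : (coordinateBasis hU).repr u i = b.repr (u : V) i := by
  classical
  have h : (coordinateBasis hU).coord i = b.coord i ∘ₗ U.subtype := by
    refine (coordinateBasis hU).ext fun j => ?_
    rw [LinearMap.comp_apply, Submodule.subtype_apply, coordinateBasis_apply,
      Module.Basis.coord_apply, Module.Basis.coord_apply, Module.Basis.repr_self,
      Module.Basis.repr_self, Finsupp.single_apply, Finsupp.single_apply]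
    simp only [Subtype.ext_iff]
  exact LinearMap.congr_fun h u

/-- `U` is spanned by part of the basis, so its coordinates, and hence the diagonal entries, are
those of the ambient space. -/
theorem trace_eq_sum_repr (hU : ∀ v, v ∈ U ↔ ∀ i, b.repr v i ≠ 0 → i ∈ p)
    (T : Module.End ℂ U) (T₀ : Module.End ℂ V)
    (hT : ∀ u : U, (T u : V) = T₀ u) :
    LinearMap.trace ℂ U T = ∑ i ∈ p, b.repr (T₀ (b i)) i := by
  classical
  rw [LinearMap.trace_eq_matrix_trace ℂ (coordinateBasis hU), Matrix.trace,
    ← Finset.sum_coe_sort p]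
  refine Finset.sum_congr rfl fun i _ => ?_
  rw [Matrix.diag_apply, LinearMap.toMatrix_apply, coordinateBasis_repr, hT, coordinateBasis_apply]

end Eigenbasis

/-! ### Numerical identities -/

lemma ell_of_mul_eq {N m : ℕ} (h : N ^ 2 = 24 * m + 1) : ell N = m := by
  have h1 : ((N : ℚ) ^ 2 - 1) / 24 = (m : ℤ) := by
    have : (N : ℚ) ^ 2 = 24 * m + 1 := by exact_mod_cast h
    rw [this]
    push_cast
    ring
  rw [ell, h1, Rat.num_intCast, Int.toNat_natCast]

/-- Every residue coprime to `24` squares to `1` modulo `24`. -/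
lemma sq_eq_of_prime {N : ℕ} (hN : N.Prime) (h2 : N ≠ 2) (h3 : N ≠ 3) :
    ∃ m, N ^ 2 = 24 * m + 1 := by
  have h2' : ¬2 ∣ N := fun h => h2 ((Nat.prime_dvd_prime_iff_eq Nat.prime_two hN).mp h).symm
  have h3' : ¬3 ∣ N := fun h => h3 ((Nat.prime_dvd_prime_iff_eq Nat.prime_three hN).mp h).symm
  have h24 : N ^ 2 % 24 = 1 := by
    have hlt : N % 24 < 24 := Nat.mod_lt _ (by norm_num)
    have hc2 : N % 24 % 2 ≠ 0 := by omega
    have hc3 : N % 24 % 3 ≠ 0 := by omega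
    rw [Nat.pow_mod]
    generalize N % 24 = c at hlt hc2 hc3
    interval_cases c <;> simp_all
  exact ⟨N ^ 2 / 24, by omega⟩

/-- `k` is the denominator of `(N² - 1)/24`, namely `8`, `3` and `1`, so clearing it gives `k (N² -
1) = 24 ℓ_N`. -/
lemma kdim_mul_sq {N : ℕ} (hN : N.Prime) : kdim N * N ^ 2 = 24 * ell N + kdim N := by
  by_cases h2 : N = 2
  · subst h2
    norm_num [kdim, ell]
  by_cases h3 : N = 3
  · subst h3
    norm_num [kdim, ell]
  obtain ⟨m, hm⟩ := sq_eq_of_prime hN h2 h3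
  rw [ell_of_mul_eq hm, kdim, if_neg h2, if_neg h3, one_mul, hm]

lemma numFermions_eq (N : ℕ) : numFermions N = kdim N * N ^ 2 := by
  unfold numFermions numCycles kdim
  split_ifs with h2 h3
  · subst h2; norm_num
  · subst h3; norm_num
  · ring

/-! ### An eigenbasis of `W_tw` -/

section WBasis

/-- The index set of the basis of `W_tw`. -/
abbrev WIndex (N : ℕ) : Type :=
  (Fin (24 * ell N) × ℕ+ →₀ ℕ) × (Fin (numFermions N) → Finset ℕ+) × (Fin (kdim N) × ℕ+ →₀ ℕ)

variable {N : ℕ}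

/-- The basis of `W_tw` attached to a basis of `𝔥`. -/
def wBasis (e : Module.Basis (Fin (24 * ell N)) ℂ (Fin (24 * ell N) → ℂ)) :
    Module.Basis (WIndex N) ℂ (Wtw N) :=
  (heisBasis e).tensorProduct
    ((tensorBasis (numFermions N)).tensorProduct (heisBasis (Pi.basisFun ℂ (Fin (kdim N)))))

variable (e : Module.Basis (Fin (24 * ell N)) ℂ (Fin (24 * ell N) → ℂ))

lemma op_wBasis (f : Module.End ℂ (Heis (24 * ell N)))
    (g : Module.End ℂ (AtwTensor (numFermions N))) (h : Module.End ℂ (Heis (kdim N)))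
    (i : WIndex N) :
    op N f g h (wBasis e i) = f (heisBasis e i.1) ⊗ₜ[ℂ] (g (tensorBasis (numFermions N) i.2.1) ⊗ₜ[ℂ]
      h (heisBasis (Pi.basisFun ℂ (Fin (kdim N))) i.2.2)) := by
  rw [wBasis, Module.Basis.tensorProduct_apply, Module.Basis.tensorProduct_apply, op,
    TensorProduct.map_tmul, TensorProduct.map_tmul]

lemma op_wBasis_of_smul {f : Module.End ℂ (Heis (24 * ell N))}
    {g : Module.End ℂ (AtwTensor (numFermions N))} {h : Module.End ℂ (Heis (kdim N))}
    {i j : WIndex N} {x y z : ℂ} (hf : f (heisBasis e i.1) = x • heisBasis e j.1)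
    (hg : g (tensorBasis (numFermions N) i.2.1) = y • tensorBasis (numFermions N) j.2.1)
    (hh : h (heisBasis (Pi.basisFun ℂ (Fin (kdim N))) i.2.2)
      = z • heisBasis (Pi.basisFun ℂ (Fin (kdim N))) j.2.2) :
    op N f g h (wBasis e i) = (x * (y * z)) • wBasis e j := by
  rw [op_wBasis, hf, hg, hh, wBasis, Module.Basis.tensorProduct_apply,
    Module.Basis.tensorProduct_apply, TensorProduct.smul_tmul_smul, TensorProduct.smul_tmul_smul]

lemma op_mul (f f' : Module.End ℂ (Heis (24 * ell N)))
    (g g' : Module.End ℂ (AtwTensor (numFermions N))) (h h' : Module.End ℂ (Heis (kdim N))) :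
    op N f g h * op N f' g' h' = op N (f * f') (g * g') (h * h') := by
  rw [op, op, op, TensorProduct.map_mul, TensorProduct.map_mul]

lemma op_one : op N 1 1 1 = 1 := by
  rw [op, TensorProduct.map_one, TensorProduct.map_one]

lemma op_pow (f : Module.End ℂ (Heis (24 * ell N)))
    (g : Module.End ℂ (AtwTensor (numFermions N))) (a : ℕ) :
    op N f g 1 ^ a = op N (f ^ a) (g ^ a) 1 := by
  induction a with
  | zero => rw [pow_zero, pow_zero, pow_zero, op_one]
  | succ a ih => rw [pow_succ, ih, op_mul, ← pow_succ, ← pow_succ, one_mul]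

lemma one_apply_eq_one_smul {V : Type*} [AddCommGroup V] [Module ℂ V] (v : V) :
    (1 : Module.End ℂ V) v = (1 : ℂ) • v := by
  rw [Module.End.one_apply, one_smul]

/-- The eigenvalue of `L(0) - c / 24` on a basis vector. -/
def wDeg (i : WIndex N) : ℕ := heisWeight i.1 + (fockWeight i.2.1 + heisWeight i.2.2)

/-- The eigenvalue of `L_1(0) - c_1 / 24` on a basis vector. -/
def wWeight (i : WIndex N) : ℤ := (heisWeight i.1 : ℤ) - ell N

/-- The eigenvalue of `\tilde p(0)` on a basis vector. -/
def wSign (i : WIndex N) : ℤˣ := (-1) ^ (oddSet i.2.1).card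

lemma shiftedL1_wBasis (B : LinearMap.BilinForm ℂ (Fin (24 * ell N) → ℂ)) (hB : B.Nondegenerate)
    (i : WIndex N) : shiftedL1 N B hB (wBasis e i) = (wWeight i : ℂ) • wBasis e i := by
  rw [shiftedL1, LinearMap.sub_apply, LinearMap.smul_apply, Module.End.one_apply,
    op_wBasis_of_smul e (j := i) (heisL0_heisBasis B hB e i.1) (one_apply_eq_one_smul _)
      (one_apply_eq_one_smul _), wWeight]
  refine (sub_smul _ _ (wBasis e i)).symm.trans (congrArg (· • wBasis e i) ?_)
  push_cast
  ring

/-- Each Clifford factor has vacuum energy `1/16 - 1/48 = 1/24`. -/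
lemma shiftedL2_wBasis (i : WIndex N) :
    shiftedL2 N (wBasis e i)
      = ((numFermions N : ℂ) / 24 + (fockWeight i.2.1 : ℂ)) • wBasis e i := by
  rw [shiftedL2, LinearMap.sub_apply, LinearMap.smul_apply, Module.End.one_apply,
    op_wBasis_of_smul e (j := i) (one_apply_eq_one_smul _) (cliffTensorL0_tensorBasis i.2.1)
      (one_apply_eq_one_smul _)]
  refine (sub_smul _ _ (wBasis e i)).symm.trans (congrArg (· • wBasis e i) ?_)
  ring

lemma shiftedL3_wBasis (C : LinearMap.BilinForm ℂ (Fin (kdim N) → ℂ)) (hC : C.Nondegenerate)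
    (i : WIndex N) :
    shiftedL3 N C hC (wBasis e i) = ((heisWeight i.2.2 : ℂ) - (kdim N : ℂ) / 24) • wBasis e i := by
  rw [shiftedL3, LinearMap.sub_apply, LinearMap.smul_apply, Module.End.one_apply,
    op_wBasis_of_smul e (j := i) (one_apply_eq_one_smul _) (one_apply_eq_one_smul _)
      (heisL0_heisBasis C hC _ i.2.2)]
  refine (sub_smul _ _ (wBasis e i)).symm.trans (congrArg (· • wBasis e i) ?_)
  ring

/-- The vacuum energies add up to `(M - 24 ℓ_N - k)/24 = 0`, so the eigenvalue is the plain sum of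
the three weights. -/
lemma shiftedL_wBasis (hN : N.Prime) (B : LinearMap.BilinForm ℂ (Fin (24 * ell N) → ℂ))
    (hB : B.Nondegenerate) (C : LinearMap.BilinForm ℂ (Fin (kdim N) → ℂ)) (hC : C.Nondegenerate)
    (i : WIndex N) : shiftedL N B hB C hC (wBasis e i) = (wDeg i : ℂ) • wBasis e i := by
  rw [shiftedL, LinearMap.add_apply, LinearMap.add_apply, shiftedL1_wBasis, shiftedL2_wBasis,
    shiftedL3_wBasis, ← add_smul, ← add_smul, wDeg, wWeight]
  congr 1
  have h : (numFermions N : ℂ) = 24 * ell N + kdim N := by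
    rw [numFermions_eq, kdim_mul_sq hN]
    push_cast
    ring
  rw [h]
  push_cast
  ring

lemma pTildeW_wBasis (i : WIndex N) :
    pTildeW N (wBasis e i) = ((wSign i : ℤ) : ℂ) • wBasis e i := by
  rw [pTildeW, op_wBasis_of_smul e (j := i) (one_apply_eq_one_smul _) (pTilde_tensorBasis i.2.1)
    (one_apply_eq_one_smul _), wSign]
  congr 1
  push_cast
  ring

/-- A variable of mode `n` with exponent `s` adds `s n` to the weight, so the bound limits both the
modes that occur and their exponents. -/
lemma finite_heisWeight_le (d n : ℕ) : {s : Fin d × ℕ+ →₀ ℕ | heisWeight s ≤ n}.Finite := by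
  classical
  refine (Set.finite_Iic (Finsupp.indicator ((Finset.univ : Finset (Fin d)) ×ˢ
    Finset.Icc 1 (n.succPNat)) fun _ _ => n)).subset fun s hs => ?_
  have hle : ∀ v ∈ s.support, s v * v.2 ≤ n := fun v hv =>
    (Finset.single_le_sum (f := fun v => s v * (v.2 : ℕ)) (fun _ _ => Nat.zero_le _) hv).trans hs
  intro v
  by_cases hv : v ∈ s.support
  · have h1 := hle v hv
    have h2 : 0 < s v := Nat.pos_of_ne_zero (Finsupp.mem_support_iff.mp hv)
    have h3 : v.2 ∈ Finset.Icc 1 (n.succPNat) := by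
      rw [Finset.mem_Icc, ← PNat.coe_le_coe v.2, Nat.succPNat_coe]
      exact ⟨one_le, ((Nat.le_mul_of_pos_left _ h2).trans h1).trans (Nat.le_succ n)⟩
    rw [Finsupp.indicator_apply, dif_pos (Finset.mem_product.mpr ⟨Finset.mem_univ _, h3⟩)]
    exact (Nat.le_mul_of_pos_right _ v.2.pos).trans h1
  · rw [Finsupp.notMem_support_iff.mp hv]
    exact Nat.zero_le _

lemma finite_fockWeight_le (M n : ℕ) : {f : Fin M → Finset ℕ+ | fockWeight f ≤ n}.Finite := by
  refine (Set.Finite.pi' fun _ : Fin M => (Finset.Icc 1 (n.succPNat)).powerset.finite_toSet).subset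
    fun f hf i => ?_
  rw [Finset.mem_coe, Finset.mem_powerset]
  intro m hm
  have h1 : (m : ℕ) ≤ ∑ m ∈ f i, (m : ℕ) :=
    Finset.single_le_sum (f := fun m : ℕ+ => (m : ℕ)) (fun _ _ => Nat.zero_le _) hm
  have h2 : ∑ m ∈ f i, (m : ℕ) ≤ fockWeight f :=
    Finset.single_le_sum (f := fun i => ∑ m ∈ f i, (m : ℕ)) (fun _ _ => Nat.zero_le _)
      (Finset.mem_univ i)
  rw [Finset.mem_Icc, ← PNat.coe_le_coe m, Nat.succPNat_coe]
  exact ⟨one_le, ((h1.trans h2).trans hf).trans (Nat.le_succ n)⟩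

lemma finite_wDeg (n : ℕ) : {i : WIndex N | wDeg i = n}.Finite := by
  refine ((finite_heisWeight_le _ n).prod ((finite_fockWeight_le _ n).prod
    (finite_heisWeight_le _ n))).subset fun i hi => ?_
  simp only [wDeg, Set.mem_ofPred_eq, Set.mem_prod] at hi ⊢
  omega

/-- The basis vectors of degree `n`. -/
def wFiber (N n : ℕ) : Finset (WIndex N) := (finite_wDeg n).toFinset

lemma mem_wFiber {n : ℕ} {i : WIndex N} : i ∈ wFiber N n ↔ wDeg i = n := by
  simp [wFiber]

lemma wWeight_mem {n : ℕ} {i : WIndex N} (hi : i ∈ wFiber N n) : wWeight i ∈ weights N n := by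
  rw [mem_wFiber, wDeg] at hi
  rw [weights, Finset.mem_Icc, wWeight]
  omega

/-! ### The graded and fine pieces as coordinate subspaces. -/

section Pieces

variable (B : LinearMap.BilinForm ℂ (Fin (24 * ell N) → ℂ))
    (hB : B.Nondegenerate) (C : LinearMap.BilinForm ℂ (Fin (kdim N) → ℂ)) (hC : C.Nondegenerate)

lemma mem_gradedPiece_iff (hN : N.Prime) (n : ℕ) (v : Wtw N) : v ∈ gradedPiece N B hB C hC n ↔
    ∀ i, (wBasis e).repr v i ≠ 0 → i ∈ wFiber N n := by
  rw [gradedPiece, mem_eigenspace_iff_repr _ (shiftedL_wBasis e hN B hB C hC)]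
  simp only [Nat.cast_inj, mem_wFiber]

lemma mem_finePiece_iff (hN : N.Prime) (n : ℕ) (m : ℤ) (ε : ℤˣ) (v : Wtw N) :
    v ∈ finePiece N B hB C hC n m ε ↔
    ∀ i, (wBasis e).repr v i ≠ 0 →
      i ∈ (wFiber N n).filter fun i => (wWeight i, wSign i) = (m, ε) := by
  rw [finePiece, Submodule.mem_inf, Submodule.mem_inf, mem_gradedPiece_iff e B hB C hC hN,
    mem_eigenspace_iff_repr _ (shiftedL1_wBasis e B hB),
    mem_eigenspace_iff_repr _ (pTildeW_wBasis e)]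
  simp only [Finset.mem_filter, Prod.mk.injEq, Int.cast_inj, Units.val_inj]
  constructor
  · exact fun h i hi => ⟨h.1.1 i hi, h.1.2 i hi, h.2 i hi⟩
  · exact fun h => ⟨⟨fun i hi => (h i hi).1, fun i hi => (h i hi).2.1⟩, fun i hi => (h i hi).2.2⟩

lemma isInternal_gradedPiece (hN : N.Prime) : DirectSum.IsInternal (gradedPiece N B hB C hC) := by
  let e := Pi.basisFun ℂ (Fin (24 * ell N))
  refine DirectSum.isInternal_submodule_of_iSupIndep_of_iSup_eq_top
    ((shiftedL N B hB C hC).eigenspaces_iSupIndep.comp Nat.cast_injective) ?_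
  rw [eq_top_iff, ← (wBasis e).span_eq, Submodule.span_le]
  rintro _ ⟨i, rfl⟩
  exact Submodule.mem_iSup_of_mem (wDeg i)
    (basis_mem_of_mem (mem_gradedPiece_iff e B hB C hC hN _) (mem_wFiber.mpr rfl))

lemma gradedPiece_eq_iSup (hN : N.Prime) (n : ℕ) : gradedPiece N B hB C hC n
    = ⨆ m ∈ weights N n, ⨆ ε : ℤˣ, finePiece N B hB C hC n m ε := by
  let e := Pi.basisFun ℂ (Fin (24 * ell N))
  refine le_antisymm (fun v hv => ?_)
    (iSup₂_le fun m _ => iSup_le fun ε => finePiece_le N B hB C hC n m ε)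
  rw [← (wBasis e).linearCombination_repr v, Finsupp.linearCombination_apply]
  refine Submodule.sum_mem _ fun i hi => Submodule.smul_mem _ _ ?_
  have hi' := (mem_gradedPiece_iff e B hB C hC hN n v).mp hv i (Finsupp.mem_support_iff.mp hi)
  refine Submodule.mem_iSup_of_mem (wWeight i) (Submodule.mem_iSup_of_mem (wWeight_mem hi')
    (Submodule.mem_iSup_of_mem (wSign i) ?_))
  exact basis_mem_of_mem (mem_finePiece_iff e B hB C hC hN _ _ _)
    (Finset.mem_filter.mpr ⟨hi', rfl⟩)

lemma finiteDimensional_gradedPiece (hN : N.Prime) (n : ℕ) :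
    FiniteDimensional ℂ (gradedPiece N B hB C hC n) :=
  Module.Finite.of_basis (coordinateBasis (mem_gradedPiece_iff
    (Pi.basisFun ℂ (Fin (24 * ell N))) B hB C hC hN n))

theorem trace_virtualPiece (hN : N.Prime) {G : Type} [Group G] (ρ : Representation ℂ G (Wtw N))
    (hfin : ∀ n, FiniteDimensional ℂ (gradedPiece N B hB C hC n))
    (hst : ∀ n m ε g, finePiece N B hB C hC n m ε ≤ (finePiece N B hB C hC n m ε).comap (ρ g))
    (n : ℕ) (g : G) :
    VirtualRep.trace g (virtualPiece N B hB C hC ρ hfin hst n)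
      = ∑ i ∈ wFiber N n, (wWeight i : ℂ) * ((wSign i : ℤ) : ℂ) *
        (wBasis e).repr (ρ g (wBasis e i)) i := by
  have h1 : ∀ m ε, VirtualRep.trace g (fineClass N B hB C hC ρ hfin hst n m ε)
      = ∑ i ∈ (wFiber N n).filter fun i => (wWeight i, wSign i) = (m, ε),
        (wBasis e).repr (ρ g (wBasis e i)) i := by
    intro m ε
    rw [← trace_eq_sum_repr (mem_finePiece_iff e B hB C hC hN n m ε)
      (ρ.subrepresentation (finePiece N B hB C hC n m ε) (hst n m ε) g) (ρ g) fun u => rfl]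
    rw [fineClass, VirtualRep.cls, VirtualRep.trace]
    erw [QuotientAddGroup.lift_mk]
    rw [FreeAbelianGroup.lift_apply_of]
    rfl
  -- The basis vectors of degree `n` are grouped by the pair (weight, sign), on which the
  -- multiplicity `m ε` is constant.
  rw [virtualPiece, ← Finset.sum_product', map_sum, ← Finset.sum_fiberwise_of_maps_to
    (s := wFiber N n) (t := weights N n ×ˢ Finset.univ) (g := fun i => (wWeight i, wSign i))
    fun i hi => Finset.mem_product.mpr ⟨wWeight_mem hi, Finset.mem_univ _⟩]
  refine Finset.sum_congr rfl fun p _ => ?_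
  rw [map_zsmul, h1, zsmul_eq_mul, Finset.mul_sum]
  refine Finset.sum_congr rfl fun i hi => ?_
  have h2 := (Finset.mem_filter.mp hi).2
  rw [← h2]
  push_cast
  ring

end Pieces

end WBasis

/-! ### The orbits of the permutation -/

section Orbits

variable {M N r : ℕ} {σ : Equiv.Perm (Fin M)}

lemma perm_pow_eq_one (hN : N.Prime) (hσ : σ.cycleType = Multiset.replicate r N) : σ ^ N = 1 := by
  have := Fact.mk hN
  rw [Equiv.Perm.pow_prime_eq_one_iff]
  intro c hc
  rw [hσ] at hc
  exact Multiset.eq_of_mem_replicate hc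

/-- `cycleType` lists only nontrivial cycles; here their lengths already add up to `M`, which leaves
no fixed points. -/
lemma perm_apply_ne (hσ : σ.cycleType = Multiset.replicate r N) (hM : M = N * r) (x : Fin M) :
    σ x ≠ x := by
  have h : σ.support = Finset.univ := by
    rw [← Finset.card_eq_iff_eq_univ, ← Equiv.Perm.sum_cycleType, hσ]
    simp [hM, mul_comm]
  rw [← Equiv.Perm.mem_support, h]
  exact Finset.mem_univ x

/-- The map to the set of orbits of a permutation with cycle shape `N^r`. -/
theorem exists_orbit_map (hN : N.Prime) (hσ : σ.cycleType = Multiset.replicate r N)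
    (hM : M = N * r) :
    ∃ o : Fin M → Fin r, (∀ x y, o x = o y ↔ σ.SameCycle x y) ∧
      ∀ c, (Finset.univ.filter fun x => o x = c).card = N := by
  classical
  let Q := Quotient (Equiv.Perm.SameCycle.setoid σ)
  have hmk : ∀ x y : Fin M, (Quotient.mk _ x : Q) = Quotient.mk _ y ↔ σ.SameCycle x y :=
    fun x y => Quotient.eq
  have hfib : ∀ c : Q, (Finset.univ.filter fun x : Fin M => (Quotient.mk _ x : Q) = c).card = N := by
    intro c
    obtain ⟨x, rfl⟩ := Quotient.exists_rep c
    have h1 : (Finset.univ.filter fun y : Fin M => (Quotient.mk _ y : Q) = Quotient.mk _ x)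
        = (σ.cycleOf x).support := by
      ext y
      rw [Finset.mem_filter, hmk, Equiv.Perm.mem_support_cycleOf_iff, Equiv.Perm.mem_support]
      simp [perm_apply_ne hσ hM x, Equiv.Perm.sameCycle_comm]
    have h2 : (σ.cycleOf x).support.card ∈ σ.cycleType := by
      rw [Equiv.Perm.cycleType_def, Multiset.mem_map]
      exact ⟨σ.cycleOf x, Finset.mem_val.mpr (Equiv.Perm.cycleOf_mem_cycleFactorsFinset_iff.mpr
        (Equiv.Perm.mem_support.mpr (perm_apply_ne hσ hM x))), rfl⟩
    rw [h1]
    rw [hσ] at h2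
    exact Multiset.eq_of_mem_replicate h2
  -- Counting `Fin M` by orbits of size `N` gives `N r = M = |Q| N`.
  have hcard : Fintype.card Q = r := by
    have h1 := Finset.card_eq_sum_card_fiberwise (s := (Finset.univ : Finset (Fin M)))
      (t := (Finset.univ : Finset Q)) (f := fun x => Quotient.mk _ x) (fun x _ => Finset.mem_univ _)
    rw [Finset.sum_congr rfl fun c _ => hfib c, Finset.sum_const, Finset.card_univ,
      Finset.card_univ, Fintype.card_fin, smul_eq_mul] at h1
    exact Nat.eq_of_mul_eq_mul_right hN.pos (h1.symm.trans (hM.trans (mul_comm N r)))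
  let φ := Fintype.equivFinOfCardEq hcard
  refine ⟨fun x => φ (Quotient.mk _ x), fun x y => ?_, fun c => ?_⟩
  · rw [φ.injective.eq_iff, hmk]
  · rw [← hfib (φ.symm c)]
    congr 1
    ext x
    simp [Equiv.eq_symm_apply]

/-- A function is invariant under a nontrivial power of `σ` if and only if it is constant on the
orbits. -/
lemma comp_symm_eq_iff {X : Type*} (hN : N.Prime) (hσ : σ ^ N = 1) {a : ℕ} (ha : ¬N ∣ a)
    {R : ℕ} {o : Fin M → Fin R} (ho : ∀ x y, o x = o y ↔ σ.SameCycle x y)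
    (hsurj : Function.Surjective o) (f : Fin M → X) :
    f ∘ (σ ^ a).symm = f ↔ ∃ g, f = g ∘ o := by
  constructor
  · intro h
    have h1 : ∀ x, f ((σ ^ a) x) = f x := fun x => by
      conv_lhs => rw [← h]
      simp
    have h2 : ∀ k x, f (((σ ^ a) ^ k) x) = f x := by
      intro k
      induction k with
      | zero => intro x; rfl
      | succ k ih =>
        intro x
        rw [pow_succ', Equiv.Perm.mul_apply, h1, ih]
    -- `a` is prime to the order of `σ`, so `σ` is itself a power of `σ ^ a`.
    have h3 : ∀ x, f (σ x) = f x := by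
      obtain ⟨k, hk⟩ := exists_pow_eq_self_of_coprime (x := σ)
        (n := a) (Nat.Coprime.coprime_dvd_right (orderOf_dvd_of_pow_eq_one hσ)
          ((Nat.Prime.coprime_iff_not_dvd hN).mpr ha).symm)
      intro x
      conv_lhs => rw [← hk]
      exact h2 k x
    have h4 : ∀ k x, f ((σ ^ k) x) = f x := by
      intro k
      induction k with
      | zero => intro x; rfl
      | succ k ih =>
        intro x
        rw [pow_succ', Equiv.Perm.mul_apply, h3, ih]
    refine ⟨fun c => f (Function.surjInv hsurj c), funext fun x => ?_⟩
    have h5 : σ.SameCycle (Function.surjInv hsurj (o x)) x :=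
      (ho _ _).mp (Function.surjInv_eq hsurj (o x))
    obtain ⟨k, -, hk⟩ := h5.exists_pow_eq'
    rw [Function.comp_apply, ← h4 k (Function.surjInv hsurj (o x)), hk]
  · rintro ⟨g, rfl⟩
    ext1 x
    have : o ((σ ^ a).symm x) = o x := by
      rw [ho]
      refine ⟨a, ?_⟩
      rw [zpow_natCast]
      exact Equiv.apply_symm_apply (σ ^ a) x
    simp only [Function.comp_apply, this]

lemma sum_comp_orbit {R e : ℕ} {o : Fin M → Fin R}
    (hfib : ∀ c, (Finset.univ.filter fun x => o x = c).card = e) (F : Fin R → ℕ) :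
    ∑ x, F (o x) = e * ∑ c, F c := by
  rw [← Finset.sum_fiberwise_of_maps_to (t := Finset.univ) (g := o) (fun x _ => Finset.mem_univ _),
    Finset.mul_sum]
  refine Finset.sum_congr rfl fun c _ => ?_
  rw [Finset.sum_congr rfl fun x hx => by rw [(Finset.mem_filter.mp hx).2], Finset.sum_const, hfib,
    smul_eq_mul]

lemma fockWeight_comp {R e : ℕ} {o : Fin M → Fin R}
    (hfib : ∀ c, (Finset.univ.filter fun x => o x = c).card = e) (g : Fin R → Finset ℕ+) :
    fockWeight (g ∘ o) = e * fockWeight g :=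
  sum_comp_orbit hfib fun c => ∑ n ∈ g c, (n : ℕ)

lemma card_oddSet_comp {R e : ℕ} {o : Fin M → Fin R}
    (hfib : ∀ c, (Finset.univ.filter fun x => o x = c).card = e) (g : Fin R → Finset ℕ+) :
    (oddSet (g ∘ o)).card = e * (oddSet g).card := by
  have h := sum_comp_orbit hfib fun c => if Odd (g c).card then 1 else 0
  rw [oddSet, oddSet, Finset.card_filter, Finset.card_filter]
  exact h

/-- The powers of the permutation operator on the basis, together with their signs. -/
theorem exists_sign (hN : N.Prime) (hσ : σ.cycleType = Multiset.replicate r N) (hM : M = N * r)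
    (sigmaOp : Module.End ℂ (AtwTensor M))
    (hsigmaOp : sigmaOp = koszulPerm σ ∨ (N ≠ 2 ∧ sigmaOp = plainPerm σ)) :
    ∃ sg : ℕ → Finset (Fin M) → ℂ,
      (∀ a f, (sigmaOp ^ a) (tensorBasis M f)
        = sg a (oddSet f) • tensorBasis M (f ∘ (σ ^ a).symm)) ∧ (∀ S, sg 0 S = 1) ∧
      (∀ S, sg N S = 1) ∧
      ∀ a, ¬N ∣ a → ∀ S : Finset (Fin M), S.map (σ ^ a).toEmbedding = S → ∀ t, S.card = N * t →
        sg a S * (-1) ^ S.card = (-1) ^ t := by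
  have hpow := perm_pow_eq_one hN hσ
  have hodd : ∀ t, Odd N → (-1 : ℂ) ^ (N * t) = (-1) ^ t := fun t h => by
    rw [pow_mul, h.neg_one_pow]
  rcases hsigmaOp with rfl | ⟨h2, rfl⟩
  · refine ⟨fun a S => koszulSign (σ ^ a) S, fun a f => ?_, fun S => ?_, fun S => ?_,
      fun a ha S hS t ht => ?_⟩
    · rw [koszulPerm_pow, koszulPerm_tensorBasis]
    · dsimp only
      rw [pow_zero, koszulSign_one]
    · dsimp only
      rw [hpow, koszulSign_one]
    · dsimp only
      -- For `N = 2`, the factor `(-1)^{2t}` from `p̃(0)` is trivial and the Koszul sign of the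
      -- involution is `(-1)^t`. For odd `N` the Koszul sign is trivial and `(-1)^{Nt} = (-1)^t`.
      rcases hN.eq_two_or_odd' with rfl | h
      · have hσ2 : ∀ i, σ (σ i) = i := fun i => by
          have := Equiv.congr_fun hpow i
          rwa [pow_two, Equiv.Perm.mul_apply, Equiv.Perm.one_apply] at this
        have ha' : σ ^ a = σ := by
          obtain ⟨k, rfl⟩ : Odd a := by
            rw [← Nat.not_even_iff_odd, even_iff_two_dvd]
            exact ha
          rw [pow_succ, pow_mul, hpow, one_pow, one_mul]
        rw [ha'] at hS ⊢
        rw [koszulSign_of_involution hS hσ2 (perm_apply_ne hσ hM) ht, ht, pow_mul]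
        simp
      · rw [koszulSign_of_odd hS h (by rw [← pow_mul, mul_comm, pow_mul, hpow, one_pow]), one_mul, ht,
          hodd t h]
  · refine ⟨fun a S => 1, fun a f => ?_, fun S => rfl, fun S => rfl, fun a ha S hS t ht => ?_⟩
    · rw [plainPerm_pow, plainPerm_tensorBasis, one_smul]
    · rw [one_mul, ht, hodd t (hN.eq_two_or_odd'.resolve_left h2)]

/-! ### Families of finite sets -/

/-- The family of the slices of a finite set of pairs. -/
def slices {R : ℕ} (T : Finset (Fin R × ℕ+)) (c : Fin R) : Finset ℕ+ :=
  (T.filter fun v => v.1 = c).image Prod.snd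

lemma mem_slices {R : ℕ} {T : Finset (Fin R × ℕ+)} {c : Fin R} {n : ℕ+} :
    n ∈ slices T c ↔ (c, n) ∈ T := by
  simp [slices]

lemma slices_bijective (R : ℕ) :
    Function.Bijective (slices : Finset (Fin R × ℕ+) → Fin R → Finset ℕ+) := by
  constructor
  · intro T T' h
    ext ⟨c, n⟩
    rw [← mem_slices, h, mem_slices]
  · intro g
    refine ⟨(Finset.univ.sigma g).map (Equiv.sigmaEquivProd _ _).toEmbedding, ?_⟩
    ext c n
    rw [mem_slices, Finset.mem_map_equiv]
    simp

lemma prod_slices {R : ℕ} (T : Finset (Fin R × ℕ+)) (h : Fin R × ℕ+ → ℂ) :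
    ∏ v ∈ T, h v = ∏ c, ∏ n ∈ slices T c, h (c, n) := by
  rw [← Finset.prod_fiberwise_of_maps_to (t := Finset.univ) (g := Prod.fst)
    (fun v _ => Finset.mem_univ _)]
  refine Finset.prod_congr rfl fun c _ => ?_
  rw [slices, Finset.prod_image]
  · refine Finset.prod_congr rfl fun v hv => ?_
    rw [← (Finset.mem_filter.mp hv).2]
  · intro v hv w hw hvw
    exact Prod.ext ((Finset.mem_filter.mp hv).2.trans (Finset.mem_filter.mp hw).2.symm) hvw

/-- A subset of `Fin R × ℕ+` is a choice of modes for each orbit. There is one sign per mode, and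
within a slice these multiply to the parity of the slice. -/
lemma prod_neg_qVar {R : ℕ} (T : Finset (Fin R × ℕ+)) (q : ℂ) (e : ℕ) :
    ∏ v ∈ T, -qVar (fun _ => 1) q e v
      = (-1) ^ (oddSet (slices T)).card * q ^ (e * fockWeight (slices T)) := by
  rw [prod_slices, neg_one_pow_card_oddSet, fockWeight, Finset.mul_sum, ← Finset.prod_pow_eq_pow_sum,
    ← Finset.prod_mul_distrib]
  refine Finset.prod_congr rfl fun c _ => ?_
  rw [Finset.prod_neg, Finset.mul_sum, ← Finset.prod_pow_eq_pow_sum]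
  simp [qVar]

end Orbits

/-! ### The eigenvalues of the automorphism -/

section Eigenvalues

-- Comparing roots with multiplicity replaces the characteristic polynomial by a multiset identity,
-- which can be pushed forward under `z ↦ z^a` to treat the powers of `γ`.
open Polynomial in
lemma eigenvalues_eq {d N k r : ℕ} {lam : Fin d → ℂ}
    (h : (∏ j, (X - C (lam j))) * (X - 1) ^ k = ((X : ℂ[X]) ^ N - 1) ^ r) :
    Finset.univ.val.map lam + k • {1} = r • nthRoots N (1 : ℂ) := by
  have h1 := congrArg roots h
  have hne : (∏ j, (X - C (lam j))) * ((X : ℂ[X]) - 1) ^ k ≠ 0 :=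
    mul_ne_zero (Finset.prod_ne_zero_iff.mpr fun j _ => X_sub_C_ne_zero _)
      (pow_ne_zero _ (X_sub_C_ne_zero 1))
  rw [roots_mul hne, roots_pow, roots_pow, ← C_1, roots_X_sub_C] at h1
  rw [nthRoots, ← h1]
  congr 1
  rw [roots_prod _ _ (Finset.prod_ne_zero_iff.mpr fun j _ => X_sub_C_ne_zero _)]
  simp [Multiset.bind_singleton]

/-- Raising to a power prime to `N` permutes the `N`-th roots of unity. Hence all nontrivial powers
of `γ` have the same eigenvalues, and one computation serves every `g ≠ e`. -/
lemma map_pow_nthRoots {N a : ℕ} (hN : N.Prime) (ha : ¬N ∣ a) :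
    (Polynomial.nthRoots N (1 : ℂ)).map (· ^ a) = Polynomial.nthRoots N (1 : ℂ) := by
  have hζ := Complex.isPrimitiveRoot_exp N hN.ne_zero
  have hζa := hζ.pow_of_coprime a ((Nat.Prime.coprime_iff_not_dvd hN).mpr ha).symm
  conv_rhs => rw [hζa.nthRoots_eq (α := 1) (one_pow N)]
  rw [hζ.nthRoots_eq (α := 1) (one_pow N), Multiset.map_map]
  refine Multiset.map_congr rfl fun i _ => ?_
  simp [← pow_mul, mul_comm]

lemma eigenvalues_pow {d N k r a : ℕ} (hN : N.Prime) (ha : ¬N ∣ a) {lam : Fin d → ℂ}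
    (h : Finset.univ.val.map lam + k • {1} = r • Polynomial.nthRoots N (1 : ℂ)) :
    Finset.univ.val.map (fun j => lam j ^ a) + k • {1} = r • Polynomial.nthRoots N (1 : ℂ) := by
  have h1 := congrArg (Multiset.map (· ^ a)) h
  rw [Multiset.map_add, Multiset.map_nsmul, Multiset.map_nsmul, map_pow_nthRoots hN ha,
    Multiset.map_map, Multiset.map_singleton, one_pow] at h1
  exact h1

lemma prod_one_sub_eigenvalues {d N k r : ℕ} (hN : 0 < N) {lam : Fin d → ℂ}
    (h : Finset.univ.val.map lam + k • {1} = r • Polynomial.nthRoots N (1 : ℂ)) (y : ℂ) :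
    (∏ j, (1 - lam j * y)) * (1 - y) ^ k = (1 - y ^ N) ^ r := by
  have h1 := congrArg (fun s => (Multiset.map (fun z => 1 - z * y) s).prod) h
  simp only [Multiset.map_add, Multiset.map_nsmul, Multiset.map_map, Multiset.prod_add,
    Multiset.prod_nsmul, Multiset.map_singleton, Multiset.prod_singleton, one_mul] at h1
  have hζ := Complex.isPrimitiveRoot_exp N hN.ne'
  have h2 : ((Polynomial.nthRoots N (1 : ℂ)).map fun z => 1 - z * y).prod = 1 - y ^ N := by
    have h3 := hζ.pow_sub_pow_eq_prod_sub_mul 1 y hN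
    rw [one_pow] at h3
    rw [h3, Polynomial.nthRootsFinset_def, ← hζ.nthRoots_one_nodup.dedup]
    simp only [Finset.prod]
    congr 2
    simp [Multiset.toFinset, hζ.nthRoots_one_nodup.dedup]
  rw [h2] at h1
  exact h1

lemma sum_pow_eigenvalues {d N k r : ℕ} (hN : N.Prime) {lam : Fin d → ℂ}
    (h : Finset.univ.val.map lam + k • {1} = r • Polynomial.nthRoots N (1 : ℂ)) (m : ℕ) :
    ∑ j, lam j ^ m = (if N ∣ m then (N * r : ℂ) else 0) - k := by
  have h1 := congrArg (fun s => (Multiset.map (fun z => z ^ m) s).sum) h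
  simp only [Multiset.map_add, Multiset.map_nsmul, Multiset.map_map, Multiset.sum_add,
    Multiset.sum_nsmul, Multiset.map_singleton, Multiset.sum_singleton, one_pow] at h1
  have hζ := Complex.isPrimitiveRoot_exp N hN.ne_zero
  have h2 : ((Polynomial.nthRoots N (1 : ℂ)).map fun z => z ^ m).sum
      = if N ∣ m then (N : ℂ) else 0 := by
    split_ifs with hm
    · have h3 : (Polynomial.nthRoots N (1 : ℂ)).map (fun z => z ^ m)
          = (Polynomial.nthRoots N (1 : ℂ)).map fun _ => 1 := by
        refine Multiset.map_congr rfl fun z hz => ?_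
        obtain ⟨t, rfl⟩ := hm
        rw [pow_mul, (Polynomial.mem_nthRoots hN.pos).mp hz, one_pow]
      rw [h3, Multiset.map_const', Multiset.sum_replicate, hζ.card_nthRoots_one]
      simp
    · rw [map_pow_nthRoots hN hm, hζ.nthRoots_eq (α := 1) (one_pow N)]
      have := hζ.geom_sum_eq_zero hN.one_lt
      simpa [Finset.sum] using this
  rw [h2] at h1
  rw [eq_sub_iff_add_eq]
  refine Eq.trans ?_ (h1.trans ?_)
  · simp [Finset.sum]
  · split_ifs <;> simp [mul_comm]

end Eigenvalues

/-! ### The graded trace -/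

section GradedTrace

variable {N : ℕ}

/-- The sum of the diagonal entries of a power of `γσ`, weighted by `\tilde p(0) (L_1(0) - c_1/24)`
and graded by degree, over the basis of `W_tw`. -/
theorem hasSum_diagonal {R a : ℕ} {n : ℕ} (hn : 0 < n) {lam : Fin (24 * ell N) → ℂ}
    (hlam : ∀ j, ‖lam j‖ ≤ 1)
    (hprod : ∀ y : ℂ, (∏ j, (1 - lam j ^ a * y)) * (1 - y) ^ kdim N = (1 - y ^ n) ^ R)
    (hpow : ∀ m : ℕ, 0 < m → ∑ j, (lam j ^ a) ^ m
      = (if n ∣ m then (n * R : ℂ) else 0) - kdim N)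
    {π : Equiv.Perm (Fin (numFermions N))} {o : Fin (numFermions N) → Fin R}
    (hfib : ∀ c, (Finset.univ.filter fun x => o x = c).card = n)
    (hfix : ∀ f : Fin (numFermions N) → Finset ℕ+, f ∘ π.symm = f ↔ ∃ g, f = g ∘ o)
    (hsurj : Function.Surjective o) {sg : Finset (Fin (numFermions N)) → ℂ}
    (hsg : ∀ S : Finset (Fin (numFermions N)), S.map π.toEmbedding = S → ∀ t, S.card = n * t →
        sg S * (-1) ^ S.card = (-1) ^ t) {q : ℂ} (hq : ‖q‖ < 1) :
    HasSum (fun i : WIndex N => (wWeight i : ℂ) * ((wSign i : ℤ) : ℂ) *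
        (monom (fun v => lam v.1) i.1 ^ a *
          if i.2.1 ∘ π.symm = i.2.1 then sg (oddSet i.2.1) else 0) * q ^ wDeg i)
      (-(ell N : ℂ) + n * R * lambert (q ^ n) - kdim N * lambert q) := by
  have hlam' : ∀ j, ‖lam j ^ a‖ ≤ 1 := fun j => by
    rw [norm_pow]
    exact pow_le_one₀ (norm_nonneg _) (hlam j)
  have hmain := hasSum_trace_series hn hlam' hprod hpow hq (ell N : ℂ)
  -- `J` parametrizes the basis vectors fixed by the permutation: one set of modes is chosen per
  -- orbit and repeated along it.
  let J : (Fin (24 * ell N) × ℕ+ →₀ ℕ) × Finset (Fin R × ℕ+) × (Fin (kdim N) × ℕ+ →₀ ℕ) →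
      WIndex N := fun i => (i.1, slices i.2.1 ∘ o, i.2.2)
  have hJ : Function.Injective J := by
    rintro ⟨s, T, u⟩ ⟨s', T', u'⟩ h
    simp only [J, Prod.mk.injEq] at h
    have := (slices_bijective R).injective (hsurj.injective_comp_right h.2.1)
    rw [h.1, this, h.2.2]
  rw [← hJ.hasSum_iff]
  · convert hmain using 1
    ext ⟨s, T, u⟩
    have h1 : (slices T ∘ o) ∘ π.symm = slices T ∘ o := (hfix _).mpr ⟨_, rfl⟩
    have h2 := hsg (oddSet (slices T ∘ o)) (by rw [← oddSet_comp_symm, h1]) _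
      (card_oddSet_comp hfib (slices T))
    have h3 : (((wSign (N := N) (s, slices T ∘ o, u) : ℤˣ) : ℤ) : ℂ)
        = (-1) ^ (oddSet (slices T ∘ o)).card := by
      rw [wSign]
      push_cast
      rfl
    have h4 : monom (fun v : Fin (24 * ell N) × ℕ+ => lam v.1 ^ a) s
        = monom (fun v : Fin (24 * ell N) × ℕ+ => lam v.1) s ^ a := by
      rw [monom, monom, Finsupp.prod, Finsupp.prod, ← Finset.prod_pow]
      exact Finset.prod_congr rfl fun v _ => pow_right_comm _ _ _
    have h5 : monom (fun _ : Fin (kdim N) × ℕ+ => (1 : ℂ)) u = 1 := by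
      simp [monom]
    simp only [Function.comp_apply, J]
    rw [if_pos h1, h3, prod_neg_qVar, monom_qVar, monom_qVar, h4, h5, ← h2, wDeg, wWeight,
      fockWeight_comp hfib, pow_add, pow_add]
    push_cast
    ring
  -- A basis vector outside the image of `J` is moved by the permutation, so its diagonal entry is
  -- zero.
  · rintro ⟨s, f, u⟩ hi
    have : ¬f ∘ π.symm = f := by
      rw [hfix]
      rintro ⟨g, rfl⟩
      obtain ⟨T, rfl⟩ := (slices_bijective R).surjective g
      exact hi ⟨(s, T, u), rfl⟩
    simp only [if_neg this, mul_zero, zero_mul]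

/-- Both traces of a power of `γσ`, in terms of Lambert series. -/
theorem hasSum_diagonal_pow (hN : N.Prime) {lam : Fin (24 * ell N) → ℂ}
    (hlam : ∀ j, lam j ^ N = 1)
    (hchar : Finset.univ.val.map lam + kdim N • {1}
      = numCycles N • Polynomial.nthRoots N (1 : ℂ))
    {σ : Equiv.Perm (Fin (numFermions N))} (hσ : σ.cycleType = Multiset.replicate (numCycles N) N)
    {sg : ℕ → Finset (Fin (numFermions N)) → ℂ} (hsg0 : ∀ S, sg 0 S = 1)
    (hsg : ∀ a, ¬N ∣ a → ∀ S : Finset (Fin (numFermions N)), S.map (σ ^ a).toEmbedding = S →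
      ∀ t, S.card = N * t → sg a S * (-1) ^ S.card = (-1) ^ t)
    {a : ℕ} (ha : a < N) {q : ℂ} (hq : ‖q‖ < 1) :
    HasSum (fun i : WIndex N => (wWeight i : ℂ) * ((wSign i : ℤ) : ℂ) *
        (monom (fun v => lam v.1) i.1 ^ a *
          if i.2.1 ∘ (σ ^ a).symm = i.2.1 then sg a (oddSet i.2.1) else 0) * q ^ wDeg i)
      (-(ell N : ℂ) + numFermions N * lambert (if a = 0 then q else q ^ N)
        - kdim N * lambert q) := by
  have hlam' : ∀ j, ‖lam j‖ ≤ 1 := fun j =>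
    (Complex.norm_eq_one_of_pow_eq_one (hlam j) hN.ne_zero).le
  have hM : numFermions N = 24 * ell N + kdim N := by rw [numFermions_eq, kdim_mul_sq hN]
  by_cases h0 : a = 0
  · subst h0
    -- For the identity every tensor factor is an orbit by itself, so `n = 1`, `R = M`, and the
    -- product identity is `24 ℓ_N + k = M`.
    have h := hasSum_diagonal (N := N) (R := numFermions N) (a := 0) (n := 1) one_pos hlam'
      (fun y => by simp [hM, pow_add]) (fun m _ => by simp [hM])
      (π := σ ^ 0) (o := id)
      (fun c => by rw [Finset.card_eq_one]; exact ⟨c, by ext; simp⟩)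
      (fun f => ⟨fun _ => ⟨f, rfl⟩, fun _ => rfl⟩) Function.surjective_id (sg := sg 0)
      (fun S _ t ht => by rw [hsg0, one_mul, ht, one_mul]) hq
    simpa using h
  · have hda : ¬N ∣ a := Nat.not_dvd_of_pos_of_lt (Nat.pos_of_ne_zero h0) ha
    obtain ⟨o, ho, hfib⟩ := exists_orbit_map hN hσ rfl
    have hsurj : Function.Surjective o := fun c => by
      have : (Finset.univ.filter fun x => o x = c).Nonempty := by
        rw [← Finset.card_pos, hfib]
        exact hN.pos
      obtain ⟨x, hx⟩ := this
      exact ⟨x, (Finset.mem_filter.mp hx).2⟩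
    have hchar' := eigenvalues_pow hN hda hchar
    have h := hasSum_diagonal (N := N) hN.pos hlam'
      (prod_one_sub_eigenvalues hN.pos hchar') (fun m _ => sum_pow_eigenvalues hN hchar' m)
      hfib (comp_symm_eq_iff hN (perm_pow_eq_one hN hσ) hda ho hsurj) hsurj (hsg a hda) hq
    rw [if_neg h0]
    have hM' : (numFermions N : ℂ) = N * numCycles N := by
      rw [numFermions]
      push_cast
      rfl
    rw [hM']
    exact h

end GradedTrace

/-! ### The action of `ℤ/Nℤ` -/

/-- Stability of every eigenspace under `γσ` comes from this, since permuting tensor factors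
preserves degree, weight and sign. -/
lemma commute_of_monomial {V I : Type*} [AddCommGroup V] [Module ℂ V] (b : Module.Basis I ℂ V)
    {A X : Module.End ℂ V} {t c : I → ℂ} {φ : I → I} (hA : ∀ i, A (b i) = t i • b i)
    (hX : ∀ i, X (b i) = c i • b (φ i)) (ht : ∀ i, t (φ i) = t i) : Commute A X := by
  refine b.ext fun i => ?_
  rw [Module.End.mul_apply, Module.End.mul_apply, hX, hA, map_smul, map_smul, hA, hX, ht,
    smul_comm]

/-- The representation of `ℤ/Nℤ` in which `1` acts by an operator whose `N`-th power is `1`. -/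
def cyclicRep {V : Type*} [AddCommGroup V] [Module ℂ V] (N : ℕ) [NeZero N] {T : Module.End ℂ V}
    (hT : T ^ N = 1) : Representation ℂ (Multiplicative (ZMod N)) V where
  toFun g := T ^ g.toAdd.val
  map_one' := by simp
  map_mul' g h := by
    rw [toAdd_mul, ZMod.val_add, ← pow_add, ← pow_eq_pow_mod _ hT]

lemma cyclicRep_apply {V : Type*} [AddCommGroup V] [Module ℂ V] (N : ℕ) [NeZero N]
    {T : Module.End ℂ V} (hT : T ^ N = 1) (g : Multiplicative (ZMod N)) :
    cyclicRep N hT g = T ^ g.toAdd.val := rfl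

section Action

variable {N : ℕ} (e : Module.Basis (Fin (24 * ell N)) ℂ (Fin (24 * ell N) → ℂ))
  {lam : Fin (24 * ell N) → ℂ} {f : Module.End ℂ (Fin (24 * ell N) → ℂ)}
  {σ : Equiv.Perm (Fin (numFermions N))} {sigmaOp : Module.End ℂ (AtwTensor (numFermions N))}
  {sg : ℕ → Finset (Fin (numFermions N)) → ℂ}

/-- The action of a permutation of the tensor factors on the index set of the basis. -/
def permIndex (π : Equiv.Perm (Fin (numFermions N))) (i : WIndex N) : WIndex N :=
  (i.1, i.2.1 ∘ π.symm, i.2.2)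

lemma wWeight_permIndex (π : Equiv.Perm (Fin (numFermions N))) (i : WIndex N) :
    wWeight (permIndex π i) = wWeight i := rfl

lemma wSign_permIndex (π : Equiv.Perm (Fin (numFermions N))) (i : WIndex N) :
    wSign (permIndex π i) = wSign i := by
  rw [wSign, wSign, permIndex, oddSet_comp_symm, Finset.card_map]

lemma wDeg_permIndex (π : Equiv.Perm (Fin (numFermions N))) (i : WIndex N) :
    wDeg (permIndex π i) = wDeg i := by
  have h : fockWeight (i.2.1 ∘ π.symm) = fockWeight i.2.1 :=
    Equiv.sum_comp π.symm fun x => ∑ m ∈ i.2.1 x, (m : ℕ)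
  rw [wDeg, wDeg, permIndex, h]

lemma heisMap_pow_heisBasis (hf : ∀ j, f (e j) = lam j • e j) (a : ℕ)
    (s : Fin (24 * ell N) × ℕ+ →₀ ℕ) :
    (heisMap f ^ a) (heisBasis e s)
      = monom (fun v : Fin (24 * ell N) × ℕ+ => lam v.1) s ^ a • heisBasis e s := by
  induction a with
  | zero => rw [pow_zero, pow_zero, one_apply_eq_one_smul]
  | succ a ih =>
    rw [pow_succ, Module.End.mul_apply, heisMap_heisBasis e lam f hf, map_smul, ih, smul_smul,
      pow_succ']

lemma op_pow_wBasis (hf : ∀ j, f (e j) = lam j • e j)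
    (hsg : ∀ a g, (sigmaOp ^ a) (tensorBasis (numFermions N) g)
      = sg a (oddSet g) • tensorBasis (numFermions N) (g ∘ (σ ^ a).symm)) (a : ℕ) (i : WIndex N) :
    (op N (heisMap f) sigmaOp 1 ^ a) (wBasis e i)
      = (monom (fun v : Fin (24 * ell N) × ℕ+ => lam v.1) i.1 ^ a * sg a (oddSet i.2.1)) •
        wBasis e (permIndex (σ ^ a) i) := by
  rw [op_pow, op_wBasis_of_smul e (j := permIndex (σ ^ a) i) (heisMap_pow_heisBasis e hf a i.1)
    (hsg a i.2.1) (one_apply_eq_one_smul _), mul_one]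

lemma op_pow_eq_one (hf : ∀ j, f (e j) = lam j • e j) (hlam : ∀ j, lam j ^ N = 1)
    (hσ : σ ^ N = 1)
    (hsg : ∀ a g, (sigmaOp ^ a) (tensorBasis (numFermions N) g)
      = sg a (oddSet g) • tensorBasis (numFermions N) (g ∘ (σ ^ a).symm))
    (hsgN : ∀ S, sg N S = 1) : op N (heisMap f) sigmaOp 1 ^ N = 1 := by
  refine (wBasis e).ext fun i => ?_
  have h : monom (fun v : Fin (24 * ell N) × ℕ+ => lam v.1) i.1 ^ N = 1 := by
    rw [monom, Finsupp.prod, ← Finset.prod_pow]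
    exact Finset.prod_eq_one fun v _ => by rw [pow_right_comm, hlam, one_pow]
  rw [op_pow_wBasis e hf hsg, h, hsgN, mul_one, one_smul, hσ]
  rfl

lemma repr_op_pow_wBasis (hf : ∀ j, f (e j) = lam j • e j)
    (hsg : ∀ a g, (sigmaOp ^ a) (tensorBasis (numFermions N) g)
      = sg a (oddSet g) • tensorBasis (numFermions N) (g ∘ (σ ^ a).symm)) (a : ℕ) (i : WIndex N) :
    (wBasis e).repr ((op N (heisMap f) sigmaOp 1 ^ a) (wBasis e i)) i
      = monom (fun v : Fin (24 * ell N) × ℕ+ => lam v.1) i.1 ^ a *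
        if i.2.1 ∘ (σ ^ a).symm = i.2.1 then sg a (oddSet i.2.1) else 0 := by
  classical
  rw [op_pow_wBasis e hf hsg, map_smul, Module.Basis.repr_self, Finsupp.smul_apply,
    Finsupp.single_apply, smul_eq_mul]
  have h : permIndex (σ ^ a) i = i ↔ i.2.1 ∘ (σ ^ a).symm = i.2.1 := by
    obtain ⟨s, g, u⟩ := i
    simp [permIndex]
  simp only [h]
  split_ifs <;> ring

variable (B : LinearMap.BilinForm ℂ (Fin (24 * ell N) → ℂ)) (hB : B.Nondegenerate)
  (C : LinearMap.BilinForm ℂ (Fin (kdim N) → ℂ)) (hC : C.Nondegenerate)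

lemma commute_shiftedL_pTildeW (hN : N.Prime) :
    Commute (shiftedL N B hB C hC) (pTildeW N) :=
  commute_of_monomial (wBasis (Pi.basisFun ℂ _)) (φ := id) (shiftedL_wBasis _ hN B hB C hC)
    (pTildeW_wBasis _) fun _ => rfl

lemma commute_shiftedL_shiftedL1 (hN : N.Prime) :
    Commute (shiftedL N B hB C hC) (shiftedL1 N B hB) :=
  commute_of_monomial (wBasis (Pi.basisFun ℂ _)) (φ := id) (shiftedL_wBasis _ hN B hB C hC)
    (shiftedL1_wBasis _ B hB) fun _ => rfl

lemma mem_eigenspace_of_commute {V : Type*} [AddCommGroup V] [Module ℂ V] {A X : Module.End ℂ V}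
    (h : Commute A X) {μ : ℂ} {v : V} (hv : v ∈ Module.End.eigenspace A μ) :
    X v ∈ Module.End.eigenspace A μ := by
  rw [Module.End.mem_eigenspace_iff] at hv ⊢
  rw [← Module.End.mul_apply, h.eq, Module.End.mul_apply, hv, map_smul]

lemma finePiece_le_comap (hN : N.Prime) (hf : ∀ j, f (e j) = lam j • e j)
    (hsg : ∀ a g, (sigmaOp ^ a) (tensorBasis (numFermions N) g)
      = sg a (oddSet g) • tensorBasis (numFermions N) (g ∘ (σ ^ a).symm)) (a n : ℕ) (m : ℤ)
    (ε : ℤˣ) : finePiece N B hB C hC n m ε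
      ≤ (finePiece N B hB C hC n m ε).comap (op N (heisMap f) sigmaOp 1 ^ a) := by
  have hX := op_pow_wBasis e hf hsg a
  have h1 := commute_of_monomial (wBasis e) (shiftedL_wBasis e hN B hB C hC) hX fun i => by
    rw [wDeg_permIndex]
  have h2 := commute_of_monomial (wBasis e) (shiftedL1_wBasis e B hB) hX fun i => by
    rw [wWeight_permIndex]
  have h3 := commute_of_monomial (wBasis e) (pTildeW_wBasis e) hX fun i => by
    rw [wSign_permIndex]
  exact fun v hv => ⟨⟨mem_eigenspace_of_commute h1 hv.1.1, mem_eigenspace_of_commute h2 hv.1.2⟩,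
    mem_eigenspace_of_commute h3 hv.2⟩

lemma mapsTo_gradedPiece (hN : N.Prime) (hf : ∀ j, f (e j) = lam j • e j)
    (hsg : ∀ a g, (sigmaOp ^ a) (tensorBasis (numFermions N) g)
      = sg a (oddSet g) • tensorBasis (numFermions N) (g ∘ (σ ^ a).symm)) (a n : ℕ) :
    ∀ w ∈ gradedPiece N B hB C hC n,
      (op N (heisMap f) sigmaOp 1 ^ a * pTildeW N * shiftedL1 N B hB) w
        ∈ gradedPiece N B hB C hC n := by
  have h1 := commute_of_monomial (wBasis e) (shiftedL_wBasis e hN B hB C hC)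
    (op_pow_wBasis e hf hsg a) fun i => by rw [wDeg_permIndex]
  exact fun w hw => mem_eigenspace_of_commute ((h1.mul_right (commute_shiftedL_pTildeW B hB C hC
    hN)).mul_right (commute_shiftedL_shiftedL1 B hB C hC hN)) hw

/-- Both traces are the sum of the diagonal entries of `ρ g` weighted by the two eigenvalues. Only
the other two operators have to be diagonal, so the standard basis of `𝔥` suffices. -/
lemma trace_restrict_gradedPiece (hN : N.Prime) {G : Type} [Group G]
    (ρ : Representation ℂ G (Wtw N)) (hfin : ∀ n, FiniteDimensional ℂ (gradedPiece N B hB C hC n))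
    (hst : ∀ n m ε g, finePiece N B hB C hC n m ε ≤ (finePiece N B hB C hC n m ε).comap (ρ g))
    (n : ℕ) (g : G)
    (h : ∀ w ∈ gradedPiece N B hB C hC n,
      (ρ g * pTildeW N * shiftedL1 N B hB) w ∈ gradedPiece N B hB C hC n) :
    LinearMap.trace ℂ _ ((ρ g * pTildeW N * shiftedL1 N B hB).restrict h)
      = VirtualRep.trace g (virtualPiece N B hB C hC ρ hfin hst n) := by
  let e := Pi.basisFun ℂ (Fin (24 * ell N))
  rw [trace_virtualPiece e B hB C hC hN, trace_eq_sum_repr (mem_gradedPiece_iff e B hB C hC hN n)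
    _ (ρ g * pTildeW N * shiftedL1 N B hB) fun u => rfl]
  refine Finset.sum_congr rfl fun i _ => ?_
  rw [Module.End.mul_apply, Module.End.mul_apply, shiftedL1_wBasis, map_smul, pTildeW_wBasis,
    smul_smul, map_smul, map_smul, Finsupp.smul_apply, smul_eq_mul]

end Action

/-! ### The Eisenstein series -/

lemma E2_eq_lambert (τ : UpperHalfPlane) : EisensteinSeries.E2 τ
    = 1 - 24 * lambert (Complex.exp (2 * Real.pi * Complex.I * (τ : ℂ))) := by
  have hq := UpperHalfPlane.norm_exp_two_pi_I_lt_one τ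
  have h := tsum_prod_pow_eq_tsum_sigma 1 hq
  have hs : Summable fun c : ℕ+ × ℕ+ => (c.2 : ℂ) ^ 1 *
      Complex.exp (2 * Real.pi * Complex.I * (τ : ℂ)) ^ (c.1 * c.2 : ℕ) :=
    summable_prod_mul_pow 1 hq
  rw [EisensteinSeries.E2_eq_tsum_cexp, lambert, ← h, ← hs.tsum_prod]
  simp only [pow_one]

lemma E2_mul_eq_lambert {N : ℕ} (hN : 0 < N) (τ : UpperHalfPlane) :
    EisensteinSeries.E2 (UpperHalfPlane.ofComplex ((N : ℂ) * (τ : ℂ)))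
      = 1 - 24 * lambert (Complex.exp (2 * Real.pi * Complex.I * (τ : ℂ)) ^ N) := by
  have him : 0 < ((N : ℂ) * (τ : ℂ)).im := by
    rw [← Complex.ofReal_natCast, Complex.im_ofReal_mul]
    exact mul_pos (Nat.cast_pos.mpr hN) τ.im_pos
  rw [E2_eq_lambert, UpperHalfPlane.ofComplex_apply_of_im_pos him, ← Complex.exp_nat_mul]
  congr 4
  change _ * ((N : ℂ) * (τ : ℂ)) = _
  ring

/-- In `-ℓ_N E_{2,N}` the Lambert series carry the factor `24 ℓ_N / (N² - 1) = k`, which gives `kN²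
= M` at `q^N` and `-k` at `q`. For `g = e` the coefficient is `24 ℓ_N = M - k`. -/
lemma traceFunction_eq_lambert {N : ℕ} (hN : N.Prime) (g : Multiplicative (ZMod N))
    (τ : UpperHalfPlane) : traceFunction N g τ
      = -(ell N : ℂ) + numFermions N * lambert (if g.toAdd.val = 0
          then Complex.exp (2 * Real.pi * Complex.I * (τ : ℂ))
          else Complex.exp (2 * Real.pi * Complex.I * (τ : ℂ)) ^ N)
        - kdim N * lambert (Complex.exp (2 * Real.pi * Complex.I * (τ : ℂ))) := by
  have h1 : (kdim N : ℂ) * N ^ 2 = 24 * ell N + kdim N := by exact_mod_cast kdim_mul_sq hN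
  have h2 : (numFermions N : ℂ) = kdim N * N ^ 2 := by exact_mod_cast numFermions_eq N
  have hg : g.toAdd.val = 0 ↔ g = 1 := by
    rw [ZMod.val_eq_zero, ← ofAdd_eq_one]
    rfl
  simp only [hg, traceFunction]
  split_ifs with h
  · rw [E2_eq_lambert]
    linear_combination -lambert (Complex.exp (2 * Real.pi * Complex.I * (τ : ℂ))) * (h1 + h2)
  · have hN1 : (N : ℂ) - 1 ≠ 0 := sub_ne_zero.mpr (by exact_mod_cast hN.one_lt.ne')
    have hN2 : (N : ℂ) + 1 ≠ 0 := by exact_mod_cast N.succ_ne_zero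
    have h3 : (ell N : ℂ) = kdim N * (((N : ℂ) + 1) * ((N : ℂ) - 1)) / 24 := by
      linear_combination -h1 / 24
    rw [E2level, E2_mul_eq_lambert hN.pos, E2_eq_lambert, h2, h3]
    field_simp
    ring

/-! ### Assembling the graded trace -/

lemma hasSum_wFiber {N : ℕ} {G : WIndex N → ℂ} {q s : ℂ}
    (h : HasSum (fun i => G i * q ^ wDeg i) s) :
    HasSum (fun n => (∑ i ∈ wFiber N n, G i) * q ^ n) s := by
  refine (h.tsum_fiberwise wDeg).congr_fun fun n => ?_
  have h1 : wDeg ⁻¹' {n} = (wFiber N n : Set (WIndex N)) := by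
    ext i
    simp [mem_wFiber]
  rw [h1, Finset.tsum_subtype' (wFiber N n) fun i => G i * q ^ wDeg i, Finset.sum_mul]
  exact Finset.sum_congr rfl fun i hi => by rw [mem_wFiber.mp hi]

/-! ### Infinitude -/

lemma ell_pos {N : ℕ} (hN : N.Prime) : 0 < ell N := by
  have h := kdim_mul_sq hN
  have hk : 0 < kdim N := by
    unfold kdim
    split_ifs <;> norm_num
  refine Nat.pos_of_ne_zero fun h0 => ?_
  have h2 : 2 ^ 2 ≤ N ^ 2 := Nat.pow_le_pow_left hN.two_le 2
  rw [h0] at h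
  nlinarith

lemma not_finiteDimensional_Wtw {N : ℕ} (hN : N.Prime) : ¬FiniteDimensional ℂ (Wtw N) := by
  intro h
  have hf := Module.Finite.finite_basis (wBasis (N := N) (Pi.basisFun ℂ _))
  have : Nonempty (Fin (24 * ell N)) := ⟨⟨0, Nat.mul_pos (by norm_num) (ell_pos hN)⟩⟩
  exact not_finite (WIndex N)

/-- For real `x` all terms are nonnegative, so the single term with index `(1, K)` is a lower bound.
-/
lemma le_norm_lambert {x : ℝ} (h0 : 0 ≤ x) (h1 : x < 1) (K : ℕ+) :
    (K : ℝ) * x ^ (K : ℕ) ≤ ‖lambert (x : ℂ)‖ := by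
  have hs := summable_lambert (q := (x : ℂ)) (by rwa [Complex.norm_real, Real.norm_of_nonneg h0])
  have he : ∀ c : ℕ+ × ℕ+, (c.2 : ℂ) * (x : ℂ) ^ (c.1 * c.2 : ℕ)
      = ((c.2 * x ^ (c.1 * c.2 : ℕ) : ℝ) : ℂ) := fun c => by push_cast; rfl
  simp only [he] at hs
  rw [lambert]
  simp only [he]
  rw [← Complex.ofReal_tsum, Complex.norm_real]
  have hs' := Complex.summable_ofReal.mp hs
  refine le_trans ?_ ((hs'.le_tsum (1, K) fun c _ => by positivity).trans (le_abs_self _))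
  simp

/-- With finitely many nonzero coefficients the series would be bounded by `∑ ‖t n‖` on the unit
disc, whereas `E_2` grows without bound as `q → 1` along the reals. -/
lemma infinite_of_hasSum_E2 {l : ℕ} (hl : 0 < l) {t : ℕ → ℂ}
    (h : ∀ τ : UpperHalfPlane, HasSum
      (fun n => t n * Complex.exp (2 * Real.pi * Complex.I * (τ : ℂ)) ^ n)
      (-(l : ℂ) * EisensteinSeries.E2 τ)) : {n | t n ≠ 0}.Infinite := by
  intro hfin
  obtain ⟨K, hK⟩ := exists_nat_gt ((∑ n ∈ hfin.toFinset, ‖t n‖) + 1)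
  have hpos : 0 ≤ ∑ n ∈ hfin.toFinset, ‖t n‖ := Finset.sum_nonneg fun _ _ => norm_nonneg _
  have hK0 : 0 < (K : ℝ) := by linarith
  have hlog := Real.log_pos one_lt_two
  -- Chosen so that `x = e^{-2πy}` satisfies `x^K = 1/2`. The Lambert series is then at least `K/2`,
  -- which contradicts the choice of `K`.
  let y : ℝ := Real.log 2 / (2 * Real.pi * K)
  have hy : 0 < y := by positivity
  let τ : UpperHalfPlane := ⟨Complex.I * y, by simpa using hy⟩
  have hτ : Complex.exp (2 * Real.pi * Complex.I * (τ : ℂ))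
      = ((Real.exp (-(2 * Real.pi * y)) : ℝ) : ℂ) := by
    rw [Complex.ofReal_exp]
    congr 1
    change 2 * Real.pi * Complex.I * (Complex.I * y) = _
    push_cast
    linear_combination 2 * Real.pi * y * Complex.I_mul_I
  set x := Real.exp (-(2 * Real.pi * y)) with hx
  have hx1 : x < 1 := by
    rw [hx, Real.exp_lt_one_iff]
    have := Real.pi_pos
    nlinarith [mul_pos this hy]
  have hxK : x ^ K = 1 / 2 := by
    rw [hx, ← Real.exp_nat_mul]
    have : (K : ℝ) * -(2 * Real.pi * y) = -Real.log 2 := by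
      simp only [y]
      field_simp
    rw [this, Real.exp_neg, Real.exp_log two_pos, one_div]
  have hle := le_norm_lambert (Real.exp_pos _).le hx1 ⟨K, by exact_mod_cast hK0⟩
  rw [PNat.mk_coe, hxK] at hle
  have hsum := (h τ).unique (hasSum_sum_of_ne_finset_zero (s := hfin.toFinset) fun n hn => by
    rw [Set.Finite.mem_toFinset, Set.mem_ofPred_eq, not_not] at hn
    rw [hn, zero_mul])
  rw [E2_eq_lambert, hτ] at hsum
  have hb : ‖∑ n ∈ hfin.toFinset, t n * (x : ℂ) ^ n‖ ≤ ∑ n ∈ hfin.toFinset, ‖t n‖ := by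
    refine (norm_sum_le _ _).trans (Finset.sum_le_sum fun n _ => ?_)
    rw [norm_mul, norm_pow, Complex.norm_real, Real.norm_of_nonneg (Real.exp_pos _).le]
    exact mul_le_of_le_one_right (norm_nonneg _) (pow_le_one₀ (Real.exp_pos _).le hx1.le)
  rw [← hsum] at hb
  have hl1 : (1 : ℝ) ≤ l := by exact_mod_cast hl
  have hn : (l : ℝ) * (24 * ‖lambert (x : ℂ)‖ - 1) ≤ ‖-(l : ℂ) * (1 - 24 * lambert (x : ℂ))‖ := by
    rw [norm_mul, norm_neg, Complex.norm_natCast]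
    refine mul_le_mul_of_nonneg_left ?_ (Nat.cast_nonneg l)
    have := norm_sub_norm_le (24 * lambert (x : ℂ)) 1
    rw [norm_sub_rev]
    simpa using this
  nlinarith

end PurelyEisenstein

end

theorem mainTheorem3 (N : ℕ) (hN : N.Prime)
    -- the invariant form on `𝔥 = ℂ^{24 ℓ_N}` and the automorphism `γ` of `𝔥`
    (B : LinearMap.BilinForm ℂ (Fin (24 * ell N) → ℂ)) (hBsymm : B.IsSymm) (hB : B.Nondegenerate)
    (γ : (Fin (24 * ell N) → ℂ) ≃ₗ[ℂ] (Fin (24 * ell N) → ℂ)) (hγ : orderOf γ = N)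
    (hγchar : γ.toLinearMap.charpoly * (Polynomial.X - 1) ^ kdim N
      = (Polynomial.X ^ N - 1) ^ numCycles N)
    (hγB : ∀ x y, B (γ x) (γ y) = B x y)
    -- the form on `𝔨`
    (C : LinearMap.BilinForm ℂ (Fin (kdim N) → ℂ)) (hCsymm : C.IsSymm) (hC : C.Nondegenerate)
    -- the permutation `σ` and its action on the tensor factors
    (σ : Equiv.Perm (Fin (numFermions N))) (hσ : σ.cycleType = Multiset.replicate (numCycles N) N)
    (sigmaOp : Module.End ℂ (AtwTensor (numFermions N)))
    (hsigmaOp : sigmaOp = koszulPerm σ ∨ (N ≠ 2 ∧ sigmaOp = plainPerm σ)) :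
    -- `ℤ/Nℤ` acts on `W_tw` through `γσ`
    ∃ ρ : Representation ℂ (Multiplicative (ZMod N)) (Wtw N),
      ρ (Multiplicative.ofAdd 1) = op N (heisMap γ.toLinearMap) sigmaOp 1 ∧
      -- `W_tw` is the direct sum of the `W_{tw,n}`, which are finite-dimensional and are the sums
      -- of their invariant subspaces `finePiece n m ε`
      DirectSum.IsInternal (gradedPiece N B hB C hC) ∧
      (∀ n, gradedPiece N B hB C hC n
        = ⨆ m ∈ weights N n, ⨆ ε : ℤˣ, finePiece N B hB C hC n m ε) ∧
      ∃ (hfin : ∀ n, FiniteDimensional ℂ (gradedPiece N B hB C hC n))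
        (hst : ∀ n m ε g,
          finePiece N B hB C hC n m ε ≤ (finePiece N B hB C hC n m ε).comap (ρ g)),
        -- infinite-dimensionality, of the space and of the virtual module
        ¬ FiniteDimensional ℂ (Wtw N) ∧
        {n | virtualPiece N B hB C hC ρ hfin hst n ≠ 0}.Infinite ∧
        -- the trace of `g` on the virtual module is that of `g p̃(0) (L_1(0) - c_1 / 24)`
        (∀ n g, ∃ h : ∀ w ∈ gradedPiece N B hB C hC n,
            (ρ g * pTildeW N * shiftedL1 N B hB) w ∈ gradedPiece N B hB C hC n,
          LinearMap.trace ℂ _ ((ρ g * pTildeW N * shiftedL1 N B hB).restrict h)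
            = VirtualRep.trace g (virtualPiece N B hB C hC ρ hfin hst n)) ∧
        -- the graded traces are the functions `F_g`
        ∀ (g : Multiplicative (ZMod N)) (τ : UpperHalfPlane),
          HasSum (fun n : ℕ => VirtualRep.trace g (virtualPiece N B hB C hC ρ hfin hst n) *
              Complex.exp (2 * Real.pi * Complex.I * (τ : ℂ)) ^ n)
            (traceFunction N g τ) := by
  have : NeZero N := ⟨hN.ne_zero⟩
  have : Fact (1 < N) := ⟨hN.one_lt⟩
  have hf1 : γ.toLinearMap ^ N = 1 := by
    have h := pow_orderOf_eq_one γ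
    rw [hγ] at h
    have h2 : ∀ a : ℕ, γ.toLinearMap ^ a = (γ ^ a).toLinearMap := fun a => by
      induction a with
      | zero => rfl
      | succ a ih => rw [pow_succ, ih, pow_succ]; rfl
    rw [h2, h]
    rfl
  -- This eigenbasis of `γ` determines the basis of `W_tw` used for the action and its traces.
  obtain ⟨e, lam, hf, hlam, hchar⟩ := exists_eigenbasis hN.ne_zero γ.toLinearMap hf1
  rw [hchar] at hγchar
  have hev := eigenvalues_eq hγchar
  obtain ⟨sg, hsg, hsg0, hsgN, hsgS⟩ := exists_sign hN hσ rfl sigmaOp hsigmaOp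
  have hT := op_pow_eq_one e hf hlam (perm_pow_eq_one hN hσ) hsg hsgN
  have hst : ∀ n m ε g, finePiece N B hB C hC n m ε
      ≤ (finePiece N B hB C hC n m ε).comap (cyclicRep N hT g) := fun n m ε g =>
    finePiece_le_comap e B hB C hC hN hf hsg _ n m ε
  have hfin := finiteDimensional_gradedPiece B hB C hC hN
  have hsum : ∀ (g : Multiplicative (ZMod N)) (τ : UpperHalfPlane),
      HasSum (fun n : ℕ => VirtualRep.trace g
          (virtualPiece N B hB C hC (cyclicRep N hT) hfin hst n) *
          Complex.exp (2 * Real.pi * Complex.I * (τ : ℂ)) ^ n) (traceFunction N g τ) := by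
    intro g τ
    have h := hasSum_wFiber (hasSum_diagonal_pow hN hlam hev hσ hsg0 hsgS
      (ZMod.val_lt g.toAdd) (UpperHalfPlane.norm_exp_two_pi_I_lt_one τ))
    rw [← traceFunction_eq_lambert hN g τ] at h
    simpa only [trace_virtualPiece e B hB C hC hN, cyclicRep_apply,
      repr_op_pow_wBasis e hf hsg] using h
  refine ⟨cyclicRep N hT, ?_, isInternal_gradedPiece B hB C hC hN,
    gradedPiece_eq_iSup B hB C hC hN, hfin, hst, not_finiteDimensional_Wtw hN, ?_,
    fun n g => ⟨mapsTo_gradedPiece e B hB C hC hN hf hsg _ n,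
      trace_restrict_gradedPiece B hB C hC hN _ hfin hst n g _⟩, hsum⟩
  · rw [cyclicRep_apply, toAdd_ofAdd, ZMod.val_one, pow_one]
  -- A zero virtual module has trace zero, so it suffices that the trace of the identity is nonzero
  -- in infinitely many degrees.
  · have hinf := infinite_of_hasSum_E2 (ell_pos hN) fun τ => by
      have h := hsum 1 τ
      rw [traceFunction, if_pos rfl] at h
      exact h
    refine Set.Infinite.mono (fun n hn => ?_) hinf
    rw [Set.mem_ofPred_eq] at hn ⊢
    exact fun h0 => hn ((congrArg (VirtualRep.trace 1) h0).trans (map_zero _))
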